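/- Let $p$ be an odd prime and consider the hypercubic lattice $\mathbb Z^d$ with its cubical cochains, coboundary $\delta$ and higher cup products $\cup_i$ ($\cup_0=\cup$). For a cell $s$ let $\boldsymbol s$ be the dual cochain, and let $\int$ denote summation over all $d$-cells. One or several $p$-dimensional qudits sit on each $n$-cell. A *Clifford QCA* is a symplectic automorphism of the finitely supported Pauli operators modulo phase that has finite range; a *finite-depth Clifford circuit* is a product of finitely many symplectic automorphisms, each block-diagonal for a partition of the qudits into blocks of uniformly bounded diameter. For a matrix $K$ over $\mathbb Z_p$, with $d=2n-1$, the *gauged ground state* $\Psi_K$ of the action $\frac1p\sum_{i,j}K_{ij}\int A_i\cup A_j$, where $A_1,\dots,A_N$ are $\mathbb Z_p$-valued of degree $n$, is $\sum_{a}\exp\bigl(\frac{2\pi i}{p}\sum_{i,j} K_{ij}\int\varphi_i\cup\delta\varphi_j\bigr)|a\rangle$, summed over the $a=\delta\varphi$ with $\varphi$ finitely supported. (The amplitude depends on $a$ only.) A Clifford QCA *disentangles* a state if it maps the group generated by all $Z_s$ onto the stabilizer group of the state (modulo phase). 1. (Sign relations.) For a $q_1$-cochain $\boldsymbol c$ and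 a $q_2$-cochain $\boldsymbol d$ over any commutative ring, $\delta(\boldsymbol c\cup\boldsymbol d)=\delta\boldsymbol c\cup\boldsymbol d+(-1)^{q_1}\boldsymbol c\cup\delta\boldsymbol d$, and for $i\ge1$ $$\delta(\boldsymbol c\cup_i\boldsymbol d)=\delta\boldsymbol c\cup_i\boldsymbol d+(-1)^{q_1}\boldsymbol c\cup_i\delta\boldsymbol d+(-1)^{q_1+q_2-i}\boldsymbol c\cup_{i-1}\boldsymbol d+(-1)^{q_1q_2+q_1+q_2}\boldsymbol d\cup_{i-1}\boldsymbol c ;$$ the same formula with literally the same signs holds if both degrees are raised by two. 2. (Dimension $d=4l-1$, $l\ge1$.) Put one qudit on each $2l$-cell and let $k\in\mathbb Z_p$, $k\neq0$. With $e$ ranging over $(2l-1)$-cells and $s,s'$ over $2l$-cells let $$G_e=X_{\delta\boldsymbol e}\prod_{s}Z_{s}^{k\int\delta\boldsymbol e\cup_1\boldsymbol s},\qquad \overline Z_s=Z_s\prod_eG_e^{\frac1{2k}\int\boldsymbol e\cup\boldsymbol s},\qquad \overline X_s=X_s\prod_{s'}\Bigl[\prod_eG_e^{-\frac12\int\boldsymbol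 e\cup\boldsymbol s'}\Bigr]^{\int\boldsymbol s'\cup_1\boldsymbol s}.$$ Then, modulo phases, $Z_s\mapsto\overline Z_s$, $X_s\mapsto\overline X_s$ defines a Clifford QCA. The $\overline Z_s$ generate the same group as the Hamiltonian terms $Z_{\partial t}$ ($t$ a $(2l+1)$-cell) and $X_{\delta\boldsymbol e}\prod_sZ_s^{k\int(\boldsymbol s\cup\boldsymbol e+\boldsymbol e\cup\boldsymbol s)}$, and this is the stabilizer group of the gauged ground state of $\frac kp\int A_{2l}\cup A_{2l}$; so the QCA disentangles this state. 3. (Identity.) For $k\in\mathbb Z_p$ and every $\mathbb Z_p$-valued cocycle $A=A_{2l+1}$ of degree $2l+1$ ($l\ge0$) on a hypercubic lattice of any dimension, as $\mathbb R/\mathbb Z$-valued cochains, $$\frac kp\,A\cup A=\delta\Bigl(\frac{k(p-1)/2}{p}\,A\cup_1A\Bigr).$$ 4. (Dimension $d=4l+1$, $l\ge0$.) Put $N\ge 1$ qudits, labelled by $i=1,\dots,N$, on each $(2l+1)$-cell. For every $k\in\mathbb Z_p$ and every $i$, conjugation by the diagonal unitary $V:|a\rangle\mapsto\exp\bigl(2\pi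 i\,\frac{k(p-1)/2}{p}\int a_i\cup_1a_i\bigr)|a\rangle$ maps Pauli operators to Pauli operators up to phase, and it is a finite-depth Clifford circuit $\theta$. For every $K$, with $K'$ obtained from $K$ by adding $\frac kp\int A_i\cup A_i$ to the action, $V\Psi_K=\Psi_{K'}$, $\theta$ maps the stabilizer group of $\Psi_K$ onto that of $\Psi_{K'}$, and a Clifford QCA $\alpha$ disentangles $\Psi_K$ if and only if $\theta\circ\alpha$ disentangles $\Psi_{K'}$. In particular ($N=1$, $K=0$) the gauged ground state of $\frac kp\int A_{2l+1}\cup A_{2l+1}$ is obtained from that of the zero action by a Clifford circuit; the term $\frac kp A_{2l+1}\cup A_{2l+1}$ contributes no nontrivial $\mathbb Z_p$ QCA. -/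

import Mathlib

noncomputable section

namespace CupQCA

/-! ### Cochains and higher cup products on the hypercubic lattice `ℤ^d` -/

/-- The sets of `n` coordinate directions of `ℤ^d`. -/
abbrev Dirs (d n : ℕ) := {S : Finset (Fin d) // S.card = n}

/-- The `n`-cells of the hypercubic lattice: `(x, S)` is the unit cube based at `x` that extends in
the directions of `S`, i.e. the product of `[x j, x j + 1]` (`j ∈ S`) and of `{x j}` (`j ∉ S`). -/
abbrev Cell (d n : ℕ) := (Fin d → ℤ) × Dirs d n

/-- `M`-valued `n`-cochains. -/
abbrev Cochain (d n : ℕ) (M : Type*) := Cell d n → M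

/-- The vertex `x` moved by one unit in each of the directions of `T`. -/
def shift {d : ℕ} (x : Fin d → ℤ) (T : Finset (Fin d)) : Fin d → ℤ :=
  fun j => x j + if j ∈ T then 1 else 0

/-- `δ a (c) = a (∂ c)` with `∂ (•,…,•) = ∑ (-1)^(ℓ + ε) (•,…,ε,…,•)`, where the `ℓ`-th `•` (counted
from `1`) is replaced by `ε ∈ {0, 1}`. -/
def coboundary {d n : ℕ} {M : Type*} [AddCommGroup M] (a : Cochain d n M) : Cochain d (n + 1) M :=
  fun c => ∑ j : {j // j ∈ c.2.1},
    ((-1 : ℤ) ^ (c.2.1.filter (fun t => t < j.1)).card) •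
      (a (shift c.1 {j.1}, ⟨c.2.1.erase j.1, by
          rw [Finset.card_erase_of_mem j.2, c.2.2]; rfl⟩) -
        a (c.1, ⟨c.2.1.erase j.1, by
          rw [Finset.card_erase_of_mem j.2, c.2.2]; rfl⟩))

/-- The number of pairs `(u, v) ∈ U × V` with `v < u`. -/
def inversions {d : ℕ} (U V : Finset (Fin d)) : ℕ :=
  ((U ×ˢ V).filter (fun w => w.2 < w.1)).card

/-- The number of elements of `U` below `j`. -/
def below {d : ℕ} (U : Finset (Fin d)) (j : Fin d) : ℕ := (U.filter (fun t => t < j)).card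

/-- The higher cup product `a ∪_i b` on the hypercubic lattice. On the cube `(x, S)` it is a signed
sum over the pairs of faces with direction sets `A ∪ B = S` that have exactly `i` common directions.
A direction `j` of `A` alone contributes the coordinate pair `(•, 1)` and a direction of `B` alone the
pair `(0, •)`, if an even number of common directions precede `j`; they contribute
`(•, 0)` and `(1, •)` if this number is odd. A cup product of a `p`- and a `q`-cochain has degree
`r = p + q - i`; for another `r` this definition returns `0`. -/
def cup {d : ℕ} (i : ℕ) {p q r : ℕ} {R : Type*} [CommRing R]
    (a : Cochain d p R) (b : Cochain d q R) : Cochain d r R :=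
  fun c => ∑ A : Dirs d p, ∑ B : Dirs d q,
    if A.1 ∪ B.1 = c.2.1 ∧ (A.1 ∩ B.1).card = i then
      (-1) ^ (inversions (A.1 \ B.1) (B.1 \ A.1) + i * (B.1 \ A.1).card) *
        a (shift c.1 ((B.1 \ A.1).filter (fun j => Odd (below (A.1 ∩ B.1) j))), A) *
        b (shift c.1 ((A.1 \ B.1).filter (fun j => Even (below (A.1 ∩ B.1) j))), B)
    else 0

/-- The coboundary formula for `∪_{i+1}` on `p`- and `q`-cochains with the signs `ε₁, ε₂, ε₃`. -/
def CupRelation (d : ℕ) (R : Type*) [CommRing R] (i p q : ℕ) (ε₁ ε₂ ε₃ : ℤ) : Prop :=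
  ∀ r : ℕ, p + q = r + (i + 1) → ∀ (a : Cochain d p R) (b : Cochain d q R),
    coboundary (cup (i + 1) a b : Cochain d r R) =
      cup (i + 1) (coboundary a) b + ε₁ • cup (i + 1) a (coboundary b) +
        ε₂ • cup i a b + ε₃ • cup i b a

/-- The cochain dual to a cell. -/
def dual {d n : ℕ} (R : Type*) [CommRing R] (s : Cell d n) : Cochain d n R := Pi.single s 1

/-- `∫ a`: the sum of the values of `a` on all `d`-cells (only used for finitely many nonzero
values). -/
def integral {d : ℕ} {R : Type*} [CommRing R] (a : Cochain d d R) : R := ∑ᶠ c : Cell d d, a c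

/-- `∫ 𝐬 ∪_i 𝐭`. -/
def cupPairing {d : ℕ} (i : ℕ) {n₁ n₂ : ℕ} (R : Type*) [CommRing R] (s : Cell d n₁) (t : Cell d n₂) :
    R :=
  integral (cup i (dual R s) (dual R t))

/-! ### Pauli operators and Clifford QCAs

`N` qudits of dimension `p` are placed on every `n`-cell of `ℤ^d`. -/

/-- The qudits. -/
abbrev Site (N d n : ℕ) := Fin N × Cell d n

/-- The distance of two qudits: the sup-distance of the base points of their cells. -/
def siteDist {N d n : ℕ} (s t : Site N d n) : ℝ := dist s.2.1 t.2.1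

/-- Finitely supported Pauli operators modulo phase, `(x, z)` standing for `∏ X_s ^ x_s Z_s ^ z_s`. -/
abbrev Pauli (p N d n : ℕ) := (Site N d n →₀ ZMod p) × (Site N d n →₀ ZMod p)

def X {p N d n : ℕ} (s : Site N d n) : Pauli p N d n := (Finsupp.single s 1, 0)

def Z {p N d n : ℕ} (s : Site N d n) : Pauli p N d n := (0, Finsupp.single s 1)

/-- The pairing `∑ z_s a_s`. -/
def pairing {p N d n : ℕ} (z a : Site N d n →₀ ZMod p) : ZMod p := z.sum (fun s b => b * a s)

/-- The commutation form of Pauli operators. -/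
def symp {p N d n : ℕ} (v w : Pauli p N d n) : ZMod p := pairing v.1 w.2 - pairing v.2 w.1

/-- Automorphisms of the Pauli group modulo phase. -/
abbrev PauliAut (p N d n : ℕ) := Pauli p N d n ≃ₗ[ZMod p] Pauli p N d n

/-- The images of the Pauli operators on `s` act trivially on `t`. -/
def NoSpread {p N d n : ℕ} (θ : PauliAut p N d n) (s t : Site N d n) : Prop :=
  (θ (X s)).1 t = 0 ∧ (θ (X s)).2 t = 0 ∧ (θ (Z s)).1 t = 0 ∧ (θ (Z s)).2 t = 0

def IsSymplectic {p N d n : ℕ} (θ : PauliAut p N d n) : Prop :=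
  ∀ v w, symp (θ v) (θ w) = symp v w

/-- A Clifford QCA: a symplectic automorphism of finite range. -/
def IsCliffordQCA {p N d n : ℕ} (θ : PauliAut p N d n) : Prop :=
  IsSymplectic θ ∧ ∃ r : ℝ, ∀ s t, r < siteDist s t → NoSpread θ s t

/-- One layer of a Clifford circuit: a symplectic automorphism that is block-diagonal for a partition
of the qudits into blocks of uniformly bounded diameter. -/
def IsSingleLayer {p N d n : ℕ} (θ : PauliAut p N d n) : Prop :=
  IsSymplectic θ ∧ ∃ B : Setoid (Site N d n),
    (∃ r : ℝ, ∀ s t, B.r s t → siteDist s t ≤ r) ∧ ∀ s t, ¬ B.r s t → NoSpread θ s t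

/-- Finite-depth Clifford circuits. -/
def cliffordCircuits (p N d n : ℕ) : Subgroup (PauliAut p N d n) :=
  Subgroup.closure {θ | IsSingleLayer θ}

/-- The group generated by all `Z_s`. -/
def zGroup (p N d n : ℕ) : Submodule (ZMod p) (Pauli p N d n) :=
  Submodule.span (ZMod p) (Set.range Z)

/-! ### States, and the gauged ground state of a cup product action -/

/-- Wave functions on the computational basis `|a⟩` of finitely supported cochains. -/
abbrev State (p N d n : ℕ) := (Site N d n →₀ ZMod p) → ℂ

/-- The operator `∏ X_s ^ x_s ∏ Z_s ^ z_s`, where `X ^ x |a⟩ = |a + x⟩` and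
`Z ^ z |a⟩ = exp (2 π i ⟨z, a⟩ / p) |a⟩`. -/
def pauliOp {p N d n : ℕ} [NeZero p] (v : Pauli p N d n) (Ψ : State p N d n) : State p N d n :=
  fun a => ZMod.stdAddChar (pairing v.2 (a - v.1)) * Ψ (a - v.1)

/-- The stabilizer group of `Ψ` modulo phase. -/
def stabilizer {p N d n : ℕ} [NeZero p] (Ψ : State p N d n) : Set (Pauli p N d n) :=
  {v | ∃ c : ℂ, pauliOp v Ψ = c • Ψ}

/-- The Clifford QCA `α` disentangles `Ψ`: it takes the group generated by the `Z_s` to the stabilizer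
group of `Ψ`, i.e. the `α (Z_s)` are separators of `Ψ`. -/
def Disentangles {p N d n : ℕ} [NeZero p] (α : PauliAut p N d n) (Ψ : State p N d n) : Prop :=
  IsCliffordQCA α ∧ α '' (zGroup p N d n) = stabilizer Ψ

/-- The `i`-th field of a configuration of `N` fields. -/
def field {p N d n : ℕ} (a : Site N d n →₀ ZMod p) (i : Fin N) : Cochain d n (ZMod p) :=
  fun c => a (i, c)

/-- `a = δ φ`. -/
def IsPotential {p N d m : ℕ} (φ : Site N d m →₀ ZMod p) (a : Site N d (m + 1) →₀ ZMod p) : Prop :=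
  ∀ i, coboundary (field φ i) = field a i

/-- `∑ K_ij ∫ φ_i ∪ δ φ_j`: the boundary value of `∑ K_ij ∫ A_i ∪ A_j` for `A = δ φ`, as
`δ (φ_i ∪ δ φ_j) = A_i ∪ A_j`. -/
def boundaryAction {p N d m : ℕ} (K : Matrix (Fin N) (Fin N) (ZMod p)) (φ : Site N d m →₀ ZMod p) :
    ZMod p :=
  ∑ i, ∑ j, K i j * integral (cup 0 (field φ i) (coboundary (field φ j)))

open Classical in
/-- The ground state of the gauged SPT phase with action `(1/p) ∑ K_ij ∫ A_i ∪ A_j`, where the `A_i`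
have degree `m + 1`: the superposition of the states `exp (2 π i S) |δ φ⟩`. -/
def gaugedState {p N d m : ℕ} [NeZero p] (K : Matrix (Fin N) (Fin N) (ZMod p)) :
    State p N d (m + 1) :=
  fun a => if h : ∃ φ : Site N d m →₀ ZMod p, IsPotential φ a then
    ZMod.stdAddChar (boundaryAction K h.choose) else 0

/-- The diagonal unitary `|a⟩ ↦ exp (2 π i (c/p) ∫ a_i ∪_1 a_i) |a⟩`. -/
def cupOneCircuit {p N d n : ℕ} [NeZero p] (c : ZMod p) (i : Fin N) (Ψ : State p N d n) :
    State p N d n :=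
  fun a => ZMod.stdAddChar (c * integral (cup 1 (field a i) (field a i))) * Ψ a

/-! ### The `ℤ_p^{(k)}` construction

There is one field, of degree `m + 1`; `e` denotes `m`-cells, `s` denotes `(m + 1)`-cells. -/

/-- `X_{δ 𝐞}`. -/
def xCoboundary (p : ℕ) {d m : ℕ} (e : Cell d m) : Pauli p 1 d (m + 1) :=
  ∑ᶠ s : Cell d (m + 1), coboundary (dual (ZMod p) e) s • X (0, s)

/-- `Z_{∂ t}`. -/
def zBoundary (p : ℕ) {d m : ℕ} (t : Cell d (m + 2)) : Pauli p 1 d (m + 1) :=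
  ∑ᶠ s : Cell d (m + 1), coboundary (dual (ZMod p) s) t • Z (0, s)

/-- `X_{δ 𝐞} ∏_s Z_s ^ (k ∫ 𝐬 ∪ 𝐞 + 𝐞 ∪ 𝐬)`. -/
def gaugeTerm {p d m : ℕ} (k : ZMod p) (e : Cell d m) : Pauli p 1 d (m + 1) :=
  xCoboundary p e + ∑ᶠ s : Cell d (m + 1),
    (k * (cupPairing 0 (ZMod p) s e + cupPairing 0 (ZMod p) e s)) • Z (0, s)

/-- The group generated by the terms `Z_{∂ t}` and `X_{δ 𝐞} ∏_s Z_s ^ (k ∫ 𝐬 ∪ 𝐞 + 𝐞 ∪ 𝐬)` of the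
Hamiltonian. -/
def hamiltonianGroup (p d m : ℕ) (k : ZMod p) : Submodule (ZMod p) (Pauli p 1 d (m + 1)) :=
  Submodule.span (ZMod p) (Set.range (zBoundary p) ∪ Set.range (gaugeTerm k))

/-- `G_e = X_{δ 𝐞} ∏_s Z_s ^ (k ∫ δ𝐞 ∪_1 𝐬)`. -/
def G {p d m : ℕ} (k : ZMod p) (e : Cell d m) : Pauli p 1 d (m + 1) :=
  xCoboundary p e + ∑ᶠ s : Cell d (m + 1),
    (k * integral (cup 1 (coboundary (dual (ZMod p) e)) (dual (ZMod p) s))) • Z (0, s)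

/-- `Z̄_s = Z_s ∏_e G_e ^ ((1/2k) ∫ 𝐞 ∪ 𝐬)`. -/
def separator {p d m : ℕ} [Fact p.Prime] (k : ZMod p) (s : Cell d (m + 1)) : Pauli p 1 d (m + 1) :=
  Z (0, s) + ∑ᶠ e : Cell d m, ((2 * k)⁻¹ * cupPairing 0 (ZMod p) e s) • G k e

/-- `X̄_s = X_s ∏_{s'} [∏_e G_e ^ (-(1/2) ∫ 𝐞 ∪ 𝐬')] ^ (∫ 𝐬' ∪_1 𝐬)`. -/
def flipper {p d m : ℕ} [Fact p.Prime] (k : ZMod p) (s : Cell d (m + 1)) : Pauli p 1 d (m + 1) :=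
  X (0, s) + ∑ᶠ s' : Cell d (m + 1), cupPairing 1 (ZMod p) s' s •
    ∑ᶠ e : Cell d m, (-(2 : ZMod p)⁻¹ * cupPairing 0 (ZMod p) e s') • G k e

end CupQCA

end

open CupQCA

noncomputable section

namespace CupQCA

/-! ### Cochains extended by zero, end point conventions, and counting of inversions -/

section


variable {d : ℕ} {R : Type*} [CommRing R]

/-! Coboundary formulas. Every term of `δ(a ∪_i b)`, `δa ∪_i b` and `a ∪_i δb` involves a value of
`a` on a face with directions `A`, a value of `b` on a face with directions `B`, and one direction
`j` in which two end points are compared. The terms are sorted by `(j, A, B)`. If `j` is in neither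
set, the three contributions cancel by the product rule for differences. If `j` is in exactly one of
them, what remains is a difference of two values of `facePair`, whose last argument is a threshold:
from that direction on the end points are exchanged. The difference is the one between the
thresholds `j + 1` and `j`, so the sum over `j` telescopes to threshold `d` minus threshold `0`,
that is, to `a ∪_{i-1} b` and `b ∪_{i-1} a` up to signs (`face_terms`, `coboundary_cup_sub`).

Dimension `4l - 1`. Let `G φ = ∏ G_e ^ φ_e` (`gaussMap`) and let `D` (`gaussDual`) be determined by
`symp v (G φ) = -⟨D v, δφ⟩`. Put `Lφ = ∫ · ∪ φ` and `Rφ = ∫ φ ∪ ·`; by Poincaré duality both are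
signed bijections of cells. The integrated `∪_1` formula gives `D G φ = ∂h + 2k (Lφ - Rφ)`. The
required map is `1 + (1/2k) G R⁻¹ D`, and `1 - (1/2k) G L⁻¹ D` is its inverse because `G` kills
`R⁻¹∂h` and `L⁻¹∂h`. In the symplectic form the terms linear in `1/2k` cancel against the quadratic
one. The image of the `Z` group is computed on the Hamiltonian generators; being the image of a
Lagrangian, it is maximal isotropic, and it lies in the isotropic stabilizer group, so the two
coincide.

Odd degree. For an odd cocycle `δ(A ∪_1 A) = -2 A ∪ A`, and `(p-1)/2` is `-1/2` modulo `p`. In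
dimension `4l + 1` the added boundary action is therefore a local quadratic form in `a = δφ` itself,
so it is implemented by a diagonal unitary. That unitary acts on Pauli operators as a shear by a
symmetric matrix of range one, which splits into `3^d` block-diagonal layers
(`shear_mem_cliffordCircuits`). -/

/-- The extension by zero of a cochain to cubes of all dimensions. -/
def extend {n : ℕ} (a : Cochain d n R) (x : Fin d → ℤ) (S : Finset (Fin d)) : R :=
  if h : S.card = n then a (x, ⟨S, h⟩) else 0

theorem extend_of_card {n : ℕ} (a : Cochain d n R) (x : Fin d → ℤ) (S : Dirs d n) :
    extend a x S.1 = a (x, S) := by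
  simp [extend, S.2]

theorem extend_of_card_ne {n : ℕ} (a : Cochain d n R) (x : Fin d → ℤ) {S : Finset (Fin d)}
    (h : S.card ≠ n) : extend a x S = 0 := by
  simp [extend, h]

theorem sum_dirs {n : ℕ} (f : Finset (Fin d) → R) (hf : ∀ S, S.card ≠ n → f S = 0) :
    ∑ A : Dirs d n, f A.1 = ∑ A, f A := by
  rw [← Finset.sum_subtype (Finset.univ.filter (fun S : Finset (Fin d) => S.card = n))
    (by simp) f, Finset.sum_filter]
  refine Finset.sum_congr rfl fun S _ => ?_
  split_ifs with h
  · rfl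
  · exact (hf S h).symm

theorem extend_coboundary {n : ℕ} (a : Cochain d n R) (x : Fin d → ℤ) (S : Finset (Fin d)) :
    extend (coboundary a) x S = ∑ j ∈ S, (-1) ^ below S j *
      (extend a (shift x {j}) (S.erase j) - extend a x (S.erase j)) := by
  by_cases h : S.card = n + 1
  · rw [extend, dif_pos h, coboundary, ← Finset.sum_coe_sort S]
    refine Finset.sum_congr rfl fun j _ => ?_
    have hj : (S.erase j.1).card = n := by rw [Finset.card_erase_of_mem j.2, h]; rfl
    simp only [extend, dif_pos hj, below]
    rw [zsmul_eq_mul]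
    push_cast
    rfl
  · rw [extend_of_card_ne _ _ h]
    refine (Finset.sum_eq_zero fun j hj => ?_).symm
    have : (S.erase j).card ≠ n := by
      intro h'
      rw [← h', Finset.card_erase_add_one hj] at h
      exact h rfl
    rw [extend_of_card_ne _ _ this, extend_of_card_ne _ _ this, sub_zero, mul_zero]

theorem coboundary_apply {n : ℕ} (a : Cochain d n R) (c : Cell d (n + 1)) :
    coboundary a c = ∑ j ∈ c.2.1, (-1) ^ below c.2.1 j *
      (extend a (shift c.1 {j}) (c.2.1.erase j) - extend a c.1 (c.2.1.erase j)) := by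
  rw [← extend_coboundary, extend_of_card]

/-- The sign of the term of `a ∪_i b` with direction sets `A` and `B`. -/
def cupSign (R : Type*) [CommRing R] (i : ℕ) (A B : Finset (Fin d)) : R :=
  (-1) ^ (inversions (A \ B) (B \ A) + i * (B \ A).card)

/-- The directions `t` of `U` for which the number of directions of `C` below `t`, increased by one
if `k ≤ t`, is odd. -/
def oddPart (k : ℕ) (C U : Finset (Fin d)) : Finset (Fin d) :=
  U.filter fun t => Odd (below C t + if k ≤ t.1 then 1 else 0)

/-- The directions `t` of `U` for which the number of directions of `C` below `t`, increased by one
if `k ≤ t`, is even. -/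
def evenPart (k : ℕ) (C U : Finset (Fin d)) : Finset (Fin d) :=
  U.filter fun t => Even (below C t + if k ≤ t.1 then 1 else 0)

theorem oddPart_top (C U : Finset (Fin d)) :
    oddPart d C U = U.filter fun t => Odd (below C t) :=
  Finset.filter_congr fun t _ => by simp [Nat.not_le.2 t.2]

theorem evenPart_top (C U : Finset (Fin d)) :
    evenPart d C U = U.filter fun t => Even (below C t) :=
  Finset.filter_congr fun t _ => by simp [Nat.not_le.2 t.2]

theorem oddPart_zero (C U : Finset (Fin d)) :
    oddPart 0 C U = U.filter fun t => Even (below C t) :=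
  Finset.filter_congr fun t _ => by simp [Nat.odd_add_one]

theorem evenPart_zero (C U : Finset (Fin d)) :
    evenPart 0 C U = U.filter fun t => Odd (below C t) :=
  Finset.filter_congr fun t _ => by simp [Nat.even_add_one]

/-- The product of faces that enters `a ∪_i b`, with the roles of the end points exchanged from the
direction `k` on. -/
def facePair {p q : ℕ} (a : Cochain d p R) (b : Cochain d q R) (x : Fin d → ℤ)
    (A B : Finset (Fin d)) (k : ℕ) : R :=
  extend a (shift x (oddPart k (A ∩ B) (B \ A))) A *
    extend b (shift x (evenPart k (A ∩ B) (A \ B))) B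

theorem cup_apply (i : ℕ) {p q r : ℕ} (a : Cochain d p R) (b : Cochain d q R) (c : Cell d r) :
    (cup i a b : Cochain d r R) c = ∑ A, ∑ B,
      if A ∪ B = c.2.1 ∧ (A ∩ B).card = i then cupSign R i A B * facePair a b c.1 A B d else 0 := by
  rw [← sum_dirs (n := p)]
  · refine Finset.sum_congr rfl fun A _ => ?_
    rw [← sum_dirs (n := q)]
    · refine Finset.sum_congr rfl fun B _ => ?_
      simp only [cupSign, facePair, extend_of_card, oddPart_top, evenPart_top, mul_assoc]
    · intro B hB
      simp [facePair, extend_of_card_ne _ _ hB]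
  · intro A hA
    simp [facePair, extend_of_card_ne _ _ hA]

/-- Interchanging the factors reverses the parity convention in every direction, which is what the
threshold `0` does. Thus the threshold interpolates between the two orders of the product. -/
theorem facePair_swap {p q : ℕ} (a : Cochain d p R) (b : Cochain d q R) (x : Fin d → ℤ)
    (A B : Finset (Fin d)) : facePair b a x B A d = facePair a b x A B 0 := by
  rw [facePair, facePair, oddPart_top, evenPart_top, oddPart_zero, evenPart_zero, mul_comm,
    Finset.inter_comm]

theorem shift_shift {x : Fin d → ℤ} {T : Finset (Fin d)} {j : Fin d} (h : j ∉ T) :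
    shift (shift x T) {j} = shift x (insert j T) := by
  funext t
  simp only [shift, Finset.mem_singleton, Finset.mem_insert]
  by_cases ht : t = j
  · subst ht; simp [h]
  · simp [ht]

theorem shift_comm (x : Fin d → ℤ) (T U : Finset (Fin d)) :
    shift (shift x T) U = shift (shift x U) T := by
  funext t
  simp only [shift]
  ring

/-- This reindexing passes from a face of a coboundary to the face, without the direction `j`, on
which the cochain itself is evaluated. -/
theorem sum_mem_eq_sum_insert (j : Fin d) (g : Finset (Fin d) → R) :
    ∑ A, (if j ∈ A then g A else 0) = ∑ A, if j ∉ A then g (insert j A) else 0 := by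
  rw [← Finset.sum_filter, ← Finset.sum_filter]
  refine Finset.sum_nbij' (fun A => A.erase j) (fun A => insert j A) ?_ ?_ ?_ ?_ ?_
  · simp
  · simp
  · intro A hA; exact Finset.insert_erase (by simpa using hA)
  · intro A hA; exact Finset.erase_insert (by simpa using hA)
  · intro A hA; rw [Finset.insert_erase (by simpa using hA)]

theorem below_union {U V : Finset (Fin d)} (h : Disjoint U V) (j : Fin d) :
    below (U ∪ V) j = below U j + below V j := by
  rw [below, Finset.filter_union, Finset.card_union_of_disjoint
    (Finset.disjoint_filter_filter h)]
  rfl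

theorem below_insert {U : Finset (Fin d)} {j : Fin d} (h : j ∉ U) (t : Fin d) :
    below (insert j U) t = below U t + if j < t then 1 else 0 := by
  rw [below, Finset.filter_insert]
  split_ifs with hjt
  · rw [Finset.card_insert_of_notMem (by simp [h])]; rfl
  · rfl

/-- The number of elements of `U` above `j`. -/
def above (U : Finset (Fin d)) (j : Fin d) : ℕ := (U.filter (fun t => j < t)).card

theorem below_add_above {U : Finset (Fin d)} {j : Fin d} (h : j ∉ U) :
    below U j + above U j = U.card := by
  rw [below, above, ← Finset.card_union_of_disjoint, ← Finset.filter_or]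
  · congr 1
    refine Finset.filter_true_of_mem fun t ht => ?_
    have : t ≠ j := fun e => h (e ▸ ht)
    exact lt_or_gt_of_ne this
  · exact Finset.disjoint_filter.2 fun t _ h1 h2 => lt_asymm h1 h2

theorem inversions_eq_sum (U V : Finset (Fin d)) :
    inversions U V = ∑ u ∈ U, ∑ v ∈ V, if v < u then 1 else 0 := by
  rw [inversions, Finset.card_filter, Finset.sum_product]

theorem inversions_insert_left {U V : Finset (Fin d)} {j : Fin d} (h : j ∉ U) :
    inversions (insert j U) V = inversions U V + below V j := by
  rw [inversions_eq_sum, inversions_eq_sum, Finset.sum_insert h, below, Finset.card_filter, add_comm]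

theorem inversions_insert_right {U V : Finset (Fin d)} {j : Fin d} (h : j ∉ V) :
    inversions U (insert j V) = inversions U V + above U j := by
  rw [inversions_eq_sum, inversions_eq_sum, above, Finset.card_filter, ← Finset.sum_add_distrib]
  refine Finset.sum_congr rfl fun u _ => ?_
  rw [Finset.sum_insert h, add_comm]

/-- Each pair in `U × V` is an inversion in exactly one of the two orders. This is the source of the
sign `(-1) ^ (p * q)` of graded commutativity. -/
theorem inversions_add_swap {U V : Finset (Fin d)} (h : Disjoint U V) :
    inversions U V + inversions V U = U.card * V.card := by
  rw [inversions_eq_sum, inversions_eq_sum, Finset.sum_comm (s := V), ← Finset.sum_add_distrib,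
    ← smul_eq_mul, ← Finset.sum_const]
  refine Finset.sum_congr rfl fun u hu => ?_
  rw [← Finset.sum_add_distrib, Finset.card_eq_sum_ones]
  refine Finset.sum_congr rfl fun v hv => ?_
  rcases lt_trichotomy u v with h' | h' | h'
  · simp [h', h'.not_gt]
  · subst h'; exact absurd hv (Finset.disjoint_left.1 h hu)
  · simp [h', h'.not_gt]

end

/-! ### Signs and end points when one direction is added to a face -/

section


variable {d : ℕ} {R : Type*} [CommRing R]

theorem below_union_inter_sdiff (A B : Finset (Fin d)) (j : Fin d) :
    below A j = below (A ∩ B) j + below (A \ B) j := by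
  rw [← below_union (Finset.disjoint_sdiff_inter A B).symm, Finset.union_comm,
    Finset.sdiff_union_inter]

theorem below_union_eq (A B : Finset (Fin d)) (j : Fin d) :
    below (A ∪ B) j = below A j + below (B \ A) j := by
  rw [← below_union Finset.disjoint_sdiff, Finset.union_sdiff_self_eq_union]

theorem below_insert_self (A : Finset (Fin d)) (j : Fin d) :
    below (insert j A) j = below A j := by
  simp [below, Finset.filter_insert]

theorem card_eq_inter_add_sdiff (A B : Finset (Fin d)) :
    A.card = (A ∩ B).card + (A \ B).card := by
  rw [add_comm, Finset.card_sdiff_add_card_inter]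

theorem oddPart_insert {k : ℕ} (C U : Finset (Fin d)) (j : Fin d) :
    oddPart k C (insert j U) = if Odd (below C j + if k ≤ j.1 then 1 else 0) then
      insert j (oddPart k C U) else oddPart k C U := by
  rw [oddPart, Finset.filter_insert]; rfl

theorem evenPart_insert {k : ℕ} (C U : Finset (Fin d)) (j : Fin d) :
    evenPart k C (insert j U) = if Even (below C j + if k ≤ j.1 then 1 else 0) then
      insert j (evenPart k C U) else evenPart k C U := by
  rw [evenPart, Finset.filter_insert]; rfl

/-- A new common direction `j` flips the parity of exactly the directions above it, so it acts as a
threshold at `j`. As `j ∉ U`, the thresholds `j` and `j + 1` agree on `U`. -/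
theorem oddPart_top_insert {C U : Finset (Fin d)} {j : Fin d} (hC : j ∉ C) {k : ℕ}
    (hU : j ∉ U) (hk : k = j.1 ∨ k = j.1 + 1) : oddPart d (insert j C) U = oddPart k C U := by
  refine Finset.filter_congr fun t ht => ?_
  have hne : j ≠ t := fun e => hU (e ▸ ht)
  have : (j < t) ↔ k ≤ t.1 := by omega
  rw [below_insert hC]
  simp [Nat.not_le.2 t.2, this]

theorem evenPart_top_insert {C U : Finset (Fin d)} {j : Fin d} (hC : j ∉ C) {k : ℕ}
    (hU : j ∉ U) (hk : k = j.1 ∨ k = j.1 + 1) : evenPart d (insert j C) U = evenPart k C U := by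
  refine Finset.filter_congr fun t ht => ?_
  have hne : j ≠ t := fun e => hU (e ▸ ht)
  have : (j < t) ↔ k ≤ t.1 := by omega
  rw [below_insert hC]
  simp [Nat.not_le.2 t.2, this]

theorem oddPart_succ {C U : Finset (Fin d)} {j : Fin d} (hU : j ∉ U) :
    oddPart (j.1 + 1) C U = oddPart j.1 C U := by
  refine Finset.filter_congr fun t ht => ?_
  have hne : j ≠ t := fun e => hU (e ▸ ht)
  have : (j.1 + 1 ≤ t.1) ↔ j.1 ≤ t.1 := by omega
  simp [this]

theorem evenPart_succ {C U : Finset (Fin d)} {j : Fin d} (hU : j ∉ U) :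
    evenPart (j.1 + 1) C U = evenPart j.1 C U := by
  refine Finset.filter_congr fun t ht => ?_
  have hne : j ≠ t := fun e => hU (e ▸ ht)
  have : (j.1 + 1 ≤ t.1) ↔ j.1 ≤ t.1 := by omega
  simp [this]

variable (i : ℕ) {p q : ℕ} (a : Cochain d p R) (b : Cochain d q R) (x : Fin d → ℤ) (j : Fin d)
  (A B : Finset (Fin d))

/-- The contribution to `δ a ∪_i b` of the faces `A` and `B` where `A` is a face in the direction `j`
of a face of `A ∪ {j}`. -/
def leftTerm : R :=
  cupSign R i (insert j A) B * ((-1) ^ below (insert j A) j *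
    (extend a (shift (shift x (oddPart d (insert j A ∩ B) (B \ insert j A))) {j}) A -
      extend a (shift x (oddPart d (insert j A ∩ B) (B \ insert j A))) A) *
    extend b (shift x (evenPart d (insert j A ∩ B) (insert j A \ B))) B)

/-- The contribution to `a ∪_i δ b` of the faces `A` and `B` where `B` is a face in the direction `j`
of a face of `B ∪ {j}`. -/
def rightTerm : R :=
  cupSign R i A (insert j B) *
    (extend a (shift x (oddPart d (A ∩ insert j B) (insert j B \ A))) A * ((-1) ^ below (insert j B) j *
      (extend b (shift (shift x (evenPart d (A ∩ insert j B) (A \ insert j B))) {j}) B -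
        extend b (shift x (evenPart d (A ∩ insert j B) (A \ insert j B))) B)))

/-- The sign of the boundary terms in the coboundary formula for `∪_{i+1}`. -/
def defectSign (R : Type*) [CommRing R] (i : ℕ) (A B : Finset (Fin d)) : R :=
  (-1) ^ (inversions (A \ B) (B \ A) + (A \ B).card + (B \ A).card + i + i * (B \ A).card)

variable {i a b x j A B}

theorem cupSign_insert_left (i : ℕ) (hA : j ∉ A) (hB : j ∉ B) :
    cupSign R i (insert j A) B * (-1) ^ below (insert j A) j =
      (-1) ^ below (insert j (A ∪ B)) j * cupSign R i A B := by
  rw [cupSign, cupSign, ← pow_add, ← pow_add, Finset.insert_sdiff_of_notMem _ hB,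
    Finset.sdiff_insert_of_notMem hB, inversions_insert_left (by simp [hA]), below_insert_self,
    below_insert_self, below_union_eq]
  congr 1
  ring

/-- The new inversions are the elements of `A \ B` above `j`; together with those below `j` they
make up `|A| - i`, which the factor `(-1) ^ |A|` and the term `i * |B \ A|` of the sign compensate.
-/
theorem cupSign_insert_right (i : ℕ) (hA : j ∉ A) (hB : j ∉ B) (hi : (A ∩ B).card = i) :
    (-1) ^ A.card * (cupSign R i A (insert j B) * (-1) ^ below (insert j B) j) =
      (-1) ^ below (insert j (A ∪ B)) j * cupSign R i A B := by
  rw [cupSign, cupSign, ← pow_add, ← pow_add, ← pow_add, Finset.insert_sdiff_of_notMem _ hA,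
    Finset.sdiff_insert_of_notMem hA, inversions_insert_right (by simp [hB]), below_insert_self,
    below_insert_self, Finset.union_comm, below_union_eq, card_eq_inter_add_sdiff A B, hi,
    Finset.card_insert_of_notMem (by simp [hB]),
    ← below_add_above (U := A \ B) (j := j) (by simp [hA])]
  apply neg_one_pow_congr
  simp only [Nat.even_iff, Nat.mul_add, Nat.mul_one]
  omega

/-- Here `j` moves from `B \ A` to the common directions. After this, the only dependence of the
sign on `j` is the parity of the common directions below it, which also decides the end point in
direction `j`. -/
theorem cupSign_insert_left_mem (i : ℕ) (hA : j ∉ A) (hB : j ∈ B) :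
    cupSign R (i + 1) (insert j A) B * (-1) ^ below (insert j A) j =
      (-1) ^ (below (A ∩ B) j + 1) * defectSign R i A B := by
  have h1 : B \ A = insert j (B \ insert j A) := by
    rw [Finset.sdiff_insert, Finset.insert_erase (by simp [hA, hB])]
  have h2 : j ∉ B \ insert j A := by simp
  rw [cupSign, defectSign, ← pow_add, ← pow_add, Finset.insert_sdiff_of_mem _ hB,
    below_insert_self, h1, inversions_insert_right h2, Finset.card_insert_of_notMem h2,
    below_union_inter_sdiff A B, ← below_add_above (U := A \ B) (j := j) (by simp [hA])]
  apply neg_one_pow_congr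
  simp only [Nat.even_iff, Nat.add_mul, Nat.mul_add, Nat.one_mul, Nat.mul_one]
  omega

theorem cupSign_insert_right_mem (i : ℕ) (hA : j ∈ A) (hB : j ∉ B) (hi : (A ∩ B).card = i) :
    (-1) ^ A.card * (cupSign R (i + 1) A (insert j B) * (-1) ^ below (insert j B) j) =
      (-1) ^ below (A ∩ B) j * defectSign R i A B := by
  have h1 : A \ B = insert j (A \ insert j B) := by
    rw [Finset.sdiff_insert, Finset.insert_erase (by simp [hA, hB])]
  have h2 : j ∉ A \ insert j B := by simp
  rw [card_eq_inter_add_sdiff A B, hi, cupSign, defectSign, ← pow_add, ← pow_add, ← pow_add,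
    Finset.insert_sdiff_of_mem _ hA,
    below_insert_self, h1, inversions_insert_left h2, Finset.card_insert_of_notMem h2,
    below_union_inter_sdiff B A, Finset.inter_comm B A]
  apply neg_one_pow_congr
  simp only [Nat.even_iff, Nat.add_mul, Nat.one_mul]
  omega

/-- This is the product rule `a'b' - ab = (a' - a) b' + a (b' - b)`, or its other form `(a' - a) b +
a' (b' - b)`. -/
theorem leftTerm_add_rightTerm (i : ℕ) (hA : j ∉ A) (hB : j ∉ B) (hi : (A ∩ B).card = i) :
    leftTerm i a b x j A B + (-1) ^ A.card * rightTerm i a b x j A B =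
      (-1) ^ below (insert j (A ∪ B)) j * cupSign R i A B *
        (facePair a b (shift x {j}) A B d - facePair a b x A B d) := by
  have hl := cupSign_insert_left (R := R) i hA hB
  have hr := cupSign_insert_right (R := R) i hA hB hi
  rw [sub_eq_add_neg, mul_add]
  unfold leftTerm rightTerm
  rw [Finset.insert_inter_of_notMem hB, Finset.inter_insert_of_notMem hA,
    Finset.insert_sdiff_of_notMem _ hB, Finset.sdiff_insert_of_notMem hB,
    Finset.insert_sdiff_of_notMem _ hA, Finset.sdiff_insert_of_notMem hA, oddPart_insert,
    evenPart_insert, facePair, facePair, shift_comm x {j}, shift_comm x {j}]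
  have hO : j ∉ oddPart d (A ∩ B) (B \ A) := by simp [oddPart, hB]
  have hE : j ∉ evenPart d (A ∩ B) (A \ B) := by simp [evenPart, hA]
  rw [shift_shift hO, shift_shift hE]
  simp only [Nat.not_le.2 j.2, if_false, add_zero]
  set s := (-1) ^ below (insert j (A ∪ B)) j * cupSign R i A B
  -- The parity decides which factor is taken at the far end in direction `j` while the other is
  -- differenced, hence which form of the product rule occurs.
  rcases Nat.even_or_odd (below (A ∩ B) j) with h | h
  · rw [if_pos h, if_neg (Nat.not_odd_iff_even.2 h)]
    linear_combination (extend a (shift x (insert j (oddPart d (A ∩ B) (B \ A)))) A -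
      extend a (shift x (oddPart d (A ∩ B) (B \ A))) A) *
        extend b (shift x (insert j (evenPart d (A ∩ B) (A \ B)))) B * hl +
      extend a (shift x (oddPart d (A ∩ B) (B \ A))) A *
       (extend b (shift x (insert j (evenPart d (A ∩ B) (A \ B)))) B -
         extend b (shift x (evenPart d (A ∩ B) (A \ B))) B) * hr
  · rw [if_pos h, if_neg (Nat.not_even_iff_odd.2 h)]
    linear_combination (extend a (shift x (insert j (oddPart d (A ∩ B) (B \ A)))) A -
      extend a (shift x (oddPart d (A ∩ B) (B \ A))) A) *
        extend b (shift x (evenPart d (A ∩ B) (A \ B))) B * hl +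
      extend a (shift x (insert j (oddPart d (A ∩ B) (B \ A)))) A *
       (extend b (shift x (insert j (evenPart d (A ∩ B) (A \ B)))) B -
         extend b (shift x (evenPart d (A ∩ B) (A \ B))) B) * hr

/-- The two ends of `A` in direction `j` are the positions prescribed by the thresholds `j` and `j +
1`. Which end belongs to which threshold depends on a parity, and the sign in
`cupSign_insert_left_mem` corrects for it. -/
theorem leftTerm_of_mem (i : ℕ) (hA : j ∉ A) (hB : j ∈ B) :
    leftTerm (i + 1) a b x j A B =
      defectSign R i A B * (facePair a b x A B (j.1 + 1) - facePair a b x A B j.1) := by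
  have hl := cupSign_insert_left_mem (R := R) i hA hB
  have h1 : B \ A = insert j (B \ insert j A) := by
    rw [Finset.sdiff_insert, Finset.insert_erase (by simp [hA, hB])]
  have h2 : j ∉ B \ insert j A := by simp
  have h3 : j ∉ A ∩ B := by simp [hA]
  have h4 : j ∉ A \ B := by simp [hA]
  unfold leftTerm facePair
  rw [Finset.insert_inter_of_mem hB, Finset.insert_sdiff_of_mem _ hB, h1,
    oddPart_top_insert h3 h2 (Or.inl rfl), evenPart_top_insert h3 h4 (Or.inl rfl),
    evenPart_succ h4, oddPart_insert, oddPart_insert, oddPart_succ h2,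
    shift_shift (by simp [oddPart])]
  simp only [Nat.not_succ_le_self, if_false, le_refl, if_true, add_zero]
  rcases Nat.even_or_odd (below (A ∩ B) j) with h | h
  · rw [pow_succ, h.neg_one_pow] at hl
    rw [if_neg (Nat.not_odd_iff_even.2 h), if_pos h.add_one]
    linear_combination (extend a (shift x (insert j (oddPart j.1 (A ∩ B) (B \ insert j A)))) A -
      extend a (shift x (oddPart j.1 (A ∩ B) (B \ insert j A))) A) *
        extend b (shift x (evenPart j.1 (A ∩ B) (A \ B))) B * hl
  · rw [pow_succ, h.neg_one_pow] at hl
    rw [if_pos h, if_neg (Nat.not_odd_iff_even.2 h.add_one)]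
    linear_combination (extend a (shift x (insert j (oddPart j.1 (A ∩ B) (B \ insert j A)))) A -
      extend a (shift x (oddPart j.1 (A ∩ B) (B \ insert j A))) A) *
        extend b (shift x (evenPart j.1 (A ∩ B) (A \ B))) B * hl

theorem rightTerm_of_mem (i : ℕ) (hA : j ∈ A) (hB : j ∉ B) (hi : (A ∩ B).card = i) :
    (-1) ^ A.card * rightTerm (i + 1) a b x j A B =
      defectSign R i A B * (facePair a b x A B (j.1 + 1) - facePair a b x A B j.1) := by
  have hl := cupSign_insert_right_mem (R := R) i hA hB hi
  have h1 : A \ B = insert j (A \ insert j B) := by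
    rw [Finset.sdiff_insert, Finset.insert_erase (by simp [hA, hB])]
  have h2 : j ∉ A \ insert j B := by simp
  have h3 : j ∉ A ∩ B := by simp [hB]
  have h4 : j ∉ B \ A := by simp [hB]
  unfold rightTerm facePair
  rw [Finset.inter_insert_of_mem hA, Finset.insert_sdiff_of_mem _ hA, h1,
    evenPart_top_insert h3 h2 (Or.inl rfl), oddPart_top_insert h3 h4 (Or.inl rfl),
    oddPart_succ h4, evenPart_insert, evenPart_insert, evenPart_succ h2,
    shift_shift (by simp [evenPart])]
  simp only [Nat.not_succ_le_self, if_false, le_refl, if_true, add_zero]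
  rcases Nat.even_or_odd (below (A ∩ B) j) with h | h
  · rw [h.neg_one_pow] at hl
    rw [if_pos h, if_neg (Nat.not_even_iff_odd.2 h.add_one)]
    linear_combination (extend b (shift x (insert j (evenPart j.1 (A ∩ B) (A \ insert j B)))) B -
      extend b (shift x (evenPart j.1 (A ∩ B) (A \ insert j B))) B) *
        extend a (shift x (oddPart j.1 (A ∩ B) (B \ A))) A * hl
  · rw [h.neg_one_pow] at hl
    rw [if_neg (Nat.not_even_iff_odd.2 h), if_pos h.add_one]
    linear_combination (extend b (shift x (insert j (evenPart j.1 (A ∩ B) (A \ insert j B)))) B -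
      extend b (shift x (evenPart j.1 (A ∩ B) (A \ insert j B))) B) *
        extend a (shift x (oddPart j.1 (A ∩ B) (B \ A))) A * hl

theorem facePair_succ (h : j ∈ A ↔ j ∈ B) :
    facePair a b x A B (j.1 + 1) = facePair a b x A B j.1 := by
  rw [facePair, facePair, oddPart_succ (by simp [h]), evenPart_succ (by simp [h])]

theorem sum_facePair_succ :
    ∑ j : Fin d, (facePair a b x A B (j.1 + 1) - facePair a b x A B j.1) =
      facePair a b x A B d - facePair a b x A B 0 := by
  rw [Fin.sum_univ_eq_sum_range (fun k => facePair a b x A B (k + 1) - facePair a b x A B k),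
    Finset.sum_range_sub]

/-- Expanding the coboundary and removing `j` from the first direction set brings the product to a
sum over `(j, A, B)` in which `A` carries the value of `a`; this index set is shared with the other
two expansions. -/
theorem cup_coboundary_left (i : ℕ) {r : ℕ} (c : Cell d r) :
    (cup i (coboundary a) b : Cochain d r R) c = ∑ j, ∑ A, ∑ B,
      if j ∉ A ∧ insert j A ∪ B = c.2.1 ∧ (insert j A ∩ B).card = i then
        leftTerm i a b c.1 j A B else 0 := by
  rw [cup_apply, Finset.sum_comm]
  have key : ∀ B A : Finset (Fin d), (if A ∪ B = c.2.1 ∧ (A ∩ B).card = i then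
      cupSign R i A B * facePair (coboundary a) b c.1 A B d else 0) = ∑ j, if j ∈ A then
        (if A ∪ B = c.2.1 ∧ (A ∩ B).card = i then cupSign R i A B * ((-1) ^ below A j *
          (extend a (shift (shift c.1 (oddPart d (A ∩ B) (B \ A))) {j}) (A.erase j) -
            extend a (shift c.1 (oddPart d (A ∩ B) (B \ A))) (A.erase j)) *
          extend b (shift c.1 (evenPart d (A ∩ B) (A \ B))) B) else 0) else 0 := by
    intro B A
    split_ifs
    · rw [facePair, extend_coboundary, Finset.sum_mul, Finset.mul_sum, ← Finset.sum_filter]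
      simp
    · simp
  simp_rw [key]
  rw [Finset.sum_congr rfl fun B _ => Finset.sum_comm, Finset.sum_comm]
  refine Finset.sum_congr rfl fun j _ => ?_
  simp_rw [sum_mem_eq_sum_insert j]
  rw [Finset.sum_comm]
  refine Finset.sum_congr rfl fun A _ => Finset.sum_congr rfl fun B _ => ?_
  by_cases hj : j ∈ A
  · simp [hj]
  · simp only [hj, not_false_eq_true, true_and, if_true, Finset.erase_insert hj]
    rfl

theorem cup_coboundary_right (i : ℕ) {r : ℕ} (c : Cell d r) :
    (cup i a (coboundary b) : Cochain d r R) c = ∑ j, ∑ A, ∑ B,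
      if j ∉ B ∧ A ∪ insert j B = c.2.1 ∧ (A ∩ insert j B).card = i then
        rightTerm i a b c.1 j A B else 0 := by
  rw [cup_apply]
  have key : ∀ A B : Finset (Fin d), (if A ∪ B = c.2.1 ∧ (A ∩ B).card = i then
      cupSign R i A B * facePair a (coboundary b) c.1 A B d else 0) = ∑ j, if j ∈ B then
        (if A ∪ B = c.2.1 ∧ (A ∩ B).card = i then cupSign R i A B *
          (extend a (shift c.1 (oddPart d (A ∩ B) (B \ A))) A * ((-1) ^ below B j *
          (extend b (shift (shift c.1 (evenPart d (A ∩ B) (A \ B))) {j}) (B.erase j) -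
            extend b (shift c.1 (evenPart d (A ∩ B) (A \ B))) (B.erase j)))) else 0) else 0 := by
    intro A B
    split_ifs
    · rw [facePair, extend_coboundary, Finset.mul_sum, Finset.mul_sum, ← Finset.sum_filter]
      simp
    · simp
  simp_rw [key]
  rw [Finset.sum_congr rfl fun A _ => Finset.sum_comm, Finset.sum_comm]
  refine Finset.sum_congr rfl fun j _ => Finset.sum_congr rfl fun A _ => ?_
  rw [sum_mem_eq_sum_insert j]
  refine Finset.sum_congr rfl fun B _ => ?_
  by_cases hj : j ∈ B
  · simp [hj]
  · simp only [hj, not_false_eq_true, true_and, if_true, Finset.erase_insert hj]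
    rfl

/-- The degree condition is needed for `S` of the wrong size: a nonzero summand has `|A| = p`, `|B|
= q`, `|A ∩ B| = i`, and so forces `|S| = r`. -/
theorem extend_cup (i : ℕ) {r : ℕ} (hr : p + q = r + i) (S : Finset (Fin d)) :
    extend (cup i a b : Cochain d r R) x S = ∑ A, ∑ B,
      if A ∪ B = S ∧ (A ∩ B).card = i then cupSign R i A B * facePair a b x A B d else 0 := by
  by_cases hS : S.card = r
  · rw [extend, dif_pos hS, cup_apply]
  · rw [extend_of_card_ne _ _ hS]
    refine (Finset.sum_eq_zero fun A _ => Finset.sum_eq_zero fun B _ => ?_).symm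
    split_ifs with h
    · by_cases hA : A.card = p
      · by_cases hB : B.card = q
        · have := Finset.card_union_add_card_inter A B
          rw [h.1, h.2, hA, hB] at this
          omega
        · rw [facePair, extend_of_card_ne b _ hB, mul_zero, mul_zero]
      · rw [facePair, extend_of_card_ne a _ hA, zero_mul, mul_zero]
    · rfl

theorem coboundary_cup (i : ℕ) {r : ℕ} (hr : p + q = r + i) (c : Cell d (r + 1)) :
    coboundary (cup i a b : Cochain d r R) c = ∑ j, ∑ A, ∑ B,
      if j ∈ c.2.1 ∧ A ∪ B = c.2.1.erase j ∧ (A ∩ B).card = i then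
        (-1) ^ below c.2.1 j * cupSign R i A B *
          (facePair a b (shift c.1 {j}) A B d - facePair a b c.1 A B d) else 0 := by
  rw [coboundary_apply, ← Finset.sum_filter_add_sum_filter_not Finset.univ (fun j => j ∈ c.2.1),
    Finset.sum_eq_zero (s := Finset.univ.filter fun j => ¬ j ∈ c.2.1), add_zero]
  · refine Finset.sum_congr (by ext; simp) fun j hj => ?_
    replace hj : j ∈ c.2.1 := by simpa using hj
    rw [extend_cup i hr, extend_cup i hr, ← Finset.sum_sub_distrib, Finset.mul_sum]
    refine Finset.sum_congr rfl fun A _ => ?_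
    rw [← Finset.sum_sub_distrib, Finset.mul_sum]
    refine Finset.sum_congr rfl fun B _ => ?_
    simp only [hj, true_and]
    split_ifs
    · ring
    · simp
  · intro j hj
    have : j ∉ c.2.1 := by simpa using hj
    simp [this]

end

/-! ### The Leibniz rule and the coboundary formula for higher cup products -/

section


variable {d : ℕ} {R : Type*} [CommRing R]

/-- The cases are the four positions of `j` relative to `A` and `B`. In both sets: nothing occurs on
either side. In exactly one: only `leftTerm` or only `rightTerm` survives and is a threshold
difference. In neither: the product rule applies and the threshold difference vanishes. -/
theorem face_terms {p q : ℕ} (i : ℕ) (a : Cochain d p R) (b : Cochain d q R) (x : Fin d → ℤ)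
    (S A B : Finset (Fin d)) (j : Fin d) :
    (if j ∈ S ∧ A ∪ B = S.erase j ∧ (A ∩ B).card = i then
        (-1) ^ below S j * cupSign R i A B *
          (facePair a b (shift x {j}) A B d - facePair a b x A B d) else 0) -
      (if j ∉ A ∧ insert j A ∪ B = S ∧ (insert j A ∩ B).card = i then
        leftTerm i a b x j A B else 0) -
      (-1) ^ p * (if j ∉ B ∧ A ∪ insert j B = S ∧ (A ∩ insert j B).card = i then
        rightTerm i a b x j A B else 0) =
    -if A ∪ B = S ∧ (A ∩ B).card + 1 = i then
      defectSign R (i - 1) A B * (facePair a b x A B (j.1 + 1) - facePair a b x A B j.1) else 0 := by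
  by_cases hp : A.card = p
  swap
  · simp [leftTerm, rightTerm, facePair, extend_of_card_ne a _ hp]
  subst hp
  by_cases hA : j ∈ A <;> by_cases hB : j ∈ B
  · have h : A ∪ B ≠ S.erase j := fun h =>
      Finset.notMem_erase j S (h ▸ Finset.mem_union_left _ hA)
    simp [hA, hB, h, facePair_succ]
  · have h : A ∪ B ≠ S.erase j := fun h =>
      Finset.notMem_erase j S (h ▸ Finset.mem_union_left _ hA)
    have h' : A ∪ insert j B = A ∪ B := by
      rw [Finset.union_insert, Finset.insert_eq_of_mem (Finset.mem_union_left _ hA)]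
    have hc : (A ∩ insert j B).card = (A ∩ B).card + 1 := by
      rw [Finset.inter_insert_of_mem hA, Finset.card_insert_of_notMem (by simp [hB])]
    simp only [h, h', hc, hA, hB, not_true, not_false_eq_true, false_and, true_and, and_false,
      if_false]
    split_ifs with h1
    · obtain ⟨-, rfl⟩ := h1
      rw [rightTerm_of_mem (A ∩ B).card hA hB rfl]
      simp
    · simp
  · have h : A ∪ B ≠ S.erase j := fun h =>
      Finset.notMem_erase j S (h ▸ Finset.mem_union_right _ hB)
    have h' : insert j A ∪ B = A ∪ B := by
      rw [Finset.insert_union, Finset.insert_eq_of_mem (Finset.mem_union_right _ hB)]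
    have hc : (insert j A ∩ B).card = (A ∩ B).card + 1 := by
      rw [Finset.insert_inter_of_mem hB, Finset.card_insert_of_notMem (by simp [hA])]
    simp only [h, h', hc, hA, hB, not_true, not_false_eq_true, false_and, true_and, and_false,
      if_false]
    split_ifs with h1
    · obtain ⟨-, rfl⟩ := h1
      rw [leftTerm_of_mem (A ∩ B).card hA hB]
      simp
    · simp
  · have h1 : (j ∈ S ∧ A ∪ B = S.erase j) ↔ insert j (A ∪ B) = S := by
      constructor
      · rintro ⟨h, h'⟩
        rw [h', Finset.insert_erase h]
      · rintro rfl
        exact ⟨Finset.mem_insert_self _ _, by rw [Finset.erase_insert (by simp [hA, hB])]⟩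
    simp only [← and_assoc, h1]
    rw [facePair_succ (by simp [hA, hB]), sub_self, mul_zero, ite_self, neg_zero,
      Finset.insert_inter_of_notMem hB, Finset.inter_insert_of_notMem hA, Finset.insert_union,
      Finset.union_insert]
    simp only [hA, hB, not_false_eq_true, true_and]
    split_ifs with h2
    · obtain ⟨rfl, hi⟩ := h2
      rw [← leftTerm_add_rightTerm i hA hB hi]
      ring
    · simp

/-- The threshold differences of `face_terms` telescope over all directions `j`, which leaves the
two extreme thresholds. -/
theorem coboundary_cup_sub {p q : ℕ} (i : ℕ) {r : ℕ} (hr : p + q = r + i) (a : Cochain d p R)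
    (b : Cochain d q R) (c : Cell d (r + 1)) :
    coboundary (cup i a b : Cochain d r R) c - (cup i (coboundary a) b : Cochain d (r + 1) R) c -
      (-1) ^ p * (cup i a (coboundary b) : Cochain d (r + 1) R) c =
    - ∑ A, ∑ B, if A ∪ B = c.2.1 ∧ (A ∩ B).card + 1 = i then defectSign R (i - 1) A B *
      (facePair a b c.1 A B d - facePair a b c.1 A B 0) else 0 := by
  rw [coboundary_cup i hr, cup_coboundary_left, cup_coboundary_right, Finset.mul_sum,
    ← Finset.sum_sub_distrib, ← Finset.sum_sub_distrib]
  simp_rw [Finset.mul_sum, ← Finset.sum_sub_distrib, ← sum_facePair_succ, Finset.mul_sum]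
  rw [Finset.sum_comm, ← Finset.sum_neg_distrib]
  refine Finset.sum_congr rfl fun A _ => ?_
  rw [Finset.sum_comm, ← Finset.sum_neg_distrib]
  refine Finset.sum_congr rfl fun B _ => ?_
  rw [Finset.sum_congr rfl fun j _ => face_terms i a b c.1 c.2.1 A B j, Finset.sum_neg_distrib]
  split_ifs
  · rfl
  · simp

/-- The Leibniz rule for the cup product. -/
theorem coboundary_cup_zero {p q : ℕ} (a : Cochain d p R) (b : Cochain d q R) :
    coboundary (cup 0 a b : Cochain d (p + q) R) =
      cup 0 (coboundary a) b + (-1 : ℤ) ^ p • cup 0 a (coboundary b) := by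
  funext c
  have h := coboundary_cup_sub 0 (add_zero (p + q)).symm a b c
  -- For `i = 0` the defect condition `(A ∩ B).card + 1 = 0` never holds, so the truncated `i - 1`
  -- plays no role.
  simp only [Nat.add_eq_zero_iff, one_ne_zero, and_false, if_false, Finset.sum_const_zero,
    neg_zero] at h
  simp only [Pi.add_apply, Pi.smul_apply]
  simp only [zsmul_eq_mul]
  push_cast
  linear_combination h

theorem defectSign_eq_left {A B : Finset (Fin d)} {i : ℕ} (h : (A ∩ B).card = i) :
    defectSign R i A B = -((-1) ^ (A.card + B.card + (i + 1)) * cupSign R i A B) := by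
  rw [card_eq_inter_add_sdiff A B, card_eq_inter_add_sdiff B A, Finset.inter_comm B A, h,
    defectSign, cupSign, ← pow_add, ← neg_one_mul (_ ^ _), ← pow_succ']
  apply neg_one_pow_congr
  simp only [Nat.even_iff]
  omega

theorem defectSign_eq_right {A B : Finset (Fin d)} {i : ℕ} (h : (A ∩ B).card = i) :
    defectSign R i A B =
      (-1) ^ (A.card * B.card + A.card + B.card) * cupSign R i B A := by
  have h1 := inversions_add_swap (U := A \ B) (V := B \ A) disjoint_sdiff_sdiff
  rw [card_eq_inter_add_sdiff A B, card_eq_inter_add_sdiff B A, Finset.inter_comm B A, h,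
    defectSign, cupSign, ← pow_add]
  apply neg_one_pow_congr
  -- The remaining parity argument is linear with the products as atoms; only the parity of `i * i`
  -- has to be supplied.
  have h2 : Even (i * i) ↔ Even i := by simp [Nat.even_mul]
  simp only [Nat.even_iff, Nat.add_mul, Nat.mul_add, mul_comm (A \ B).card i] at h2 ⊢
  omega

/-- The coboundary formula for the higher cup products. -/
theorem cupRelation (d : ℕ) (R : Type*) [CommRing R] (i p q : ℕ) :
    CupRelation d R i p q ((-1) ^ p) ((-1) ^ (p + q + (i + 1))) ((-1) ^ (p * q + p + q)) := by
  intro r hr a b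
  funext c
  have h := coboundary_cup_sub (i + 1) hr a b c
  simp only [Pi.add_apply, Pi.smul_apply]
  simp only [zsmul_eq_mul]
  push_cast
  -- The sums in `b ∪_i a` are exchanged so that `A` again carries `a`; both products can then be
  -- compared with the defect for each pair `(A, B)`.
  rw [cup_apply i a b, cup_apply i b a, Finset.sum_comm (γ := Finset (Fin d))
    (f := fun A B => if A ∪ B = c.2.1 ∧ (A ∩ B).card = i then
      cupSign R i A B * facePair b a c.1 A B d else 0), Finset.mul_sum, Finset.mul_sum]
  simp_rw [Finset.mul_sum]
  rw [add_assoc, ← Finset.sum_add_distrib, ← sub_eq_iff_eq_add', sub_add_eq_sub_sub, h,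
    ← Finset.sum_neg_distrib]
  refine Finset.sum_congr rfl fun A _ => ?_
  rw [← Finset.sum_neg_distrib, ← Finset.sum_add_distrib]
  refine Finset.sum_congr rfl fun B _ => ?_
  rw [Finset.union_comm B A, Finset.inter_comm B A]
  simp only [Nat.add_right_cancel_iff, Nat.add_sub_cancel]
  split_ifs with hi
  · by_cases hA : A.card = p
    · by_cases hB : B.card = q
      · rw [facePair_swap a b c.1 A B]
        have hl := defectSign_eq_left (R := R) hi.2
        have hr := defectSign_eq_right (R := R) hi.2
        rw [hA, hB] at hl hr
        linear_combination (-facePair a b c.1 A B d) * hl + facePair a b c.1 A B 0 * hr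
      · simp [facePair, extend_of_card_ne b _ hB]
    · simp [facePair, extend_of_card_ne a _ hA]
  · simp

theorem cupRelation_add_two (d : ℕ) (R : Type*) [CommRing R] (i p q : ℕ) :
    CupRelation d R i (p + 2) (q + 2)
      ((-1) ^ p) ((-1) ^ (p + q + (i + 1))) ((-1) ^ (p * q + p + q)) := by
  have h := cupRelation d R i (p + 2) (q + 2)
  have h1 : (-1 : ℤ) ^ (p + 2) = (-1) ^ p := neg_one_pow_congr (by grind)
  have h2 : (-1 : ℤ) ^ (p + 2 + (q + 2) + (i + 1)) = (-1) ^ (p + q + (i + 1)) :=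
    neg_one_pow_congr (by grind)
  have h3 : (-1 : ℤ) ^ ((p + 2) * (q + 2) + (p + 2) + (q + 2)) = (-1) ^ (p * q + p + q) :=
    neg_one_pow_congr (by grind)
  rwa [h1, h2, h3] at h

end

section


variable {d : ℕ} {R : Type*} [CommRing R]

/-! ### Locality and bilinearity -/

theorem dist_shift_shift_le (x : Fin d → ℤ) (T U : Finset (Fin d)) :
    dist (shift x T) (shift x U) ≤ 1 := by
  refine (dist_pi_le_iff zero_le_one).2 fun j => ?_
  simp only [shift, Int.dist_eq]
  split_ifs <;> simp

theorem shift_empty (x : Fin d → ℤ) : shift x ∅ = x := by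
  funext j; simp [shift]

theorem dist_shift_le (x : Fin d → ℤ) (T : Finset (Fin d)) : dist (shift x T) x ≤ 1 := by
  simpa only [shift_empty] using dist_shift_shift_le x T ∅

/-- The base points of the faces of a unit cube are vertices of it, at sup-distance at most one. The
finiteness and range bounds for cup products below come from this. -/
theorem exists_of_cup_ne_zero {i p q r : ℕ} {a : Cochain d p R} {b : Cochain d q R} {c : Cell d r}
    (h : cup i a b c ≠ 0) :
    ∃ s t, a s ≠ 0 ∧ b t ≠ 0 ∧ dist s.1 t.1 ≤ 1 ∧ dist s.1 c.1 ≤ 1 ∧ dist t.1 c.1 ≤ 1 := by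
  obtain ⟨A, -, hA⟩ := Finset.exists_ne_zero_of_sum_ne_zero h
  obtain ⟨B, -, hB⟩ := Finset.exists_ne_zero_of_sum_ne_zero hA
  rw [ne_eq, ite_eq_right_iff, Classical.not_imp] at hB
  exact ⟨_, _, right_ne_zero_of_mul (left_ne_zero_of_mul hB.2), right_ne_zero_of_mul hB.2,
    dist_shift_shift_le _ _ _, dist_shift_le _ _, dist_shift_le _ _⟩

theorem exists_of_coboundary_ne_zero {n : ℕ} {M : Type*} [AddCommGroup M] {a : Cochain d n M}
    {c : Cell d (n + 1)} (h : coboundary a c ≠ 0) : ∃ s, a s ≠ 0 ∧ dist s.1 c.1 ≤ 1 := by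
  by_contra! hs
  refine h (Finset.sum_eq_zero fun j _ => ?_)
  have h1 : ∀ (x : Fin d → ℤ) (S : Dirs d n), dist x c.1 ≤ 1 → a (x, S) = 0 := fun x S h' => by
    by_contra h0
    exact absurd h' (not_le.2 (hs (x, S) h0))
  have h2 : dist c.1 c.1 ≤ 1 := by rw [dist_self]; exact zero_le_one
  rw [h1 _ _ (dist_shift_le c.1 {j.1}), h1 _ _ h2, sub_zero, smul_zero]

theorem finite_setOf_exists_dist_le {m n : ℕ} {F : Set (Cell d m)} (hF : F.Finite) (ρ : ℝ) :
    {c : Cell d n | ∃ s ∈ F, dist s.1 c.1 ≤ ρ}.Finite := by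
  have : {c : Cell d n | ∃ s ∈ F, dist s.1 c.1 ≤ ρ} ⊆
      ⋃ s ∈ F, Metric.closedBall s.1 ρ ×ˢ Set.univ := by
    rintro c ⟨s, hs, hc⟩
    simp only [Set.mem_iUnion]
    exact ⟨s, hs, by simpa [Metric.mem_closedBall, dist_comm] using hc⟩
  exact (hF.biUnion fun s _ =>
    ((isCompact_closedBall s.1 ρ).finite_of_discrete).prod Set.finite_univ).subset this

theorem support_coboundary_finite {n : ℕ} {a : Cochain d n R} (ha : (Function.support a).Finite) :
    (Function.support (coboundary a)).Finite :=
  (finite_setOf_exists_dist_le ha 1).subset fun _ hc => exists_of_coboundary_ne_zero hc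

theorem support_cup_finite {i p q r : ℕ} {a : Cochain d p R}
    (ha : (Function.support a).Finite) (b : Cochain d q R) :
    (Function.support (cup i a b : Cochain d r R)).Finite :=
  (finite_setOf_exists_dist_le ha 1).subset fun _ hc => by
    obtain ⟨s, t, h⟩ := exists_of_cup_ne_zero hc
    exact ⟨s, h.1, h.2.2.2.1⟩

theorem cup_add_left {i p q r : ℕ} (a a' : Cochain d p R) (b : Cochain d q R) :
    (cup i (a + a') b : Cochain d r R) = cup i a b + cup i a' b := by
  funext c
  simp only [cup, Pi.add_apply, ← Finset.sum_add_distrib]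
  refine Finset.sum_congr rfl fun A _ => Finset.sum_congr rfl fun B _ => ?_
  split_ifs
  · ring
  · simp

theorem cup_add_right {i p q r : ℕ} (a : Cochain d p R) (b b' : Cochain d q R) :
    (cup i a (b + b') : Cochain d r R) = cup i a b + cup i a b' := by
  funext c
  simp only [cup, Pi.add_apply, ← Finset.sum_add_distrib]
  refine Finset.sum_congr rfl fun A _ => Finset.sum_congr rfl fun B _ => ?_
  split_ifs
  · ring
  · simp

theorem cup_smul_left {i p q r : ℕ} (u : R) (a : Cochain d p R) (b : Cochain d q R) :
    (cup i (u • a) b : Cochain d r R) = u • cup i a b := by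
  funext c
  simp only [cup, Pi.smul_apply, smul_eq_mul, Finset.mul_sum]
  refine Finset.sum_congr rfl fun A _ => Finset.sum_congr rfl fun B _ => ?_
  split_ifs
  · ring
  · simp

theorem cup_smul_right {i p q r : ℕ} (u : R) (a : Cochain d p R) (b : Cochain d q R) :
    (cup i a (u • b) : Cochain d r R) = u • cup i a b := by
  funext c
  simp only [cup, Pi.smul_apply, smul_eq_mul, Finset.mul_sum]
  refine Finset.sum_congr rfl fun A _ => Finset.sum_congr rfl fun B _ => ?_
  split_ifs
  · ring
  · simp

theorem coboundary_add {n : ℕ} (a b : Cochain d n R) :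
    coboundary (a + b) = coboundary a + coboundary b := by
  funext c
  simp only [coboundary, Pi.add_apply, ← Finset.sum_add_distrib, ← smul_add]
  refine Finset.sum_congr rfl fun j _ => ?_
  congr 1
  ring

theorem coboundary_smul {n : ℕ} (u : R) (a : Cochain d n R) :
    coboundary (u • a) = u • coboundary a := by
  funext c
  simp only [coboundary, Pi.smul_apply, Finset.smul_sum, smul_comm u, smul_sub]

theorem integral_add {a b : Cochain d d R} (ha : (Function.support a).Finite)
    (hb : (Function.support b).Finite) : integral (a + b) = integral a + integral b :=
  finsum_add_distrib ha hb

theorem integral_smul (u : R) {a : Cochain d d R} (ha : (Function.support a).Finite) :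
    integral (u • a) = u * integral a :=
  (mul_finsum' a u ha).symm

/-! ### The complex of finitely supported cochains -/

/-- Removing `j` and `k` in either order gives the same four corner values, while the signs differ
by one since exactly one of the two counts sees the other direction. Swapping `j` and `k` therefore
cancels the terms in pairs. -/
theorem coboundary_coboundary {n : ℕ} (a : Cochain d n R) : coboundary (coboundary a) = 0 := by
  funext c
  obtain ⟨x, S, hS⟩ := c
  rw [coboundary_apply]
  simp only [Pi.zero_apply]
  have h1 : ∀ j ∈ S, (-1 : R) ^ below S j * (extend (coboundary a) (shift x {j}) (S.erase j) -
      extend (coboundary a) x (S.erase j)) = ∑ k ∈ S, if j = k then 0 else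
        (-1) ^ (below S j + below (S.erase j) k) *
          (extend a (shift (shift x {j}) {k}) ((S.erase j).erase k)
            - extend a (shift x {j}) ((S.erase j).erase k)
            - extend a (shift x {k}) ((S.erase j).erase k) + extend a x ((S.erase j).erase k)) := by
    intro j hj
    rw [extend_coboundary, extend_coboundary, ← Finset.sum_sub_distrib, Finset.mul_sum,
      ← Finset.add_sum_erase S _ hj, if_pos rfl, zero_add]
    refine Finset.sum_congr rfl fun k hk => ?_
    rw [if_neg (Finset.ne_of_mem_erase hk).symm]
    ring
  rw [Finset.sum_congr rfl h1, ← Finset.sum_product']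
  refine Finset.sum_involution (fun w _ => (w.2, w.1)) ?_ ?_ ?_ ?_
  · rintro ⟨j, k⟩ hw
    simp only [Finset.mem_product] at hw
    by_cases hjk : j = k
    · simp [hjk]
    · have h2 : below (S.erase j) k + (if j < k then 1 else 0) = below S k := by
        rw [← below_insert (by simp), Finset.insert_erase hw.1]
      have h3 : below (S.erase k) j + (if k < j then 1 else 0) = below S j := by
        rw [← below_insert (by simp), Finset.insert_erase hw.2]
      have h4 : (-1 : R) ^ (below S j + below (S.erase j) k + 1) =
          (-1) ^ (below S k + below (S.erase k) j) := by
        apply neg_one_pow_congr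
        rw [← h2, ← h3]
        rcases lt_or_gt_of_ne hjk with h | h
        · rw [if_pos h, if_neg h.not_gt, Nat.even_iff, Nat.even_iff]; omega
        · rw [if_pos h, if_neg h.not_gt, Nat.even_iff, Nat.even_iff]; omega
      simp only [hjk, Ne.symm hjk, if_false]
      rw [Finset.erase_right_comm, ← h4, shift_comm x {k}]
      ring
  · rintro ⟨j, k⟩ _ h
    simp only at h ⊢
    intro h'
    have : k = j := congrArg Prod.fst h'
    simp [this] at h
  · rintro ⟨j, k⟩ hw
    simpa [and_comm] using hw
  · rintro ⟨j, k⟩ _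
    rfl

/-- In each direction the summand is a finitely supported function minus its translate, and the two
have the same sum. -/
theorem integral_coboundary {r : ℕ} {a : Cochain (r + 1) r R} (ha : (Function.support a).Finite) :
    integral (coboundary a) = 0 := by
  have key : ∀ j : Fin (r + 1), (∑ᶠ c : Cell (r + 1) (r + 1),
      (-1) ^ below c.2.1 j * (extend a (shift c.1 {j}) (c.2.1.erase j) -
        extend a c.1 (c.2.1.erase j))) = 0 ∧ (Function.support fun c : Cell (r + 1) (r + 1) =>
      (-1) ^ below c.2.1 j * (extend a (shift c.1 {j}) (c.2.1.erase j) -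
        extend a c.1 (c.2.1.erase j))).Finite := by
    intro j
    let e : Cell (r + 1) (r + 1) ≃ Cell (r + 1) (r + 1) :=
      { toFun := fun c => (shift c.1 {j}, c.2)
        invFun := fun c => (fun t => c.1 t - if t ∈ ({j} : Finset _) then 1 else 0, c.2)
        left_inv := fun c => by ext <;> simp [shift]
        right_inv := fun c => by ext <;> simp [shift] }
    let g : Cell (r + 1) (r + 1) → R := fun c => (-1) ^ below c.2.1 j * extend a c.1 (c.2.1.erase j)
    have hg : (Function.support g).Finite := by
      refine (finite_setOf_exists_dist_le ha 0).subset fun c hc => ?_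
      have hc' : extend a c.1 (c.2.1.erase j) ≠ 0 := right_ne_zero_of_mul hc
      rw [extend] at hc'
      split_ifs at hc' with h
      · exact ⟨_, hc', by simp⟩
      · exact absurd rfl hc'
    have hge : (Function.support fun c => g (e c)).Finite := by
      exact hg.preimage e.injective.injOn
    have heq : (fun c : Cell (r + 1) (r + 1) =>
      (-1) ^ below c.2.1 j * (extend a (shift c.1 {j}) (c.2.1.erase j) -
        extend a c.1 (c.2.1.erase j))) = fun c => g (e c) - g c := by
      funext c
      simp only [g, e, Equiv.coe_fn_mk]
      ring
    rw [heq]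
    refine ⟨?_, (hge.union hg).subset (Function.support_sub _ _)⟩
    rw [finsum_sub_distrib hge hg, finsum_comp_equiv e, sub_self]
  have hu : ∀ c : Cell (r + 1) (r + 1), c.2.1 = Finset.univ := fun c =>
    (Finset.card_eq_iff_eq_univ _).1 (by rw [c.2.2, Fintype.card_fin])
  rw [integral, finsum_congr fun c => (coboundary_apply a c).trans
    (Finset.sum_congr (hu c) fun _ _ => rfl), finsum_sum_comm _ _ fun j _ => (key j).2]
  exact Finset.sum_eq_zero fun j _ => (key j).1

/-- `∫ a ∪_i b` as a bilinear form on finitely supported cochains. -/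
def cupForm (R : Type*) [CommRing R] (d i p q : ℕ) :
    (Cell d p →₀ R) →ₗ[R] (Cell d q →₀ R) →ₗ[R] R :=
  LinearMap.mk₂ R (fun a b => integral (cup i (a : Cochain d p R) (b : Cochain d q R)))
    (fun a a' b => by
      rw [Finsupp.coe_add, cup_add_left, integral_add (support_cup_finite a.hasFiniteSupport _)
        (support_cup_finite a'.hasFiniteSupport _)])
    (fun u a b => by
      rw [Finsupp.coe_smul, cup_smul_left, integral_smul _ (support_cup_finite a.hasFiniteSupport _)]
      rfl)
    (fun a b b' => by
      rw [Finsupp.coe_add, cup_add_right, integral_add (support_cup_finite a.hasFiniteSupport _)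
        (support_cup_finite a.hasFiniteSupport _)])
    (fun u a b => by
      rw [Finsupp.coe_smul, cup_smul_right, integral_smul _ (support_cup_finite a.hasFiniteSupport _)]
      rfl)

theorem cupForm_apply {i p q : ℕ} (a : Cell d p →₀ R) (b : Cell d q →₀ R) :
    cupForm R d i p q a b = integral (cup i (a : Cochain d p R) (b : Cochain d q R)) := rfl

theorem coe_single_one {n : ℕ} (s : Cell d n) :
    ((Finsupp.single s 1 : Cell d n →₀ R) : Cochain d n R) = dual R s := by
  rw [Finsupp.single_eq_pi_single]; rfl

theorem cupForm_single_single {i p q : ℕ} (s : Cell d p) (t : Cell d q) :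
    cupForm R d i p q (Finsupp.single s 1) (Finsupp.single t 1) = cupPairing i R s t := by
  rw [cupForm_apply, coe_single_one, coe_single_one]; rfl

theorem exists_of_cupForm_ne_zero {i p q : ℕ} {a : Cell d p →₀ R} {b : Cell d q →₀ R}
    (h : cupForm R d i p q a b ≠ 0) : ∃ s t, a s ≠ 0 ∧ b t ≠ 0 ∧ dist s.1 t.1 ≤ 1 := by
  rw [cupForm_apply, integral] at h
  obtain ⟨c, hc⟩ : ∃ c, cup i (a : Cochain d p R) (b : Cochain d q R) c ≠ 0 := by
    by_contra! h0
    exact h (finsum_eq_zero_of_forall_eq_zero h0)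
  obtain ⟨s, t, h⟩ := exists_of_cup_ne_zero hc
  exact ⟨s, t, h.1, h.2.1, h.2.2.1⟩

/-- The coboundary of finitely supported cochains. -/
def delta (R : Type*) [CommRing R] (d n : ℕ) : (Cell d n →₀ R) →ₗ[R] (Cell d (n + 1) →₀ R) where
  toFun a := Finsupp.ofSupportFinite (coboundary (a : Cochain d n R))
    (support_coboundary_finite a.hasFiniteSupport)
  map_add' a b := DFunLike.coe_injective (coboundary_add (a : Cochain d n R) b)
  map_smul' u a := DFunLike.coe_injective (coboundary_smul u (a : Cochain d n R))

theorem coe_delta {n : ℕ} (a : Cell d n →₀ R) :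
    (delta R d n a : Cochain d (n + 1) R) = coboundary (a : Cochain d n R) := rfl

theorem delta_delta {n : ℕ} (a : Cell d n →₀ R) : delta R d (n + 1) (delta R d n a) = 0 :=
  DFunLike.coe_injective (coboundary_coboundary (a : Cochain d n R))

/-- Integration by parts: the Leibniz rule combined with the vanishing of the integral of a
coboundary. -/
theorem cupForm_delta {p q r : ℕ} (h : p + q = r) (a : Cell (r + 1) p →₀ R)
    (b : Cell (r + 1) q →₀ R) :
    cupForm R (r + 1) 0 (p + 1) q (delta R _ p a) b +
      (-1) ^ p * cupForm R (r + 1) 0 p (q + 1) a (delta R _ q b) = 0 := by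
  subst h
  have h := congrArg integral (coboundary_cup_zero (a : Cochain (p + q + 1) p R) b)
  rw [integral_coboundary (support_cup_finite a.hasFiniteSupport _), ← Int.cast_smul_eq_zsmul R,
    integral_add (support_cup_finite (support_coboundary_finite a.hasFiniteSupport) _)
      ((support_cup_finite a.hasFiniteSupport _).subset (Function.support_const_smul_subset _ _)),
    integral_smul _ (support_cup_finite a.hasFiniteSupport _)] at h
  rw [cupForm_apply, cupForm_apply, coe_delta, coe_delta, h]
  push_cast
  rfl

theorem cupForm_succ_delta {i p q r : ℕ} (h : p + q = r + (i + 1)) (a : Cell (r + 1) p →₀ R)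
    (b : Cell (r + 1) q →₀ R) :
    cupForm R (r + 1) (i + 1) (p + 1) q (delta R _ p a) b +
      (-1) ^ p * cupForm R (r + 1) (i + 1) p (q + 1) a (delta R _ q b) +
      (-1) ^ (p + q + (i + 1)) * cupForm R (r + 1) i p q a b +
      (-1) ^ (p * q + p + q) * cupForm R (r + 1) i q p b a = 0 := by
  have h := congrArg integral (cupRelation (r + 1) R i p q r h (a : Cochain (r + 1) p R) b)
  have fa := a.hasFiniteSupport
  have fb := b.hasFiniteSupport
  have fs : ∀ (u : R) {c : Cochain (r + 1) (r + 1) R}, (Function.support c).Finite →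
    (Function.support (u • c)).Finite := fun u c hc =>
      hc.subset (Function.support_const_smul_subset _ _)
  have fadd : ∀ {c c' : Cochain (r + 1) (r + 1) R}, (Function.support c).Finite →
    (Function.support c').Finite → (Function.support (c + c')).Finite := fun hc hc' =>
      (hc.union hc').subset (Function.support_add _ _)
  rw [integral_coboundary (support_cup_finite fa _)] at h
  simp only [← Int.cast_smul_eq_zsmul R] at h
  have f1 := support_cup_finite (i := i + 1) (r := r + 1) (support_coboundary_finite fa) b
  have f2 : ∀ u : R, _ := fun u => fs u (support_cup_finite (i := i + 1) (r := r + 1) fa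
    (coboundary b))
  have f3 : ∀ u : R, _ := fun u => fs u (support_cup_finite (i := i) (r := r + 1) fa b)
  have f4 : ∀ u : R, _ := fun u => fs u (support_cup_finite (i := i) (r := r + 1) fb a)
  rw [integral_add (fadd (fadd f1 (f2 _)) (f3 _)) (f4 _), integral_add (fadd f1 (f2 _)) (f3 _),
    integral_add f1 (f2 _), integral_smul _ (support_cup_finite fa _),
    integral_smul _ (support_cup_finite fa _), integral_smul _ (support_cup_finite fb _)] at h
  rw [cupForm_apply, cupForm_apply, cupForm_apply, cupForm_apply, coe_delta, coe_delta, h]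
  push_cast
  rfl

end

section


variable {d : ℕ} {R : Type*} [CommRing R]

/-! ### Operators of finite range on finitely supported functions -/

section Operators

variable {ι κ μ E : Type*} [PseudoMetricSpace E]

/-- The pairing `∑ z_s a_s`. -/
def dot : (ι →₀ R) →ₗ[R] (ι →₀ R) →ₗ[R] R :=
  Finsupp.linearCombination R fun s => Finsupp.lapply s

theorem dot_apply (z a : ι →₀ R) : dot z a = z.sum fun s b => b * a s := by
  rw [dot, Finsupp.linearCombination_apply, Finsupp.sum, LinearMap.sum_apply, Finsupp.sum]
  rfl

@[simp] theorem dot_single_left (s : ι) (u : R) (a : ι →₀ R) :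
    dot (Finsupp.single s u) a = u * a s := by
  rw [dot_apply, Finsupp.sum_single_index (zero_mul _)]

theorem dot_comm (z a : ι →₀ R) : dot z a = dot a z := by
  classical
  have : (dot : (ι →₀ R) →ₗ[R] (ι →₀ R) →ₗ[R] R) = dot.flip := by
    refine Finsupp.lhom_ext fun s u => Finsupp.lhom_ext fun t v => ?_
    rw [LinearMap.flip_apply, dot_single_left, dot_single_left, Finsupp.single_apply,
      Finsupp.single_apply]
    by_cases h : s = t
    · subst h; simp [mul_comm]
    · simp [h, Ne.symm h]
  exact congrArg (fun f => f z a) this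

@[simp] theorem dot_single_right (s : ι) (u : R) (a : ι →₀ R) :
    dot a (Finsupp.single s u) = a s * u := by
  rw [dot_comm, dot_single_left, mul_comm]

theorem ext_dot {z z' : ι →₀ R} (h : ∀ a, dot z a = dot z' a) : z = z' := by
  ext s
  simpa using h (Finsupp.single s 1)

theorem exists_of_map_apply_ne_zero {T : (ι →₀ R) →ₗ[R] (κ →₀ R)} {v : ι →₀ R} {t : κ}
    (h : T v t ≠ 0) : ∃ u, v u ≠ 0 ∧ T (Finsupp.single u 1) t ≠ 0 := by
  have h1 : T v t = v.sum fun u c => c * T (Finsupp.single u 1) t := by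
    conv_lhs => rw [← Finsupp.sum_single v]
    rw [Finsupp.sum, map_sum, Finsupp.finsetSum_apply]
    refine Finset.sum_congr rfl fun u _ => ?_
    rw [← mul_one (v u), ← smul_eq_mul, ← Finsupp.smul_single, map_smul]
    simp
  rw [h1] at h
  obtain ⟨u, -, hu⟩ := Finset.exists_ne_zero_of_sum_ne_zero h
  exact ⟨u, left_ne_zero_of_mul hu, right_ne_zero_of_mul hu⟩

/-- Linear maps that move supports by a bounded distance, with respect to positions `f` and `g`. -/
def FiniteRange (f : ι → E) (g : κ → E) (T : (ι →₀ R) →ₗ[R] (κ →₀ R)) : Prop :=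
  ∃ r : ℝ, ∀ s t, T (Finsupp.single s 1) t ≠ 0 → dist (f s) (g t) ≤ r

namespace FiniteRange

variable {f : ι → E} {g : κ → E} {h : μ → E} {T T' : (ι →₀ R) →ₗ[R] (κ →₀ R)}

theorem zero : FiniteRange f g (0 : (ι →₀ R) →ₗ[R] (κ →₀ R)) :=
  ⟨0, fun _ _ hst => absurd rfl hst⟩

theorem id : FiniteRange f f (LinearMap.id : (ι →₀ R) →ₗ[R] (ι →₀ R)) := by
  classical
  refine ⟨0, fun s t hst => ?_⟩
  rw [LinearMap.id_apply, Finsupp.single_apply] at hst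
  by_cases h : s = t
  · simp [h]
  · simp [h] at hst

theorem add (hT : FiniteRange f g T) (hT' : FiniteRange f g T') : FiniteRange f g (T + T') := by
  obtain ⟨r, hr⟩ := hT
  obtain ⟨r', hr'⟩ := hT'
  refine ⟨max r r', fun s t hst => ?_⟩
  rw [LinearMap.add_apply, Finsupp.add_apply] at hst
  by_cases h0 : T (Finsupp.single s 1) t = 0
  · rw [h0, zero_add] at hst
    exact le_max_of_le_right (hr' s t hst)
  · exact le_max_of_le_left (hr s t h0)

theorem smul (u : R) (hT : FiniteRange f g T) : FiniteRange f g (u • T) := by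
  obtain ⟨r, hr⟩ := hT
  exact ⟨r, fun s t hst => hr s t (right_ne_zero_of_mul hst)⟩

theorem neg (hT : FiniteRange f g T) : FiniteRange f g (-T) := by
  obtain ⟨r, hr⟩ := hT
  exact ⟨r, fun s t hst => hr s t (neg_ne_zero.1 hst)⟩

theorem comp {U : (κ →₀ R) →ₗ[R] (μ →₀ R)} (hU : FiniteRange g h U) (hT : FiniteRange f g T) :
    FiniteRange f h (U ∘ₗ T) := by
  obtain ⟨r, hr⟩ := hT
  obtain ⟨r', hr'⟩ := hU
  refine ⟨r + r', fun s t hst => ?_⟩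
  obtain ⟨u, hu, hu'⟩ := exists_of_map_apply_ne_zero (T := U) (v := T (Finsupp.single s 1)) hst
  exact (dist_triangle _ _ _).trans (add_le_add (hr s u hu) (hr' u t hu'))

end FiniteRange

end Operators

variable {i p q n : ℕ}

theorem cupForm_single_left_support_finite (i : ℕ) (b : Cell d q →₀ R) :
    (Function.support fun s : Cell d p => cupForm R d i p q (Finsupp.single s 1) b).Finite := by
  refine (finite_setOf_exists_dist_le b.hasFiniteSupport 1).subset fun s hs => ?_
  obtain ⟨s', t, h1, h2, h3⟩ := exists_of_cupForm_ne_zero hs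
  obtain rfl : s = s' := by
    by_contra h; exact h1 (Finsupp.single_eq_of_ne (Ne.symm h))
  exact ⟨t, h2, by rwa [dist_comm]⟩

theorem cupForm_single_right_support_finite (i : ℕ) (a : Cell d p →₀ R) :
    (Function.support fun t : Cell d q => cupForm R d i p q a (Finsupp.single t 1)).Finite := by
  refine (finite_setOf_exists_dist_le a.hasFiniteSupport 1).subset fun s hs => ?_
  obtain ⟨t, s', h1, h2, h3⟩ := exists_of_cupForm_ne_zero hs
  obtain rfl : s = s' := by
    by_contra h; exact h2 (Finsupp.single_eq_of_ne (Ne.symm h))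
  exact ⟨t, h1, h3⟩

/-- `b ↦ (s ↦ ∫ 𝐬 ∪_i b)`. -/
def cupLeft (R : Type*) [CommRing R] (d i p q : ℕ) : (Cell d q →₀ R) →ₗ[R] (Cell d p →₀ R) where
  toFun b := Finsupp.ofSupportFinite _ (cupForm_single_left_support_finite i b)
  map_add' b b' := by ext s; exact map_add (cupForm R d i p q (Finsupp.single s 1)) b b'
  map_smul' u b := by ext s; exact map_smul (cupForm R d i p q (Finsupp.single s 1)) u b

/-- `a ↦ (t ↦ ∫ a ∪_i 𝐭)`. -/
def cupRight (R : Type*) [CommRing R] (d i p q : ℕ) : (Cell d p →₀ R) →ₗ[R] (Cell d q →₀ R) where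
  toFun a := Finsupp.ofSupportFinite _ (cupForm_single_right_support_finite i a)
  map_add' a a' := by
    ext t; exact map_add ((cupForm R d i p q).flip (Finsupp.single t 1)) a a'
  map_smul' u a := by
    ext t; exact map_smul ((cupForm R d i p q).flip (Finsupp.single t 1)) u a

theorem cupLeft_apply (b : Cell d q →₀ R) (s : Cell d p) :
    cupLeft R d i p q b s = cupForm R d i p q (Finsupp.single s 1) b := rfl

theorem cupRight_apply (a : Cell d p →₀ R) (t : Cell d q) :
    cupRight R d i p q a t = cupForm R d i p q a (Finsupp.single t 1) := rfl

/-- With respect to `dot`, `cupLeft` and `cupRight` are the matrix of the cup form and its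
transpose. Identities between operators can thus be tested on bilinear forms. -/
theorem dot_cupLeft (a : Cell d p →₀ R) (b : Cell d q →₀ R) :
    dot a (cupLeft R d i p q b) = cupForm R d i p q a b := by
  have : dot.flip (cupLeft R d i p q b) = (cupForm R d i p q).flip b := by
    refine Finsupp.lhom_ext' fun s => LinearMap.ext_ring ?_
    simp [cupLeft_apply]
  exact congrArg (fun f => f a) this

theorem dot_cupRight (a : Cell d p →₀ R) (b : Cell d q →₀ R) :
    dot (cupRight R d i p q a) b = cupForm R d i p q a b := by
  have : dot (cupRight R d i p q a) = cupForm R d i p q a := by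
    refine Finsupp.lhom_ext' fun s => LinearMap.ext_ring ?_
    simp [cupRight_apply]
  exact congrArg (fun f => f b) this

theorem cupLeft_range {s : Cell d q} {t : Cell d p}
    (h : cupLeft R d i p q (Finsupp.single s 1) t ≠ 0) : dist s.1 t.1 ≤ 1 := by
  obtain ⟨t', s', h1, h2, h3⟩ := exists_of_cupForm_ne_zero h
  obtain rfl : t = t' := by
    by_contra h; exact h1 (Finsupp.single_eq_of_ne (Ne.symm h))
  obtain rfl : s = s' := by
    by_contra h; exact h2 (Finsupp.single_eq_of_ne (Ne.symm h))
  rwa [dist_comm]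

theorem cupRight_range {s : Cell d p} {t : Cell d q}
    (h : cupRight R d i p q (Finsupp.single s 1) t ≠ 0) : dist s.1 t.1 ≤ 1 := by
  obtain ⟨s', t', h1, h2, h3⟩ := exists_of_cupForm_ne_zero h
  obtain rfl : t = t' := by
    by_contra h; exact h2 (Finsupp.single_eq_of_ne (Ne.symm h))
  obtain rfl : s = s' := by
    by_contra h; exact h1 (Finsupp.single_eq_of_ne (Ne.symm h))
  exact h3

theorem finiteRange_cupLeft : FiniteRange Prod.fst Prod.fst (cupLeft R d i p q) :=
  ⟨1, fun _ _ => cupLeft_range⟩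

theorem finiteRange_cupRight : FiniteRange Prod.fst Prod.fst (cupRight R d i p q) :=
  ⟨1, fun _ _ => cupRight_range⟩

theorem delta_range {s : Cell d n} {t : Cell d (n + 1)}
    (h : delta R d n (Finsupp.single s 1) t ≠ 0) : dist s.1 t.1 ≤ 1 := by
  obtain ⟨s', h1, h2⟩ := exists_of_coboundary_ne_zero (a := Finsupp.single s (1 : R)) h
  obtain rfl : s = s' := by
    by_contra h; exact h1 (Finsupp.single_eq_of_ne (Ne.symm h))
  exact h2

theorem finiteRange_delta : FiniteRange Prod.fst Prod.fst (delta R d n) :=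
  ⟨1, fun _ _ => delta_range⟩

/-- The transpose of the coboundary operator. -/
def boundary (R : Type*) [CommRing R] (d n : ℕ) : (Cell d (n + 1) →₀ R) →ₗ[R] (Cell d n →₀ R) where
  toFun z := Finsupp.ofSupportFinite (fun e => dot z (delta R d n (Finsupp.single e 1))) <| by
    refine (finite_setOf_exists_dist_le z.hasFiniteSupport 1).subset fun e he => ?_
    rw [Function.mem_support, dot_apply] at he
    obtain ⟨s, -, hs⟩ := Finset.exists_ne_zero_of_sum_ne_zero he
    exact ⟨s, left_ne_zero_of_mul hs, by
      rw [dist_comm]; exact delta_range (right_ne_zero_of_mul hs)⟩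
  map_add' z z' := by
    ext e; exact map_add (dot.flip (delta R d n (Finsupp.single e 1))) z z'
  map_smul' u z := by
    ext e; exact map_smul (dot.flip (delta R d n (Finsupp.single e 1))) u z

theorem boundary_apply (z : Cell d (n + 1) →₀ R) (e : Cell d n) :
    boundary R d n z e = dot z (delta R d n (Finsupp.single e 1)) := rfl

theorem dot_boundary (z : Cell d (n + 1) →₀ R) (a : Cell d n →₀ R) :
    dot (boundary R d n z) a = dot z (delta R d n a) := by
  have : dot (boundary R d n z) = dot z ∘ₗ delta R d n := by
    refine Finsupp.lhom_ext' fun s => LinearMap.ext_ring ?_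
    simp [boundary_apply]
  exact congrArg (fun f => f a) this

theorem boundary_boundary (z : Cell d (n + 1 + 1) →₀ R) :
    boundary R d n (boundary R d (n + 1) z) = 0 :=
  ext_dot fun a => by rw [dot_boundary, dot_boundary, delta_delta, map_zero, map_zero]; rfl

/-! ### Poincaré duality -/

/-- The cell that starts at the end point of `s` and extends in the complementary directions. -/
def dualCell (h : p + q = d) (s : Cell d p) : Cell d q :=
  (shift s.1 s.2.1, ⟨s.2.1ᶜ, by rw [Finset.card_compl, s.2.2, Fintype.card_fin]; omega⟩)

theorem dualCell_injective (h : p + q = d) : Function.Injective (dualCell (d := d) h) := by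
  rintro ⟨x, S, hS⟩ ⟨y, T, hT⟩ hst
  simp only [dualCell, Prod.mk.injEq, Subtype.mk.injEq, compl_inj_iff] at hst
  obtain ⟨hxy, rfl⟩ := hst
  have : x = y := by
    funext j
    simpa [shift] using congrFun hxy j
  rw [this]

theorem dualCell_surjective (h : p + q = d) : Function.Surjective (dualCell (d := d) h) := by
  rintro ⟨y, T, hT⟩
  refine ⟨(fun j => y j - if j ∈ Tᶜ then 1 else 0,
    ⟨Tᶜ, by rw [Finset.card_compl, hT, Fintype.card_fin]; omega⟩), ?_⟩
  simp only [dualCell, compl_compl, Prod.mk.injEq, and_true]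
  funext j
  simp [shift]

/-- With no common directions the first face starts at the base point of the cube and the second
where the first ends. Hence a cell pairs with exactly one cell, with coefficient a sign. -/
theorem cupPairing_zero (h : p + q = d) (s : Cell d p) (t : Cell d q) :
    cupPairing 0 R s t = if t = dualCell h s then cupSign R 0 s.2.1 (s.2.1)ᶜ else 0 := by
  have key : ∀ c : Cell d d, (cup 0 (dual R s) (dual R t) : Cochain d d R) c =
      if t = dualCell h s ∧ c.1 = s.1 then cupSign R 0 s.2.1 (s.2.1)ᶜ else 0 := by
    intro c
    have hc : c.2.1 = Finset.univ :=
      (Finset.card_eq_iff_eq_univ _).1 (by rw [c.2.2, Fintype.card_fin])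
    have hx : ∀ A : Dirs d p, ∀ B : Dirs d q,
      (if A.1 ∪ B.1 = c.2.1 ∧ (A.1 ∩ B.1).card = 0 then
        (-1) ^ (inversions (A.1 \ B.1) (B.1 \ A.1) + 0 * (B.1 \ A.1).card) *
        dual R s (shift c.1 ((B.1 \ A.1).filter (fun j => Odd (below (A.1 ∩ B.1) j))), A) *
        dual R t (shift c.1 ((A.1 \ B.1).filter (fun j => Even (below (A.1 ∩ B.1) j))), B)
       else 0) = if A = s.2 ∧ B = t.2 then
        (if t = dualCell h s ∧ c.1 = s.1 then cupSign R 0 s.2.1 (s.2.1)ᶜ else 0) else 0 := by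
      intro A B
      by_cases hA : A = s.2
      swap
      · have : dual R s (shift c.1 ((B.1 \ A.1).filter (fun j => Odd (below (A.1 ∩ B.1) j))), A)
          = 0 := Pi.single_eq_of_ne (fun e => hA (congrArg Prod.snd e)) _
        rw [this]
        simp [hA]
      by_cases hB : B = t.2
      swap
      · have : dual R t (shift c.1 ((A.1 \ B.1).filter (fun j => Even (below (A.1 ∩ B.1) j))), B)
          = 0 := Pi.single_eq_of_ne (fun e => hB (congrArg Prod.snd e)) _
        rw [this]
        simp [hB]
      subst hA hB
      rw [if_pos (⟨rfl, rfl⟩ : s.2 = s.2 ∧ t.2 = t.2), hc]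
      by_cases hd : t.2.1 = (s.2.1)ᶜ
      · have h1 : s.2.1 ∩ (s.2.1)ᶜ = ∅ := by simp
        have h2 : s.2.1 \ (s.2.1)ᶜ = s.2.1 := by ext; simp
        have h3 : (s.2.1)ᶜ \ s.2.1 = (s.2.1)ᶜ := by ext; simp
        have h4 : ∀ j, below (∅ : Finset (Fin d)) j = 0 := fun j => rfl
        simp only [hd, cupSign, h1, h2, h3, h4, Nat.not_odd_zero, Finset.filter_false,
          shift_empty, Finset.union_compl, Finset.card_empty, and_self, if_true, Even.zero,
          Finset.filter_true, zero_mul, add_zero]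
        have e1 : dual R s (c.1, s.2) = if c.1 = s.1 then 1 else 0 := by
          rw [dual, Pi.single_apply]
          refine if_congr ⟨congrArg Prod.fst, fun e => Prod.ext e rfl⟩ rfl rfl
        have e2 : dual R t (shift c.1 s.2.1, t.2) = if t.1 = shift c.1 s.2.1 then 1 else 0 := by
          rw [dual, Pi.single_apply]
          refine if_congr ⟨fun e => (congrArg Prod.fst e).symm, fun e => Prod.ext e.symm rfl⟩ rfl rfl
        have e3 : t = dualCell h s ↔ t.1 = shift s.1 s.2.1 :=
          ⟨congrArg Prod.fst, fun e => Prod.ext e (Subtype.ext hd)⟩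
        simp only [e1, e2, e3]
        by_cases hcs : c.1 = s.1
        · rw [hcs]; simp
        · simp [hcs]
      · have h5 : ¬ (s.2.1 ∪ t.2.1 = Finset.univ ∧ (s.2.1 ∩ t.2.1).card = 0) := by
          rintro ⟨h6, h7⟩
          refine hd (IsCompl.compl_eq ?_).symm
          exact ⟨Finset.disjoint_iff_inter_eq_empty.2 (Finset.card_eq_zero.1 h7),
            codisjoint_iff.2 h6⟩
        rw [if_neg h5, if_neg fun e => hd ?_]
        rw [e.1]; rfl
    rw [cup, Finset.sum_congr rfl fun A _ => Finset.sum_congr rfl fun B _ => hx A B]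
    rw [Finset.sum_eq_single s.2, Finset.sum_eq_single t.2]
    · simp
    · intro B _ hB; simp [hB]
    · simp
    · intro A _ hA; simp [hA]
    · simp
  -- Only the top cell with the same base point as `s` contributes.
  rw [cupPairing, integral, finsum_congr key,
    finsum_eq_single _ ((s.1, ⟨Finset.univ, by simp⟩) : Cell d d)]
  · simp
  · intro c hc
    refine if_neg fun e => hc (Prod.ext e.2 (Subtype.ext ?_))
    exact (Finset.card_eq_iff_eq_univ _).1 (by rw [c.2.2, Fintype.card_fin])

theorem cupSign_mul_self (i : ℕ) (A B : Finset (Fin d)) : cupSign R i A B * cupSign R i A B = 1 := by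
  rw [cupSign, ← pow_add, ← two_mul, pow_mul]; simp

theorem cupRight_single (h : p + q = d) (s : Cell d p) :
    cupRight R d 0 p q (Finsupp.single s 1) =
      Finsupp.single (dualCell h s) (cupSign R 0 s.2.1 (s.2.1)ᶜ) := by
  classical
  ext t
  rw [cupRight_apply, cupForm_single_single, cupPairing_zero h, Finsupp.single_apply]
  simp only [eq_comm]

theorem cupLeft_single (h : p + q = d) (s : Cell d p) :
    cupLeft R d 0 p q (Finsupp.single (dualCell h s) 1) =
      Finsupp.single s (cupSign R 0 s.2.1 (s.2.1)ᶜ) := by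
  classical
  ext t
  rw [cupLeft_apply, cupForm_single_single, cupPairing_zero h, Finsupp.single_apply]
  by_cases hst : s = t
  · rw [hst, if_pos rfl, if_pos rfl]
  · rw [if_neg hst, if_neg fun e => hst (dualCell_injective h e)]

/-- The pairing is a signed permutation matrix, whose transpose is its inverse. -/
theorem cupLeft_cupRight (h : p + q = d) (a : Cell d p →₀ R) :
    cupLeft R d 0 p q (cupRight R d 0 p q a) = a := by
  have : cupLeft R d 0 p q ∘ₗ cupRight R d 0 p q = LinearMap.id := by
    refine Finsupp.lhom_ext' fun s => LinearMap.ext_ring ?_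
    rw [LinearMap.comp_apply, LinearMap.comp_apply, Finsupp.lsingle_apply, cupRight_single h,
      ← mul_one (cupSign R 0 s.2.1 (s.2.1)ᶜ), ← smul_eq_mul, ← Finsupp.smul_single, map_smul,
      cupLeft_single h, Finsupp.smul_single, smul_eq_mul, cupSign_mul_self]
    rfl
  exact congrArg (fun f => f a) this

theorem cupRight_cupLeft (h : p + q = d) (b : Cell d q →₀ R) :
    cupRight R d 0 p q (cupLeft R d 0 p q b) = b := by
  have : cupRight R d 0 p q ∘ₗ cupLeft R d 0 p q = LinearMap.id := by
    refine Finsupp.lhom_ext' fun t => LinearMap.ext_ring ?_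
    obtain ⟨s, rfl⟩ := dualCell_surjective h t
    rw [LinearMap.comp_apply, LinearMap.comp_apply, Finsupp.lsingle_apply, cupLeft_single h,
      ← mul_one (cupSign R 0 s.2.1 (s.2.1)ᶜ), ← smul_eq_mul, ← Finsupp.smul_single, map_smul,
      cupRight_single h, Finsupp.smul_single, smul_eq_mul, cupSign_mul_self]
    rfl
  exact congrArg (fun f => f b) this

end

section


variable {p N d n m : ℕ}

/-! ### Pauli operators -/

theorem pairing_eq_dot (z a : Site N d n →₀ ZMod p) : pairing z a = dot z a := (dot_apply z a).symm

theorem symp_eq_dot (v w : Pauli p N d n) : symp v w = dot v.1 w.2 - dot v.2 w.1 := by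
  rw [symp, pairing_eq_dot, pairing_eq_dot]

/-- The `i`-th field of a finitely supported configuration. -/
def fieldMap (p N d n : ℕ) (i : Fin N) :
    (Site N d n →₀ ZMod p) →ₗ[ZMod p] (Cell d n →₀ ZMod p) :=
  Finsupp.lcomapDomain (Prod.mk i) (Prod.mk_right_injective i)

/-- The configuration with the given `i`-th field, the other fields being zero. -/
def inclMap (p N d n : ℕ) (i : Fin N) :
    (Cell d n →₀ ZMod p) →ₗ[ZMod p] (Site N d n →₀ ZMod p) :=
  Finsupp.lmapDomain (ZMod p) (ZMod p) (Prod.mk i)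

theorem fieldMap_single_self (i : Fin N) (s : Cell d n) (u : ZMod p) :
    fieldMap p N d n i (Finsupp.single (i, s) u) = Finsupp.single s u := by
  classical
  ext t
  change Finsupp.single (i, s) u (i, t) = _
  simp [Finsupp.single_apply]

theorem fieldMap_single_of_ne {i j : Fin N} (h : j ≠ i) (s : Cell d n) (u : ZMod p) :
    fieldMap p N d n i (Finsupp.single (j, s) u) = 0 := by
  classical
  ext t
  change Finsupp.single (j, s) u (i, t) = _
  simp [h]

theorem inclMap_single (i : Fin N) (s : Cell d n) (u : ZMod p) :
    inclMap p N d n i (Finsupp.single s u) = Finsupp.single (i, s) u :=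
  Finsupp.mapDomain_single

theorem inclMap_apply_self (i : Fin N) (a : Cell d n →₀ ZMod p) (s : Cell d n) :
    inclMap p N d n i a (i, s) = a s :=
  Finsupp.mapDomain_apply (Prod.mk_right_injective i) a s

theorem inclMap_apply_of_ne {i j : Fin N} (h : j ≠ i) (a : Cell d n →₀ ZMod p) (s : Cell d n) :
    inclMap p N d n i a (j, s) = 0 := by
  refine Finsupp.mapDomain_of_notMem_range a _ ?_
  rintro ⟨t, ht⟩
  exact h (congrArg Prod.fst ht).symm

theorem fieldMap_inclMap (i : Fin N) (a : Cell d n →₀ ZMod p) :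
    fieldMap p N d n i (inclMap p N d n i a) = a := by
  ext s; exact inclMap_apply_self i a s

theorem dot_inclMap (i : Fin N) (z : Cell d n →₀ ZMod p) (a : Site N d n →₀ ZMod p) :
    dot (inclMap p N d n i z) a = dot z (fieldMap p N d n i a) := by
  have : dot.flip a ∘ₗ inclMap p N d n i = dot.flip (fieldMap p N d n i a) := by
    refine Finsupp.lhom_ext fun s u => ?_
    rw [LinearMap.comp_apply, inclMap_single, LinearMap.flip_apply, LinearMap.flip_apply,
      dot_single_left, dot_single_left]
    rfl
  exact congrArg (fun f => f z) this

theorem finiteRange_inclMap (i : Fin N) :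
    FiniteRange Prod.fst (fun s : Site N d n => s.2.1) (inclMap p N d n i) := by
  classical
  refine ⟨0, fun s t h => ?_⟩
  rw [inclMap_single, Finsupp.single_apply, ne_eq, ite_eq_right_iff, Classical.not_imp] at h
  rw [← h.1, dist_self]

theorem finiteRange_fieldMap (i : Fin N) :
    FiniteRange (fun s : Site N d n => s.2.1) Prod.fst (fieldMap p N d n i) := by
  classical
  refine ⟨0, fun s t h => ?_⟩
  change Finsupp.single s (1 : ZMod p) (i, t) ≠ 0 at h
  rw [Finsupp.single_apply, ne_eq, ite_eq_right_iff, Classical.not_imp] at h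
  rw [h.1, dist_self]

/-! ### Finite range of Clifford maps -/

/-- Finite range of a map of Pauli operators, in terms of its four blocks. -/
def PauliFiniteRange (θ : Pauli p N d n →ₗ[ZMod p] Pauli p N d n) : Prop :=
  (FiniteRange (fun s : Site N d n => s.2.1) (fun s : Site N d n => s.2.1)
      (LinearMap.fst _ _ _ ∘ₗ θ ∘ₗ LinearMap.inl _ _ _) ∧
    FiniteRange (fun s : Site N d n => s.2.1) (fun s : Site N d n => s.2.1)
      (LinearMap.fst _ _ _ ∘ₗ θ ∘ₗ LinearMap.inr _ _ _)) ∧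
  FiniteRange (fun s : Site N d n => s.2.1) (fun s : Site N d n => s.2.1)
      (LinearMap.snd _ _ _ ∘ₗ θ ∘ₗ LinearMap.inl _ _ _) ∧
    FiniteRange (fun s : Site N d n => s.2.1) (fun s : Site N d n => s.2.1)
      (LinearMap.snd _ _ _ ∘ₗ θ ∘ₗ LinearMap.inr _ _ _)

theorem pauliFiniteRange_iff (θ : PauliAut p N d n) :
    PauliFiniteRange θ.toLinearMap ↔
      ∃ r : ℝ, ∀ s t, r < siteDist s t → NoSpread θ s t := by
  constructor
  · rintro ⟨⟨⟨r1, h1⟩, ⟨r2, h2⟩⟩, ⟨r3, h3⟩, ⟨r4, h4⟩⟩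
    refine ⟨max (max r1 r2) (max r3 r4), fun s t hst => ?_⟩
    rw [max_lt_iff, max_lt_iff, max_lt_iff] at hst
    refine ⟨?_, ?_, ?_, ?_⟩
    · by_contra h; exact absurd (h1 s t h) (not_le.2 hst.1.1)
    · by_contra h; exact absurd (h3 s t h) (not_le.2 hst.2.1)
    · by_contra h; exact absurd (h2 s t h) (not_le.2 hst.1.2)
    · by_contra h; exact absurd (h4 s t h) (not_le.2 hst.2.2)
  · rintro ⟨r, hr⟩
    refine ⟨⟨⟨r, fun s t h => ?_⟩, ⟨r, fun s t h => ?_⟩⟩, ⟨r, fun s t h => ?_⟩, ⟨r, fun s t h => ?_⟩⟩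
    · by_contra h'; exact h (hr s t (not_le.1 h')).1
    · by_contra h'; exact h (hr s t (not_le.1 h')).2.2.1
    · by_contra h'; exact h (hr s t (not_le.1 h')).2.1
    · by_contra h'; exact h (hr s t (not_le.1 h')).2.2.2

theorem isCliffordQCA_iff (θ : PauliAut p N d n) :
    IsCliffordQCA θ ↔ IsSymplectic θ ∧ PauliFiniteRange θ.toLinearMap := by
  rw [pauliFiniteRange_iff]; rfl

/-- The four blocks multiply as `2 × 2` matrices, and finite range is stable under sums and
compositions. -/
theorem PauliFiniteRange.comp {θ η : Pauli p N d n →ₗ[ZMod p] Pauli p N d n}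
    (hθ : PauliFiniteRange θ) (hη : PauliFiniteRange η) : PauliFiniteRange (θ ∘ₗ η) := by
  obtain ⟨⟨a, b⟩, c, e⟩ := hθ
  obtain ⟨⟨a', b'⟩, c', e'⟩ := hη
  have key : ∀ v, θ v = θ (v.1, 0) + θ (0, v.2) := fun v => by
    rw [← map_add, Prod.mk_add_mk, add_zero, zero_add]
  refine ⟨⟨?_, ?_⟩, ?_, ?_⟩
  · convert (a.comp a').add (b.comp c') using 1
    exact LinearMap.ext fun v => congrArg Prod.fst (key (η (v, 0)))
  · convert (a.comp b').add (b.comp e') using 1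
    exact LinearMap.ext fun v => congrArg Prod.fst (key (η (0, v)))
  · convert (c.comp a').add (e.comp c') using 1
    exact LinearMap.ext fun v => congrArg Prod.snd (key (η (v, 0)))
  · convert (c.comp b').add (e.comp e') using 1
    exact LinearMap.ext fun v => congrArg Prod.snd (key (η (0, v)))

theorem IsCliffordQCA.mul {θ η : PauliAut p N d n} (hθ : IsCliffordQCA θ) (hη : IsCliffordQCA η) :
    IsCliffordQCA (θ * η) := by
  rw [isCliffordQCA_iff] at *
  exact ⟨fun v w => (hθ.1 _ _).trans (hη.1 v w), hθ.2.comp hη.2⟩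

/-! ### Shears -/

/-- The shear `(x, z) ↦ (x, z + M x)`. -/
def shear (M : (Site N d n →₀ ZMod p) →ₗ[ZMod p] (Site N d n →₀ ZMod p)) : PauliAut p N d n :=
  (LinearEquiv.refl (ZMod p) _).skewProd (LinearEquiv.refl (ZMod p) _) M

variable {M M' : (Site N d n →₀ ZMod p) →ₗ[ZMod p] (Site N d n →₀ ZMod p)}

theorem shear_apply (v : Pauli p N d n) : shear M v = (v.1, v.2 + M v.1) := rfl

theorem shear_mul : shear M * shear M' = shear (M + M') :=
  LinearEquiv.ext fun v => by
    rw [LinearEquiv.mul_apply, shear_apply, shear_apply, shear_apply, LinearMap.add_apply]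
    simp only
    rw [add_assoc, add_comm (M v.1)]

theorem shear_zero : shear (0 : (Site N d n →₀ ZMod p) →ₗ[ZMod p] _) = 1 :=
  LinearEquiv.ext fun v => by rw [shear_apply, LinearMap.zero_apply, add_zero]; rfl

theorem shear_inv : (shear M)⁻¹ = shear (-M) := by
  have h : M + -M = 0 := add_neg_cancel M
  rw [inv_eq_iff_mul_eq_one, shear_mul, h, shear_zero]

theorem isSymplectic_shear (h : ∀ x y, dot (M x) y = dot x (M y)) : IsSymplectic (shear M) := by
  intro v w
  rw [symp_eq_dot, symp_eq_dot, shear_apply, shear_apply]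
  simp only [map_add, LinearMap.add_apply, h]
  ring

theorem noSpread_shear {s t : Site N d n} (hst : s ≠ t) (h : M (Finsupp.single s 1) t = 0) :
    NoSpread (shear M) s t := by
  have h0 : Finsupp.single s (1 : ZMod p) t = 0 := Finsupp.single_eq_of_ne hst.symm
  refine ⟨h0, ?_, rfl, ?_⟩
  · change (0 + M (Finsupp.single s 1)) t = 0
    rw [zero_add, h]
  · change (Finsupp.single s (1 : ZMod p) + M 0) t = 0
    rw [map_zero, add_zero, h0]

theorem isCliffordQCA_shear (h : ∀ x y, dot (M x) y = dot x (M y))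
    (hM : FiniteRange (fun s : Site N d n => s.2.1) (fun s : Site N d n => s.2.1) M) :
    IsCliffordQCA (shear M) := by
  obtain ⟨r, hr⟩ := hM
  refine ⟨isSymplectic_shear h, max r 0, fun s t hst => noSpread_shear ?_ ?_⟩
  · rintro rfl
    rw [siteDist, dist_self] at hst
    exact absurd hst (not_lt.2 (le_max_right _ _))
  · by_contra h0
    exact absurd (hr s t h0) (not_le.2 ((le_max_left _ _).trans_lt hst))

theorem shear_sum_mem {ι : Type*} (s : Finset ι)
    (L : ι → (Site N d n →₀ ZMod p) →ₗ[ZMod p] (Site N d n →₀ ZMod p))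
    (h : ∀ c ∈ s, shear (L c) ∈ cliffordCircuits p N d n) :
    shear (∑ c ∈ s, L c) ∈ cliffordCircuits p N d n := by
  classical
  induction s using Finset.induction_on with
  | empty => rw [Finset.sum_empty, shear_zero]; exact one_mem _
  | insert c s hc ih =>
    rw [Finset.sum_insert hc, ← shear_mul]
    exact mul_mem (h c (Finset.mem_insert_self _ _))
      (ih fun c' hc' => h c' (Finset.mem_insert_of_mem hc'))

/-- The restriction of a configuration to the cells based at points congruent to `c` modulo `3`. -/
def residuePart (p N d n : ℕ) (c : Fin d → ZMod 3) :
    (Site N d n →₀ ZMod p) →ₗ[ZMod p] (Site N d n →₀ ZMod p) where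
  toFun a := a.filter fun s => (fun j => (s.2.1 j : ZMod 3)) = c
  map_add' _ _ := Finsupp.filter_add
  map_smul' _ _ := Finsupp.filter_smul

theorem residuePart_apply (c : Fin d → ZMod 3) (a : Site N d n →₀ ZMod p) (s : Site N d n) :
    residuePart p N d n c a s = if (fun j => (s.2.1 j : ZMod 3)) = c then a s else 0 := rfl

theorem residuePart_single (c : Fin d → ZMod 3) (s : Site N d n) (u : ZMod p) :
    residuePart p N d n c (Finsupp.single s u) =
      if (fun j => (s.2.1 j : ZMod 3)) = c then Finsupp.single s u else 0 := by
  split_ifs with h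
  · exact Finsupp.filter_single_of_pos _ h
  · exact Finsupp.filter_single_of_neg _ h

theorem sum_residuePart : ∑ c, residuePart p N d n c = LinearMap.id := by
  refine LinearMap.ext fun a => Finsupp.ext fun s => ?_
  rw [LinearMap.sum_apply, Finsupp.finsetSum_apply]
  simp [residuePart_apply]

theorem dot_residuePart (c : Fin d → ZMod 3) (a b : Site N d n →₀ ZMod p) :
    dot (residuePart p N d n c a) b = dot a (residuePart p N d n c b) := by
  have : dot.flip b ∘ₗ residuePart p N d n c = dot.flip (residuePart p N d n c b) := by
    refine Finsupp.lhom_ext fun s u => ?_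
    rw [LinearMap.comp_apply, residuePart_single, LinearMap.flip_apply, LinearMap.flip_apply,
      dot_single_left, residuePart_apply]
    split_ifs <;> simp
  exact congrArg (fun f => f a) this

/-- The index of the box of side `3` of a vertex, where the boxes are centred at the points congruent
to `c` modulo `3`. -/
def boxIndex (c : Fin d → ZMod 3) (x : Fin d → ℤ) : Fin d → ℤ :=
  fun j => (x j - (c j).val + 1) / 3

theorem dist_le_of_boxIndex_eq {c : Fin d → ZMod 3} {x y : Fin d → ℤ}
    (h : boxIndex c x = boxIndex c y) : dist x y ≤ 2 := by
  refine (dist_pi_le_iff zero_le_two).2 fun j => ?_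
  have hj := congrFun h j
  simp only [boxIndex] at hj
  rw [Int.dist_eq]
  have : |x j - y j| ≤ 2 := by rw [abs_le]; omega
  exact_mod_cast this

/-- A point congruent to `c` is the centre of its box of side `3`, so the box contains all its
neighbours. -/
theorem boxIndex_eq_of_dist_le {c : Fin d → ZMod 3} {x y : Fin d → ℤ}
    (hx : (fun j => (x j : ZMod 3)) = c) (h : dist x y ≤ 1) : boxIndex c x = boxIndex c y := by
  funext j
  have hj := (dist_pi_le_iff zero_le_one).1 h j
  rw [Int.dist_eq] at hj
  have hj' : |x j - y j| ≤ 1 := by exact_mod_cast hj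
  rw [abs_le] at hj'
  have h3 : ((x j - ((c j).val : ℤ) : ℤ) : ZMod 3) = 0 := by
    rw [← hx]; simp
  have h4 := (ZMod.intCast_zmod_eq_zero_iff_dvd _ 3).1 h3
  simp only [boxIndex]
  omega

/-- A shear given by a symmetrized matrix between cells at distance at most `1` is a finite-depth
circuit. -/
theorem shear_mem_cliffordCircuits
    {U V : (Site N d n →₀ ZMod p) →ₗ[ZMod p] (Site N d n →₀ ZMod p)}
    (hUV : ∀ x y, dot (U x) y = dot x (V y))
    (hU : ∀ s t, U (Finsupp.single s 1) t ≠ 0 → dist s.2.1 t.2.1 ≤ 1) :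
    shear (U + V) ∈ cliffordCircuits p N d n := by
  have hV : ∀ s t, V (Finsupp.single s 1) t ≠ 0 → dist s.2.1 t.2.1 ≤ 1 := fun s t h => by
    rw [dist_comm]
    refine hU t s ?_
    have := hUV (Finsupp.single t 1) (Finsupp.single s 1)
    simp only [dot_single_left, dot_single_right, one_mul, mul_one] at this
    rwa [this]
  -- Each summand is still symmetric and couples a site of residue `c` only to sites within distance
  -- one, hence within one box. Shears multiply by adding their matrices, so every residue class
  -- gives one layer.
  have hsum : U + V = ∑ c, (residuePart p N d n c ∘ₗ U + V ∘ₗ residuePart p N d n c) := by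
    refine LinearMap.ext fun v => ?_
    have h1 : ∀ w, ∑ c, residuePart p N d n c w = w := fun w => by
      rw [← LinearMap.sum_apply, sum_residuePart]; rfl
    simp only [LinearMap.sum_apply, LinearMap.add_apply, LinearMap.comp_apply,
      Finset.sum_add_distrib, ← map_sum, h1]
  rw [hsum]
  refine shear_sum_mem _ _ fun c _ => Subgroup.subset_closure ⟨isSymplectic_shear fun x y => ?_,
    Setoid.ker fun s : Site N d n => boxIndex c s.2.1, ⟨2, fun s t h => dist_le_of_boxIndex_eq h⟩,
    fun s t h => noSpread_shear ?_ ?_⟩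
  · have hVU : ∀ x y, dot (V x) y = dot x (U y) := fun x y => by
      rw [dot_comm, ← hUV, dot_comm]
    simp only [LinearMap.add_apply, LinearMap.comp_apply, map_add, dot_residuePart, hUV, hVU]
    ring
  · rintro rfl
    exact h rfl
  · by_contra h0
    refine h ?_
    change boxIndex c s.2.1 = boxIndex c t.2.1
    rw [LinearMap.add_apply, LinearMap.comp_apply, LinearMap.comp_apply, Finsupp.add_apply,
      residuePart_apply, residuePart_single] at h0
    by_cases ht : (fun j => (t.2.1 j : ZMod 3)) = c ∧ U (Finsupp.single s 1) t ≠ 0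
    · refine (boxIndex_eq_of_dist_le ht.1 ?_).symm
      rw [dist_comm]
      exact hU s t ht.2
    · have h1 : (if (fun j => (t.2.1 j : ZMod 3)) = c then U (Finsupp.single s 1) t else 0) = 0 := by
        rw [ite_eq_right_iff]
        intro hc
        by_contra hne
        exact ht ⟨hc, hne⟩
      rw [h1, zero_add] at h0
      split_ifs at h0 with hs
      · exact boxIndex_eq_of_dist_le hs (hV s t h0)
      · rw [map_zero] at h0
        exact absurd rfl h0

end

/-! ### The identity for odd-degree cocycles, and the circuit in dimension `4l + 1` -/

section


variable {p N d n m : ℕ}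

theorem two_mul_half_pred [Fact p.Prime] (hp : p ≠ 2) :
    (2 : ZMod p) * (((p - 1) / 2 : ℕ) : ZMod p) = -1 := by
  have hodd := (Fact.out : p.Prime).eq_two_or_odd'.resolve_left hp
  obtain ⟨k, hk⟩ := hodd
  have h1 : (p - 1) / 2 = k := by omega
  have h2 : ((2 * k + 1 : ℕ) : ZMod p) = 0 := by rw [← hk]; exact ZMod.natCast_self p
  push_cast at h2
  rw [h1]
  linear_combination h2

/-- The coboundary has integer coefficients, so an identity over `ZMod p` can be transported to
`ℝ/ℤ`. -/
theorem addMonoidHom_coboundary {M M' : Type*} [AddCommGroup M] [AddCommGroup M'] (f : M →+ M')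
    (a : Cochain d n M) (c : Cell d (n + 1)) :
    coboundary (fun s => f (a s)) c = f (coboundary a c) := by
  simp only [coboundary, map_sum, map_zsmul, map_sub]

theorem cup_zero_right {R : Type*} [CommRing R] {i a b r : ℕ} (x : Cochain d a R) :
    (cup i x (0 : Cochain d b R) : Cochain d r R) = 0 := by
  simpa using cup_smul_right (r := r) (i := i) 0 x (0 : Cochain d b R)

theorem cup_zero_left {R : Type*} [CommRing R] {i a b r : ℕ} (x : Cochain d b R) :
    (cup i (0 : Cochain d a R) x : Cochain d r R) = 0 := by
  simpa using cup_smul_left (r := r) (i := i) 0 (0 : Cochain d a R) x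

/-- For a cocycle `A` of odd degree, `δ (A ∪_1 A) = -2 A ∪ A`. -/
theorem coboundary_cup_one_self {R : Type*} [CommRing R] {l : ℕ} (A : Cochain d (2 * l + 1) R)
    (hA : coboundary A = 0) (c : Cell d (4 * l + 1 + 1)) :
    coboundary (cup 1 A A : Cochain d (4 * l + 1) R) c = -2 * cup 0 A A c := by
  have h := congrFun (cupRelation d R 0 (2 * l + 1) (2 * l + 1) (4 * l + 1) (by ring) A A) c
  have h1 : (-1 : ℤ) ^ (2 * l + 1 + (2 * l + 1) + (0 + 1)) = -1 :=
    Odd.neg_one_pow (by grind)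
  have h2 : (-1 : ℤ) ^ ((2 * l + 1) * (2 * l + 1) + (2 * l + 1) + (2 * l + 1)) = -1 :=
    Odd.neg_one_pow (by grind)
  rw [hA, cup_zero_left, cup_zero_right, h1, h2] at h
  rw [zero_add] at h
  rw [h]
  simp
  ring

theorem toAddCircle_cup_self [Fact p.Prime] (hp : p ≠ 2) {l : ℕ} (k : ZMod p)
    (A : Cochain d (2 * l + 1) (ZMod p)) (hA : coboundary A = 0) :
    (fun c => ZMod.toAddCircle (k * (cup 0 A A : Cochain d (4 * l + 1 + 1) (ZMod p)) c)) =
      coboundary (fun c => ZMod.toAddCircle (k * (((p - 1) / 2 : ℕ) : ZMod p) *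
        (cup 1 A A : Cochain d (4 * l + 1) (ZMod p)) c)) := by
  funext c
  rw [addMonoidHom_coboundary ZMod.toAddCircle
    (fun c => k * (((p - 1) / 2 : ℕ) : ZMod p) * (cup 1 A A : Cochain d (4 * l + 1) (ZMod p)) c)]
  congr 1
  have := congrFun (coboundary_smul (k * (((p - 1) / 2 : ℕ) : ZMod p))
    (cup 1 A A : Cochain d (4 * l + 1) (ZMod p))) c
  refine Eq.trans ?_ this.symm
  rw [Pi.smul_apply, smul_eq_mul, coboundary_cup_one_self A hA]
  linear_combination (k * cup 0 A A c) * two_mul_half_pred hp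

/-! ### The gauged ground state -/

theorem isPotential_iff (φ : Site N d m →₀ ZMod p) (a : Site N d (m + 1) →₀ ZMod p) :
    IsPotential φ a ↔
      ∀ i, delta (ZMod p) d m (fieldMap p N d m i φ) = fieldMap p N d (m + 1) i a :=
  forall_congr' fun _ => ⟨fun h => DFunLike.coe_injective h, fun h => congrArg DFunLike.coe h⟩

theorem boundaryAction_eq (K : Matrix (Fin N) (Fin N) (ZMod p)) (φ : Site N d m →₀ ZMod p) :
    boundaryAction K φ = ∑ i, ∑ j, K i j * cupForm (ZMod p) d 0 m (m + 1)
      (fieldMap p N d m i φ) (delta (ZMod p) d m (fieldMap p N d m j φ)) := rfl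

/-- Integration by parts moves `δ` onto the closed cochain `φ - φ'`. This is why the amplitude
depends on `a = δφ` only. -/
theorem cupForm_delta_eq_of_delta_eq {R : Type*} [CommRing R] (hd : d = 2 * m + 1)
    {φ φ' : Cell d m →₀ R} (h : delta R d m φ = delta R d m φ') (ψ : Cell d m →₀ R) :
    cupForm R d 0 m (m + 1) φ (delta R d m ψ) = cupForm R d 0 m (m + 1) φ' (delta R d m ψ) := by
  subst hd
  have h1 := cupForm_delta (r := 2 * m) (by ring) (φ - φ') ψ
  rw [map_sub (delta R _ m), h, sub_self, map_zero, LinearMap.zero_apply, zero_add] at h1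
  rw [← sub_eq_zero, ← LinearMap.sub_apply, ← map_sub]
  have h2 : (-1 : R) ^ m * (-1) ^ m = 1 := by rw [← pow_add, ← two_mul, pow_mul]; simp
  linear_combination (-1) ^ m * h1 - cupForm R (2 * m + 1) 0 m (m + 1) (φ - φ') (delta R _ m ψ) * h2

theorem boundaryAction_eq_of_isPotential (hd : d = 2 * m + 1) (K : Matrix (Fin N) (Fin N) (ZMod p))
    {φ φ' : Site N d m →₀ ZMod p} {a : Site N d (m + 1) →₀ ZMod p} (h : IsPotential φ a)
    (h' : IsPotential φ' a) : boundaryAction K φ = boundaryAction K φ' := by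
  rw [isPotential_iff] at h h'
  rw [boundaryAction_eq, boundaryAction_eq]
  refine Finset.sum_congr rfl fun i _ => Finset.sum_congr rfl fun j _ => ?_
  rw [cupForm_delta_eq_of_delta_eq hd ((h i).trans (h' i).symm), h j, h' j]

theorem gaugedState_eq [NeZero p] (hd : d = 2 * m + 1) (K : Matrix (Fin N) (Fin N) (ZMod p))
    {φ : Site N d m →₀ ZMod p} {a : Site N d (m + 1) →₀ ZMod p} (h : IsPotential φ a) :
    gaugedState K a = ZMod.stdAddChar (boundaryAction K φ) := by
  have hex : ∃ φ : Site N d m →₀ ZMod p, IsPotential φ a := ⟨φ, h⟩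
  rw [gaugedState, dif_pos hex, boundaryAction_eq_of_isPotential hd K hex.choose_spec h]

/-! ### The circuit in dimension `4 l + 1` -/

/-- The matrix of the quadratic form `c ∫ a_i ∪_1 a_i`. -/
def cupOneLeft (c : ZMod p) (i : Fin N) :
    (Site N d n →₀ ZMod p) →ₗ[ZMod p] (Site N d n →₀ ZMod p) :=
  c • (inclMap p N d n i ∘ₗ cupLeft (ZMod p) d 1 n n ∘ₗ fieldMap p N d n i)

/-- The transposed matrix of the quadratic form `c ∫ a_i ∪_1 a_i`. -/
def cupOneRight (c : ZMod p) (i : Fin N) :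
    (Site N d n →₀ ZMod p) →ₗ[ZMod p] (Site N d n →₀ ZMod p) :=
  c • (inclMap p N d n i ∘ₗ cupRight (ZMod p) d 1 n n ∘ₗ fieldMap p N d n i)

theorem dot_cupOneLeft (c : ZMod p) (i : Fin N) (x y : Site N d n →₀ ZMod p) :
    dot (cupOneLeft c i x) y = c * cupForm (ZMod p) d 1 n n (fieldMap p N d n i y)
      (fieldMap p N d n i x) := by
  rw [cupOneLeft, LinearMap.smul_apply, map_smul, LinearMap.smul_apply, smul_eq_mul,
    LinearMap.comp_apply, LinearMap.comp_apply, dot_inclMap, dot_comm, dot_cupLeft]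

theorem dot_cupOneRight (c : ZMod p) (i : Fin N) (x y : Site N d n →₀ ZMod p) :
    dot (cupOneRight c i x) y = c * cupForm (ZMod p) d 1 n n (fieldMap p N d n i x)
      (fieldMap p N d n i y) := by
  rw [cupOneRight, LinearMap.smul_apply, map_smul, LinearMap.smul_apply, smul_eq_mul,
    LinearMap.comp_apply, LinearMap.comp_apply, dot_inclMap, dot_cupRight]

theorem cupOneLeft_range {c : ZMod p} {i : Fin N} {s t : Site N d n}
    (h : cupOneLeft c i (Finsupp.single s 1) t ≠ 0) : dist s.2.1 t.2.1 ≤ 1 := by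
  obtain ⟨j, s⟩ := s
  obtain ⟨j', t⟩ := t
  have h' := right_ne_zero_of_mul (a := c) h
  rw [LinearMap.comp_apply, LinearMap.comp_apply] at h'
  by_cases hj' : j' = i
  · subst hj'
    rw [inclMap_apply_self] at h'
    by_cases hj : j = j'
    · subst hj
      rw [fieldMap_single_self] at h'
      exact cupLeft_range h'
    · rw [fieldMap_single_of_ne hj, map_zero] at h'
      exact absurd rfl h'
  · exact absurd (inclMap_apply_of_ne hj' _ t) h'

/-- The action of `|a⟩ ↦ exp (2 π i (c/p) ∫ a_i ∪_1 a_i) |a⟩` on Pauli operators. -/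
def cupOneShear (c : ZMod p) (i : Fin N) : PauliAut p N d n :=
  shear (cupOneLeft c i + cupOneRight c i)

theorem cupOneShear_mem (c : ZMod p) (i : Fin N) :
    cupOneShear c i ∈ cliffordCircuits p N d n :=
  shear_mem_cliffordCircuits
    (fun x y => by rw [dot_cupOneLeft, dot_comm, dot_cupOneRight]) fun _ _ => cupOneLeft_range

theorem isCliffordQCA_cupOneShear (c : ZMod p) (i : Fin N) :
    IsCliffordQCA (cupOneShear c i : PauliAut p N d n) := by
  refine isCliffordQCA_shear (fun x y => ?_) (FiniteRange.add ?_ ?_)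
  · rw [dot_comm x]
    simp only [map_add, LinearMap.add_apply, dot_cupOneLeft, dot_cupOneRight]
    ring
  · exact (((finiteRange_inclMap i).comp finiteRange_cupLeft).comp (finiteRange_fieldMap i)).smul c
  · exact (((finiteRange_inclMap i).comp finiteRange_cupRight).comp (finiteRange_fieldMap i)).smul c

theorem cupOneShear_inv (c : ZMod p) (i : Fin N) :
    (cupOneShear c i : PauliAut p N d n)⁻¹ = cupOneShear (-c) i := by
  rw [cupOneShear, cupOneShear, shear_inv]
  congr 1
  refine LinearMap.ext fun v => ?_
  simp only [cupOneLeft, cupOneRight, LinearMap.neg_apply, LinearMap.add_apply,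
    LinearMap.smul_apply, neg_smul, neg_add]

theorem norm_stdAddChar [NeZero p] (x : ZMod p) : ‖ZMod.stdAddChar x‖ = 1 := by
  rw [ZMod.stdAddChar_apply]; exact Circle.norm_coe _

/-- For the quadratic form `q(a) = c ∫ a_i ∪_1 a_i` one has `q(a + x) = q(a) + q(x) + ⟨M x, a⟩` with
`M` the symmetrized matrix. The value `q(x)` is the phase and `M x` the additional `Z` exponent. -/
theorem cupOneCircuit_pauliOp [NeZero p] (c : ZMod p) (i : Fin N) (v : Pauli p N d n)
    (Ψ : State p N d n) :
    cupOneCircuit c i (pauliOp v Ψ) =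
      (ZMod.stdAddChar (c * integral (cup 1 (field v.1 i) (field v.1 i))) : ℂ) •
        pauliOp (cupOneShear c i v) (cupOneCircuit c i Ψ) := by
  funext a
  -- Evaluating at a translate of `v.1` removes the subtraction built into `pauliOp`.
  obtain ⟨a, rfl⟩ : ∃ b, a = b + v.1 := ⟨a - v.1, by simp⟩
  simp only [cupOneCircuit, pauliOp, Pi.smul_apply, smul_eq_mul, cupOneShear, shear_apply,
    add_sub_cancel_right, pairing_eq_dot]
  rw [← mul_assoc, ← mul_assoc, ← mul_assoc, ← AddChar.map_add_eq_mul, ← AddChar.map_add_eq_mul,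
    ← AddChar.map_add_eq_mul]
  congr 2
  have h : ∀ b : Site N d n →₀ ZMod p, integral (cup 1 (field b i) (field b i)) =
    cupForm (ZMod p) d 1 n n (fieldMap p N d n i b) (fieldMap p N d n i b) := fun b => rfl
  rw [h, h, h]
  simp only [map_add, LinearMap.add_apply, dot_cupOneLeft, dot_cupOneRight]
  ring

theorem cupOneCircuit_smul [NeZero p] (c : ZMod p) (i : Fin N) (u : ℂ) (Ψ : State p N d n) :
    cupOneCircuit c i (u • Ψ) = u • cupOneCircuit c i Ψ := by
  funext a
  simp only [cupOneCircuit, Pi.smul_apply, smul_eq_mul]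
  ring

theorem cupOneCircuit_injective [NeZero p] (c : ZMod p) (i : Fin N) :
    Function.Injective (cupOneCircuit c i : State p N d n → State p N d n) := by
  intro Ψ Φ h
  funext a
  have h0 : (ZMod.stdAddChar (c * integral (cup 1 (field a i) (field a i))) : ℂ) ≠ 0 := by
    rw [← norm_ne_zero_iff, norm_stdAddChar]; exact one_ne_zero
  exact mul_left_cancel₀ h0 (congrFun h a)

theorem cupOneShear_image_stabilizer [NeZero p] (c : ZMod p) (i : Fin N) (Ψ : State p N d n) :
    cupOneShear c i '' stabilizer Ψ = stabilizer (cupOneCircuit c i Ψ) := by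
  have hne : ∀ x : ZMod p, (ZMod.stdAddChar x : ℂ) ≠ 0 := fun x => by
    rw [← norm_ne_zero_iff, norm_stdAddChar]; exact one_ne_zero
  have key : ∀ v, cupOneShear c i v ∈ stabilizer (cupOneCircuit c i Ψ) ↔ v ∈ stabilizer Ψ := by
    intro v
    have h := cupOneCircuit_pauliOp c i v Ψ
    constructor
    · rintro ⟨u, hu⟩
      rw [hu, smul_smul, ← cupOneCircuit_smul] at h
      exact ⟨_, cupOneCircuit_injective c i h⟩
    · rintro ⟨u, hu⟩
      rw [hu, cupOneCircuit_smul] at h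
      refine ⟨(ZMod.stdAddChar (c * integral (cup 1 (field v.1 i) (field v.1 i))) : ℂ)⁻¹ * u, ?_⟩
      rw [mul_smul, h, smul_smul, inv_mul_cancel₀ (hne _), one_smul]
  ext w
  obtain ⟨v, rfl⟩ := (cupOneShear c i).surjective w
  rw [key]
  exact (cupOneShear c i).injective.mem_set_image

theorem boundaryAction_add_single (K : Matrix (Fin N) (Fin N) (ZMod p)) (i : Fin N) (k : ZMod p)
    (φ : Site N d m →₀ ZMod p) :
    boundaryAction (K + Matrix.single i i k) φ = boundaryAction K φ +
      k * cupForm (ZMod p) d 0 m (m + 1) (fieldMap p N d m i φ)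
        (delta (ZMod p) d m (fieldMap p N d m i φ)) := by
  rw [boundaryAction_eq, boundaryAction_eq]
  simp only [Matrix.add_apply, add_mul, Finset.sum_add_distrib]
  congr 1
  rw [Finset.sum_eq_single i, Finset.sum_eq_single i]
  · rw [Matrix.single_apply_same]
  · intro j _ hj
    rw [Matrix.single_apply_of_ne _ _ _ _ _ (fun h => hj h.2.symm), zero_mul]
  · simp
  · intro j _ hj
    refine Finset.sum_eq_zero fun j' _ => ?_
    rw [Matrix.single_apply_of_ne _ _ _ _ _ (fun h => hj h.1.symm), zero_mul]
  · simp

/-- In dimension `4 l + 1`, `∫ δφ ∪_1 δφ = -2 ∫ φ ∪ δφ` for `2 l`-cochains. -/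
theorem cupForm_one_delta_self {R : Type*} [CommRing R] {l : ℕ} (hd : d = 4 * l + 1)
    (hm : m = 2 * l) (φ : Cell d m →₀ R) :
    cupForm R d 1 (m + 1) (m + 1) (delta R d m φ) (delta R d m φ) =
      -2 * cupForm R d 0 m (m + 1) φ (delta R d m φ) := by
  subst hd hm
  -- The `∪_1` formula for the pair `(φ, δφ)` has no `δδφ` term, and integration by parts turns `∫
  -- δφ ∪ φ` into `-∫ φ ∪ δφ`.
  have h1 := cupForm_succ_delta (i := 0) (r := 4 * l) (by ring) φ (delta R _ _ φ)
  have h2 := cupForm_delta (r := 4 * l) (by ring) φ φ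
  have e1 : (-1 : R) ^ (2 * l) = 1 := by rw [pow_mul]; simp
  have e2 : (-1 : R) ^ (2 * l + (2 * l + 1) + (0 + 1)) = 1 := Even.neg_one_pow (by grind)
  have e3 : (-1 : R) ^ (2 * l * (2 * l + 1) + 2 * l + (2 * l + 1)) = -1 :=
    Odd.neg_one_pow (by grind)
  rw [delta_delta, map_zero, e1, e2, e3] at h1
  rw [e1] at h2
  linear_combination h1 + h2

/-- On `a = δφ` the phase is `-2 · k(p-1)/2 = k` times `∫ φ_i ∪ δφ_i`, exactly the change of the
boundary action; elsewhere both amplitudes vanish. -/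
theorem cupOneCircuit_gaugedState [Fact p.Prime] (hp : p ≠ 2) {l : ℕ} (hd : d = 4 * l + 1)
    (hm : m = 2 * l) (k : ZMod p) (i : Fin N) (K : Matrix (Fin N) (Fin N) (ZMod p)) :
    cupOneCircuit (k * (((p - 1) / 2 : ℕ) : ZMod p)) i (gaugedState (m := m) (d := d) K) =
      gaugedState (K + Matrix.single i i k) := by
  funext a
  by_cases h : ∃ φ : Site N d m →₀ ZMod p, IsPotential φ a
  · obtain ⟨φ, hφ⟩ := h
    rw [cupOneCircuit, gaugedState_eq (by omega) _ hφ, gaugedState_eq (by omega) _ hφ,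
      ← AddChar.map_add_eq_mul, boundaryAction_add_single]
    congr 1
    have h1 : integral (cup 1 (field a i) (field a i)) = cupForm (ZMod p) d 1 (m + 1) (m + 1)
      (fieldMap p N d (m + 1) i a) (fieldMap p N d (m + 1) i a) := rfl
    rw [h1, ← (isPotential_iff φ a).1 hφ i, cupForm_one_delta_self hd hm]
    linear_combination (-k * cupForm (ZMod p) d 0 m (m + 1) (fieldMap p N d m i φ)
      (delta (ZMod p) d m (fieldMap p N d m i φ))) * two_mul_half_pred hp
  · rw [cupOneCircuit, gaugedState, gaugedState, dif_neg h, dif_neg h, mul_zero]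

/-- The shear carries one stabilizer group onto the other, and its inverse, the shear for `-c`, is
also a Clifford QCA; so nothing is lost in either direction. -/
theorem disentangles_cupOneShear_mul_iff [NeZero p] (c : ZMod p) (i : Fin N) (α : PauliAut p N d n)
    (Ψ : State p N d n) :
    Disentangles α Ψ ↔ Disentangles (cupOneShear c i * α) (cupOneCircuit c i Ψ) := by
  have hθ := isCliffordQCA_cupOneShear (d := d) (n := n) c i
  have himg : ⇑(cupOneShear c i * α : PauliAut p N d n) '' (zGroup p N d n : Set (Pauli p N d n)) =
      cupOneShear c i '' (α '' (zGroup p N d n : Set (Pauli p N d n))) := by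
    rw [Set.image_image]; rfl
  rw [Disentangles, Disentangles, himg, ← cupOneShear_image_stabilizer,
    (cupOneShear c i).injective.image_injective.eq_iff]
  refine and_congr_left fun _ => ⟨hθ.mul, fun h => ?_⟩
  have := (isCliffordQCA_cupOneShear (d := d) (n := n) (-c) i).mul h
  rwa [← cupOneShear_inv, inv_mul_cancel_left] at this

theorem exists_circuit [Fact p.Prime] (hp : p ≠ 2) {l : ℕ} (hd : d = 4 * l + 1)
    (hm : m = 2 * l) (k : ZMod p) (i : Fin N) :
    ∃ θ ∈ cliffordCircuits p N d (m + 1),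
      (∀ v : Pauli p N d (m + 1), ∃ c : ℂ, ‖c‖ = 1 ∧ ∀ Ψ : State p N d (m + 1),
        cupOneCircuit (k * (((p - 1) / 2 : ℕ) : ZMod p)) i (pauliOp v Ψ) =
          c • pauliOp (θ v) (cupOneCircuit (k * (((p - 1) / 2 : ℕ) : ZMod p)) i Ψ)) ∧
      ∀ K : Matrix (Fin N) (Fin N) (ZMod p),
        cupOneCircuit (k * (((p - 1) / 2 : ℕ) : ZMod p)) i (gaugedState (m := m) (d := d) K) =
          gaugedState (K + Matrix.single i i k) ∧
        θ '' stabilizer (gaugedState K) = stabilizer (gaugedState (K + Matrix.single i i k)) ∧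
        ∀ α : PauliAut p N d (m + 1),
          Disentangles α (gaugedState K) ↔
            Disentangles (θ * α) (gaugedState (K + Matrix.single i i k)) := by
  refine ⟨cupOneShear (k * (((p - 1) / 2 : ℕ) : ZMod p)) i, cupOneShear_mem _ _, fun v =>
    ⟨_, norm_stdAddChar _, cupOneCircuit_pauliOp _ i v⟩, fun K => ?_⟩
  have h := cupOneCircuit_gaugedState hp hd hm k i K
  refine ⟨h, ?_, fun α => ?_⟩
  · rw [← h, cupOneShear_image_stabilizer]
  · rw [← h, ← disentangles_cupOneShear_mul_iff]

end

section


/-! ### Operators in dimension `2 m + 1`, `m` odd -/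

section Operators

variable {d m : ℕ} {R : Type*} [CommRing R]

theorem cupForm_delta_of_odd (hd : d = 2 * m + 1) (hm : Odd m) (φ ψ : Cell d m →₀ R) :
    cupForm R d 0 (m + 1) m (delta R d m φ) ψ = cupForm R d 0 m (m + 1) φ (delta R d m ψ) := by
  subst hd
  have h := cupForm_delta (r := 2 * m) (by ring) φ ψ
  rw [hm.neg_one_pow] at h
  linear_combination h

theorem cupLeft_delta (hd : d = 2 * m + 1) (hm : Odd m) (ψ : Cell d m →₀ R) :
    cupLeft R d 0 m (m + 1) (delta R d m ψ) = boundary R d m (cupLeft R d 0 (m + 1) m ψ) :=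
  ext_dot fun φ => by
    rw [dot_boundary, dot_comm, dot_cupLeft, dot_comm, dot_cupLeft, cupForm_delta_of_odd hd hm]

theorem cupRight_delta (hd : d = 2 * m + 1) (hm : Odd m) (φ : Cell d m →₀ R) :
    cupRight R d 0 (m + 1) m (delta R d m φ) = boundary R d m (cupRight R d 0 m (m + 1) φ) :=
  ext_dot fun ψ => by
    rw [dot_boundary, dot_cupRight, dot_cupRight, cupForm_delta_of_odd hd hm]

/-- Poincaré duality exchanges `δ` and `∂`: the relation `cupRight_delta` is multiplied by the
inverse duality maps on both sides. -/
theorem delta_cupLeft (hd : d = 2 * m + 1) (hm : Odd m) (z : Cell d (m + 1) →₀ R) :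
    delta R d m (cupLeft R d 0 m (m + 1) z) = cupLeft R d 0 (m + 1) m (boundary R d m z) := by
  have h1 : m + (m + 1) = d := by omega
  have h2 : m + 1 + m = d := by omega
  rw [← cupLeft_cupRight h2 (delta R d m _), cupRight_delta hd hm, cupRight_cupLeft h1]

theorem delta_cupRight (hd : d = 2 * m + 1) (hm : Odd m) (z : Cell d (m + 1) →₀ R) :
    delta R d m (cupRight R d 0 (m + 1) m z) = cupRight R d 0 m (m + 1) (boundary R d m z) := by
  have h1 : m + (m + 1) = d := by omega
  have h2 : m + 1 + m = d := by omega
  rw [← cupRight_cupLeft h1 (delta R d m _), cupLeft_delta hd hm, cupLeft_cupRight h2]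

/-- Duals of boundaries are closed since `∂∂ = 0`. As `gaussMap` factors through `δ`, it ignores
every error term `∂h` after dualization. -/
theorem delta_cupLeft_boundary (hd : d = 2 * m + 1) (hm : Odd m) (h : Cell d (m + 1 + 1) →₀ R) :
    delta R d m (cupLeft R d 0 m (m + 1) (boundary R d (m + 1) h)) = 0 := by
  rw [delta_cupLeft hd hm, boundary_boundary, map_zero]

theorem delta_cupRight_boundary (hd : d = 2 * m + 1) (hm : Odd m) (h : Cell d (m + 1 + 1) →₀ R) :
    delta R d m (cupRight R d 0 (m + 1) m (boundary R d (m + 1) h)) = 0 := by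
  rw [delta_cupRight hd hm, boundary_boundary, map_zero]

/-- This is the integrated `∪_1` formula with the second argument stripped off by duality; for odd
`m` the signs are those shown. -/
theorem cupRight_one_delta (hd : d = 2 * m + 1) (hm : Odd m) (φ : Cell d m →₀ R) :
    cupRight R d 1 (m + 1) (m + 1) (delta R d m φ) =
      boundary R d (m + 1) (cupRight R d 1 m (m + 1 + 1) φ) - cupRight R d 0 m (m + 1) φ +
        cupLeft R d 0 (m + 1) m φ :=
  ext_dot fun b => by
    subst hd
    have h := cupForm_succ_delta (i := 0) (r := 2 * m) (by ring) φ b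
    have e2 : (-1 : R) ^ (m + (m + 1) + (0 + 1)) = 1 := Even.neg_one_pow (by grind)
    have e3 : (-1 : R) ^ (m * (m + 1) + m + (m + 1)) = -1 :=
      Odd.neg_one_pow (by obtain ⟨t, rfl⟩ := hm; grind)
    rw [hm.neg_one_pow, e2, e3] at h
    simp only [map_add, map_sub, LinearMap.add_apply, LinearMap.sub_apply, dot_boundary,
      dot_cupRight]
    rw [dot_comm (cupLeft _ _ _ _ _ _), dot_cupLeft]
    linear_combination h

theorem cupLeft_one_delta (hd : d = 2 * m + 1) (hm : Odd m) (φ : Cell d m →₀ R) :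
    cupLeft R d 1 (m + 1) (m + 1) (delta R d m φ) =
      -boundary R d (m + 1) (cupLeft R d 1 (m + 1 + 1) m φ) + cupRight R d 0 m (m + 1) φ -
        cupLeft R d 0 (m + 1) m φ :=
  ext_dot fun b => by
    subst hd
    have h := cupForm_succ_delta (i := 0) (r := 2 * m) (by ring) b φ
    have e1 : (-1 : R) ^ (m + 1) = 1 := hm.add_one.neg_one_pow
    have e2 : (-1 : R) ^ (m + 1 + m + (0 + 1)) = 1 := Even.neg_one_pow (by grind)
    have e3 : (-1 : R) ^ ((m + 1) * m + (m + 1) + m) = -1 :=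
      Odd.neg_one_pow (by obtain ⟨t, rfl⟩ := hm; grind)
    rw [e1, e2, e3] at h
    simp only [map_add, map_sub, map_neg, LinearMap.add_apply, LinearMap.sub_apply,
      LinearMap.neg_apply, dot_boundary, dot_cupRight]
    rw [dot_comm, dot_cupLeft, dot_comm (cupLeft _ _ _ _ _ _), dot_cupLeft,
      dot_comm (cupLeft _ _ _ _ _ _), dot_cupLeft]
    linear_combination h

end Operators

/-! ### The `ℤ_p^{(k)}` construction -/

variable {p d m : ℕ}

theorem inclMap_fieldMap {n : ℕ} (a : Site 1 d n →₀ ZMod p) :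
    inclMap p 1 d n 0 (fieldMap p 1 d n 0 a) = a := by
  ext ⟨i, s⟩
  rw [Subsingleton.elim i 0, inclMap_apply_self]
  rfl

/-- The linear extension of `e ↦ G_e`. -/
def gaussMap (d m : ℕ) (k : ZMod p) : (Cell d m →₀ ZMod p) →ₗ[ZMod p] Pauli p 1 d (m + 1) :=
  (inclMap p 1 d (m + 1) 0 ∘ₗ delta (ZMod p) d m).prod
    (k • (inclMap p 1 d (m + 1) 0 ∘ₗ cupRight (ZMod p) d 1 (m + 1) (m + 1) ∘ₗ delta (ZMod p) d m))

/-- The commutation of Pauli operators with the `G_e` is `δ` composed with this map. -/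
def gaussDual (d m : ℕ) (k : ZMod p) : Pauli p 1 d (m + 1) →ₗ[ZMod p] (Cell d (m + 1) →₀ ZMod p) :=
  fieldMap p 1 d (m + 1) 0 ∘ₗ LinearMap.snd _ _ _ -
    k • (cupLeft (ZMod p) d 1 (m + 1) (m + 1) ∘ₗ fieldMap p 1 d (m + 1) 0 ∘ₗ LinearMap.fst _ _ _)

theorem gaussMap_apply (k : ZMod p) (φ : Cell d m →₀ ZMod p) :
    gaussMap d m k φ = (inclMap p 1 d (m + 1) 0 (delta (ZMod p) d m φ),
      k • inclMap p 1 d (m + 1) 0 (cupRight (ZMod p) d 1 (m + 1) (m + 1) (delta (ZMod p) d m φ))) :=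
  rfl

theorem gaussDual_apply (k : ZMod p) (v : Pauli p 1 d (m + 1)) :
    gaussDual d m k v = fieldMap p 1 d (m + 1) 0 v.2 -
      k • cupLeft (ZMod p) d 1 (m + 1) (m + 1) (fieldMap p 1 d (m + 1) 0 v.1) := rfl

theorem gaussMap_eq_zero {k : ZMod p} {φ : Cell d m →₀ ZMod p} (h : delta (ZMod p) d m φ = 0) :
    gaussMap d m k φ = 0 := by
  rw [gaussMap_apply, h, map_zero, map_zero, map_zero, smul_zero]; rfl

theorem symp_gaussMap (k : ZMod p) (v : Pauli p 1 d (m + 1)) (φ : Cell d m →₀ ZMod p) :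
    symp v (gaussMap d m k φ) = -dot (gaussDual d m k v) (delta (ZMod p) d m φ) := by
  rw [symp_eq_dot, gaussMap_apply, gaussDual_apply]
  simp only [map_smul, map_sub, LinearMap.sub_apply, LinearMap.smul_apply, smul_eq_mul]
  rw [dot_comm v.1, dot_comm v.2, dot_inclMap, dot_inclMap, dot_cupRight,
    dot_comm (fieldMap p 1 d (m + 1) 0 v.2), dot_comm (cupLeft _ _ _ _ _ _), dot_cupLeft]
  ring

theorem symp_comm (v w : Pauli p 1 d (m + 1)) : symp v w = -symp w v := by
  rw [symp_eq_dot, symp_eq_dot, dot_comm v.1, dot_comm v.2]; ring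

/-- The `∪_1` matrix enters antisymmetrized, so the `∪_0` parts of `cupRight_one_delta` and
`cupLeft_one_delta` add up to the factor `2k`, while the rest is a boundary. -/
theorem gaussDual_gaussMap (hd : d = 2 * m + 1) (hm : Odd m) (k : ZMod p)
    (φ : Cell d m →₀ ZMod p) :
    ∃ h, gaussDual d m k (gaussMap d m k φ) = boundary (ZMod p) d (m + 1) h +
      (2 * k) • (cupLeft (ZMod p) d 0 (m + 1) m φ - cupRight (ZMod p) d 0 m (m + 1) φ) := by
  refine ⟨k • (cupRight (ZMod p) d 1 m (m + 1 + 1) φ + cupLeft (ZMod p) d 1 (m + 1 + 1) m φ), ?_⟩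
  rw [gaussDual_apply, gaussMap_apply]
  simp only [map_smul, fieldMap_inclMap, map_add]
  rw [cupRight_one_delta hd hm, cupLeft_one_delta hd hm]
  module

theorem symp_gaussMap_gaussMap (hd : d = 2 * m + 1) (hm : Odd m) (k : ZMod p)
    (φ ψ : Cell d m →₀ ZMod p) :
    symp (gaussMap d m k φ) (gaussMap d m k ψ) =
      2 * k * (cupForm (ZMod p) d 0 m (m + 1) φ (delta (ZMod p) d m ψ) -
        cupForm (ZMod p) d 0 m (m + 1) ψ (delta (ZMod p) d m φ)) := by
  obtain ⟨h, hh⟩ := gaussDual_gaussMap hd hm k φ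
  rw [symp_gaussMap, hh]
  simp only [map_add, map_smul, map_sub, LinearMap.add_apply, LinearMap.smul_apply,
    LinearMap.sub_apply, smul_eq_mul]
  rw [dot_boundary, delta_delta, map_zero, dot_cupRight, dot_comm (cupLeft _ _ _ _ _ _),
    dot_cupLeft, cupForm_delta_of_odd hd hm]
  ring

end

/-! ### The automorphism given by separators and flippers -/

section


variable {p d m : ℕ}

theorem symp_add_left (v v' w : Pauli p 1 d (m + 1)) : symp (v + v') w = symp v w + symp v' w := by
  simp only [symp_eq_dot, Prod.fst_add, Prod.snd_add, map_add, LinearMap.add_apply]; ring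

theorem symp_add_right (v w w' : Pauli p 1 d (m + 1)) : symp v (w + w') = symp v w + symp v w' := by
  simp only [symp_eq_dot, Prod.fst_add, Prod.snd_add, map_add]; ring

theorem symp_smul_left (u : ZMod p) (v w : Pauli p 1 d (m + 1)) :
    symp (u • v) w = u * symp v w := by
  simp only [symp_eq_dot, Prod.smul_fst, Prod.smul_snd, map_smul, LinearMap.smul_apply, smul_eq_mul]
  ring

theorem symp_smul_right (u : ZMod p) (v w : Pauli p 1 d (m + 1)) :
    symp v (u • w) = u * symp v w := by
  simp only [symp_eq_dot, Prod.smul_fst, Prod.smul_snd, map_smul, smul_eq_mul]; ring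

/-- The map `Z_s ↦ Z̄_s`, `X_s ↦ X̄_s`. -/
def separatorMap [Fact p.Prime] (d m : ℕ) (k : ZMod p) :
    Pauli p 1 d (m + 1) →ₗ[ZMod p] Pauli p 1 d (m + 1) :=
  LinearMap.id + (2 * k)⁻¹ • (gaussMap d m k ∘ₗ cupLeft (ZMod p) d 0 m (m + 1) ∘ₗ gaussDual d m k)

/-- The inverse of `separatorMap`. -/
def separatorInv [Fact p.Prime] (d m : ℕ) (k : ZMod p) :
    Pauli p 1 d (m + 1) →ₗ[ZMod p] Pauli p 1 d (m + 1) :=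
  LinearMap.id - (2 * k)⁻¹ • (gaussMap d m k ∘ₗ cupRight (ZMod p) d 0 (m + 1) m ∘ₗ gaussDual d m k)

theorem separatorMap_apply [Fact p.Prime] (k : ZMod p) (v : Pauli p 1 d (m + 1)) :
    separatorMap d m k v =
      v + (2 * k)⁻¹ • gaussMap d m k (cupLeft (ZMod p) d 0 m (m + 1) (gaussDual d m k v)) := rfl

theorem separatorInv_apply [Fact p.Prime] (k : ZMod p) (v : Pauli p 1 d (m + 1)) :
    separatorInv d m k v =
      v - (2 * k)⁻¹ • gaussMap d m k (cupRight (ZMod p) d 0 (m + 1) m (gaussDual d m k v)) := rfl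

theorem two_mul_ne_zero_of_odd_prime [Fact p.Prime] (hp : p ≠ 2) {k : ZMod p} (hk : k ≠ 0) :
    2 * k ≠ 0 := by
  refine mul_ne_zero (fun h => ?_) hk
  have h' : ((2 : ℕ) : ZMod p) = 0 := by exact_mod_cast h
  exact hp ((Nat.prime_dvd_prime_iff_eq Fact.out Nat.prime_two).1
    ((ZMod.natCast_eq_zero_iff 2 p).1 h'))

/-- With `f = D v`, `D G L⁻¹ f = ∂h + 2k (f - R L⁻¹ f)`. Applying `R⁻¹/2k` yields `R⁻¹f - L⁻¹f`
modulo the kernel of `G`, so all corrections cancel. -/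
theorem separatorMap_separatorInv [Fact p.Prime] (hp : p ≠ 2) (hd : d = 2 * m + 1) (hm : Odd m)
    {k : ZMod p} (hk : k ≠ 0) (v : Pauli p 1 d (m + 1)) :
    separatorMap d m k (separatorInv d m k v) = v := by
  have h1 : m + (m + 1) = d := by omega
  have h2 : m + 1 + m = d := by omega
  have h0 := two_mul_ne_zero_of_odd_prime hp hk
  rw [separatorMap_apply, separatorInv_apply]
  set f := gaussDual d m k v
  obtain ⟨h, hh⟩ := gaussDual_gaussMap hd hm k (cupRight (ZMod p) d 0 (m + 1) m f)
  have hb := gaussMap_eq_zero (k := k) (delta_cupLeft_boundary hd hm h)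
  rw [map_sub (gaussDual d m k), map_smul (gaussDual d m k), hh]
  simp only [map_sub, map_add, map_smul, hb, cupLeft_cupRight h1, cupLeft_cupRight h2, zero_add,
    inv_smul_smul₀ h0]
  module

theorem separatorInv_separatorMap [Fact p.Prime] (hp : p ≠ 2) (hd : d = 2 * m + 1) (hm : Odd m)
    {k : ZMod p} (hk : k ≠ 0) (v : Pauli p 1 d (m + 1)) :
    separatorInv d m k (separatorMap d m k v) = v := by
  have h1 : m + (m + 1) = d := by omega
  have h2 : m + 1 + m = d := by omega
  have h0 := two_mul_ne_zero_of_odd_prime hp hk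
  rw [separatorInv_apply, separatorMap_apply]
  set f := gaussDual d m k v
  obtain ⟨h, hh⟩ := gaussDual_gaussMap hd hm k (cupLeft (ZMod p) d 0 m (m + 1) f)
  have hb := gaussMap_eq_zero (k := k) (delta_cupRight_boundary hd hm h)
  rw [map_add (gaussDual d m k), map_smul (gaussDual d m k), hh]
  simp only [map_sub, map_add, map_smul, hb, cupRight_cupLeft h1, cupRight_cupLeft h2, zero_add,
    inv_smul_smul₀ h0]
  module

/-- The automorphism `Z_s ↦ Z̄_s`, `X_s ↦ X̄_s`. -/
def separatorAut [Fact p.Prime] (hp : p ≠ 2) (hd : d = 2 * m + 1) (hm : Odd m)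
    {k : ZMod p} (hk : k ≠ 0) : PauliAut p 1 d (m + 1) :=
  { separatorMap d m k with
    invFun := separatorInv d m k
    left_inv := separatorInv_separatorMap hp hd hm hk
    right_inv := separatorMap_separatorInv hp hd hm hk }

/-- The commutator of two `G` operators carries a factor `2k`, and `R R⁻¹ = 1` turns it into the
same expression as the two mixed terms, with the opposite sign. The coefficient `1/2k` is what makes
them cancel. -/
theorem isSymplectic_separatorAut [Fact p.Prime] (hp : p ≠ 2) (hd : d = 2 * m + 1) (hm : Odd m)
    {k : ZMod p} (hk : k ≠ 0) : IsSymplectic (separatorAut (d := d) (m := m) hp hd hm hk) := by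
  intro v w
  have h1 : m + (m + 1) = d := by omega
  have h0 := two_mul_ne_zero_of_odd_prime hp hk
  change symp (separatorMap d m k v) (separatorMap d m k w) = symp v w
  rw [separatorMap_apply, separatorMap_apply]
  set f := gaussDual d m k v with hf
  set g := gaussDual d m k w with hg
  simp only [symp_add_left, symp_add_right, symp_smul_left, symp_smul_right]
  rw [symp_gaussMap_gaussMap hd hm, symp_comm (gaussMap d m k _) w, symp_gaussMap, symp_gaussMap, ← hf, ← hg,
    ← dot_cupRight, ← dot_cupRight, cupRight_cupLeft h1, cupRight_cupLeft h1]
  have hc : (2 * k)⁻¹ * (2 * k) = 1 := inv_mul_cancel₀ h0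
  linear_combination (2 * k)⁻¹ * (dot f (delta (ZMod p) d m (cupLeft (ZMod p) d 0 m (m + 1) g)) -
    dot g (delta (ZMod p) d m (cupLeft (ZMod p) d 0 m (m + 1) f))) * hc

theorem pauliFiniteRange_id_add_smul {N n : ℕ} {κ : Type*} {g : κ → Fin d → ℤ} (u : ZMod p)
    {A : (κ →₀ ZMod p) →ₗ[ZMod p] Pauli p N d n} {B : Pauli p N d n →ₗ[ZMod p] (κ →₀ ZMod p)}
    (h1 : FiniteRange g (fun s : Site N d n => s.2.1) (LinearMap.fst _ _ _ ∘ₗ A))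
    (h2 : FiniteRange g (fun s : Site N d n => s.2.1) (LinearMap.snd _ _ _ ∘ₗ A))
    (h3 : FiniteRange (fun s : Site N d n => s.2.1) g (B ∘ₗ LinearMap.inl _ _ _))
    (h4 : FiniteRange (fun s : Site N d n => s.2.1) g (B ∘ₗ LinearMap.inr _ _ _)) :
    PauliFiniteRange (LinearMap.id + u • (A ∘ₗ B)) := by
  refine ⟨⟨?_, ?_⟩, ?_, ?_⟩
  · convert FiniteRange.id.add ((h1.comp h3).smul u) using 1
    exact LinearMap.ext fun x => rfl
  · convert FiniteRange.zero.add ((h1.comp h4).smul u) using 1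
    exact LinearMap.ext fun x => rfl
  · convert FiniteRange.zero.add ((h2.comp h3).smul u) using 1
    exact LinearMap.ext fun x => rfl
  · convert FiniteRange.id.add ((h2.comp h4).smul u) using 1
    exact LinearMap.ext fun x => rfl

theorem pauliFiniteRange_separatorMap [Fact p.Prime] (k : ZMod p) :
    PauliFiniteRange (separatorMap d m k) := by
  have hι := finiteRange_inclMap (p := p) (d := d) (n := m + 1) (0 : Fin 1)
  have hφ := finiteRange_fieldMap (p := p) (d := d) (n := m + 1) (0 : Fin 1)
  have hδ := finiteRange_delta (R := ZMod p) (d := d) (n := m)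
  have hP := finiteRange_cupLeft (R := ZMod p) (d := d) (i := 0) (p := m) (q := m + 1)
  have hL := finiteRange_cupRight (R := ZMod p) (d := d) (i := 1) (p := m + 1) (q := m + 1)
  have hT := finiteRange_cupLeft (R := ZMod p) (d := d) (i := 1) (p := m + 1) (q := m + 1)
  refine pauliFiniteRange_id_add_smul (g := Prod.fst) _ ?_ ?_ ?_ ?_
  · exact hι.comp hδ
  · exact (hι.comp (hL.comp hδ)).smul k
  · refine hP.comp (T := gaussDual d m k ∘ₗ LinearMap.inl _ _ _) ?_
    convert ((hT.comp hφ).smul k).neg using 1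
    refine LinearMap.ext fun x => ?_
    rw [LinearMap.comp_apply, gaussDual_apply, LinearMap.inl_apply, map_zero, zero_sub]
    rfl
  · refine hP.comp (T := gaussDual d m k ∘ₗ LinearMap.inr _ _ _) ?_
    convert hφ using 1
    refine LinearMap.ext fun x => ?_
    rw [LinearMap.comp_apply, gaussDual_apply, LinearMap.inr_apply, map_zero, map_zero, smul_zero,
      sub_zero]

theorem isCliffordQCA_separatorAut [Fact p.Prime] (hp : p ≠ 2) (hd : d = 2 * m + 1) (hm : Odd m)
    {k : ZMod p} (hk : k ≠ 0) : IsCliffordQCA (separatorAut (d := d) (m := m) hp hd hm hk) :=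
  (isCliffordQCA_iff _).2
    ⟨isSymplectic_separatorAut hp hd hm hk, pauliFiniteRange_separatorMap (d := d) (m := m) k⟩

/-! ### Comparison with the generators -/

theorem finsum_smul_eq_linearCombination {ι M : Type*} [AddCommGroup M] [Module (ZMod p) M]
    (f : ι →₀ ZMod p) (g : ι → M) :
    ∑ᶠ s, f s • g s = Finsupp.linearCombination (ZMod p) g f := by
  rw [Finsupp.linearCombination_apply, Finsupp.sum]
  refine finsum_eq_sum_of_support_subset _ fun s hs => ?_
  simp only [Function.mem_support] at hs
  rw [Finset.mem_coe, Finsupp.mem_support_iff]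
  rintro h
  exact hs (by rw [h, zero_smul])

theorem finsum_smul_map_single {ι M : Type*} [AddCommGroup M] [Module (ZMod p) M]
    (f : ι →₀ ZMod p) (T : (ι →₀ ZMod p) →ₗ[ZMod p] M) :
    ∑ᶠ s, f s • T (Finsupp.single s 1) = T f := by
  rw [finsum_smul_eq_linearCombination]
  have : Finsupp.linearCombination (ZMod p) (fun s => T (Finsupp.single s 1)) = T :=
    Finsupp.lhom_ext' fun s => LinearMap.ext_ring (by simp)
  rw [this]

theorem finsum_smul_X (f : Cell d (m + 1) →₀ ZMod p) :
    ∑ᶠ s, f s • (X (0, s) : Pauli p 1 d (m + 1)) = (inclMap p 1 d (m + 1) 0 f, 0) := by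
  have h := finsum_smul_map_single f
    (LinearMap.inl (ZMod p) (Site 1 d (m + 1) →₀ ZMod p) (Site 1 d (m + 1) →₀ ZMod p) ∘ₗ
      inclMap p 1 d (m + 1) 0)
  simp only [LinearMap.comp_apply, inclMap_single] at h
  exact h

theorem finsum_smul_Z (f : Cell d (m + 1) →₀ ZMod p) :
    ∑ᶠ s, f s • (Z (0, s) : Pauli p 1 d (m + 1)) = (0, inclMap p 1 d (m + 1) 0 f) := by
  have h := finsum_smul_map_single f
    (LinearMap.inr (ZMod p) (Site 1 d (m + 1) →₀ ZMod p) (Site 1 d (m + 1) →₀ ZMod p) ∘ₗ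
      inclMap p 1 d (m + 1) 0)
  simp only [LinearMap.comp_apply, inclMap_single] at h
  exact h

theorem xCoboundary_eq (e : Cell d m) : xCoboundary p e =
    (inclMap p 1 d (m + 1) 0 (delta (ZMod p) d m (Finsupp.single e 1)), 0) := by
  rw [← finsum_smul_X, xCoboundary]
  refine finsum_congr fun s => ?_
  rw [coe_delta, coe_single_one]

theorem zBoundary_eq (t : Cell d (m + 2)) : zBoundary p t =
    (0, inclMap p 1 d (m + 1) 0 (boundary (ZMod p) d (m + 1) (Finsupp.single t 1))) := by
  rw [← finsum_smul_Z, zBoundary]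
  refine finsum_congr fun s => ?_
  rw [boundary_apply, dot_single_left, one_mul, coe_delta, coe_single_one]

theorem G_eq (k : ZMod p) (e : Cell d m) : G k e = gaussMap d m k (Finsupp.single e 1) := by
  have h := finsum_smul_Z (k • cupRight (ZMod p) d 1 (m + 1) (m + 1)
    (delta (ZMod p) d m (Finsupp.single e 1)))
  rw [finsum_congr (g := fun s => (k * integral (cup 1 (coboundary (dual (ZMod p) e))
    (dual (ZMod p) s))) • (Z (0, s) : Pauli p 1 d (m + 1))) fun s => by
      rw [Finsupp.smul_apply, cupRight_apply, cupForm_apply, coe_delta, coe_single_one,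
        coe_single_one, smul_eq_mul]] at h
  rw [G, h, xCoboundary_eq, gaussMap_apply, Prod.mk_add_mk, add_zero, zero_add, map_smul]

/-- The linear extension of the gauge terms of the Hamiltonian. -/
def gaugeMap (d m : ℕ) (k : ZMod p) : (Cell d m →₀ ZMod p) →ₗ[ZMod p] Pauli p 1 d (m + 1) :=
  (inclMap p 1 d (m + 1) 0 ∘ₗ delta (ZMod p) d m).prod (k • (inclMap p 1 d (m + 1) 0 ∘ₗ
    (cupLeft (ZMod p) d 0 (m + 1) m + cupRight (ZMod p) d 0 m (m + 1))))

/-- The linear extension of the terms `Z_{∂ t}` of the Hamiltonian. -/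
def zBoundaryMap (p d m : ℕ) : (Cell d (m + 2) →₀ ZMod p) →ₗ[ZMod p] Pauli p 1 d (m + 1) :=
  LinearMap.inr _ _ _ ∘ₗ inclMap p 1 d (m + 1) 0 ∘ₗ boundary (ZMod p) d (m + 1)

theorem gaugeMap_apply (k : ZMod p) (φ : Cell d m →₀ ZMod p) :
    gaugeMap d m k φ = (inclMap p 1 d (m + 1) 0 (delta (ZMod p) d m φ),
      inclMap p 1 d (m + 1) 0 (k • (cupLeft (ZMod p) d 0 (m + 1) m φ +
        cupRight (ZMod p) d 0 m (m + 1) φ))) := by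
  rw [map_smul]; rfl

theorem zBoundaryMap_apply (h : Cell d (m + 2) →₀ ZMod p) :
    zBoundaryMap p d m h = (0, inclMap p 1 d (m + 1) 0 (boundary (ZMod p) d (m + 1) h)) := rfl

theorem gaugeTerm_eq (k : ZMod p) (e : Cell d m) :
    gaugeTerm k e = gaugeMap d m k (Finsupp.single e 1) := by
  have h := finsum_smul_Z (k • (cupLeft (ZMod p) d 0 (m + 1) m (Finsupp.single e 1) +
    cupRight (ZMod p) d 0 m (m + 1) (Finsupp.single e 1)))
  rw [finsum_congr (g := fun s => (k * (cupPairing 0 (ZMod p) s e + cupPairing 0 (ZMod p) e s)) •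
    (Z (0, s) : Pauli p 1 d (m + 1))) fun s => by
      rw [Finsupp.smul_apply, Finsupp.add_apply, cupLeft_apply, cupRight_apply,
        cupForm_single_single, cupForm_single_single, smul_eq_mul]] at h
  rw [gaugeMap_apply, gaugeTerm, xCoboundary_eq, h, Prod.mk_add_mk, add_zero, zero_add]

theorem span_range_map_single {ι M : Type*} [AddCommGroup M] [Module (ZMod p) M]
    (T : (ι →₀ ZMod p) →ₗ[ZMod p] M) :
    Submodule.span (ZMod p) (Set.range fun s => T (Finsupp.single s 1)) = LinearMap.range T := by
  rw [← Finsupp.range_linearCombination]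
  congr 1
  exact Finsupp.lhom_ext' fun s => LinearMap.ext_ring (by simp)

theorem hamiltonianGroup_eq (k : ZMod p) : hamiltonianGroup p d m k =
    LinearMap.range (zBoundaryMap p d m) ⊔ LinearMap.range (gaugeMap d m k) := by
  have h1 : (zBoundary p : Cell d (m + 2) → _) =
    fun t => zBoundaryMap p d m (Finsupp.single t 1) := funext fun t => zBoundary_eq t
  have h2 : (gaugeTerm k : Cell d m → _) =
    fun t => gaugeMap d m k (Finsupp.single t 1) := funext fun t => gaugeTerm_eq k t
  rw [hamiltonianGroup, Submodule.span_union, h1, h2, span_range_map_single, span_range_map_single]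

theorem zGroup_eq : zGroup p 1 d (m + 1) = LinearMap.range (LinearMap.inr (ZMod p)
    (Site 1 d (m + 1) →₀ ZMod p) (Site 1 d (m + 1) →₀ ZMod p)) := by
  rw [← span_range_map_single]; rfl

theorem gaussDual_Z (k : ZMod p) (z : Site 1 d (m + 1) →₀ ZMod p) :
    gaussDual d m k (0, z) = fieldMap p 1 d (m + 1) 0 z := by
  rw [gaussDual_apply]; simp

theorem separatorMap_Z [Fact p.Prime] (k : ZMod p) (s : Cell d (m + 1)) :
    separatorMap d m k (Z (0, s)) = separator k s := by
  rw [separatorMap_apply, separator, Z, gaussDual_Z, fieldMap_single_self]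
  congr 1
  rw [← map_smul, ← finsum_smul_map_single _ (gaussMap d m k)]
  refine finsum_congr fun e => ?_
  rw [G_eq, Finsupp.smul_apply, cupLeft_apply, cupForm_single_single, smul_eq_mul]

theorem separatorMap_X [Fact p.Prime] {k : ZMod p} (hk : k ≠ 0) (s : Cell d (m + 1)) :
    separatorMap d m k (X (0, s)) = flipper k s := by
  have hG : ∀ s' : Cell d (m + 1), ∑ᶠ e : Cell d m,
      (-(2 : ZMod p)⁻¹ * cupPairing 0 (ZMod p) e s') • G k e =
      (-(2 : ZMod p)⁻¹ • (gaussMap d m k ∘ₗ cupLeft (ZMod p) d 0 m (m + 1)))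
        (Finsupp.single s' 1) := by
    intro s'
    rw [LinearMap.smul_apply, LinearMap.comp_apply, ← map_smul,
      ← finsum_smul_map_single _ (gaussMap d m k)]
    refine finsum_congr fun e => ?_
    rw [G_eq, Finsupp.smul_apply, cupLeft_apply, cupForm_single_single, smul_eq_mul]
  -- The factor `k` from `X_s` meets `1/2k`, which leaves the coefficient `-1/2` of the flipper.
  have hw : gaussDual d m k (X (0, s)) =
      -(k • cupLeft (ZMod p) d 1 (m + 1) (m + 1) (Finsupp.single s 1)) := by
    rw [gaussDual_apply, X, fieldMap_single_self, map_zero, zero_sub]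
  rw [separatorMap_apply, flipper, hw]
  congr 1
  rw [finsum_congr fun s' => by rw [hG s', ← cupForm_single_single, ← cupLeft_apply],
    finsum_smul_map_single]
  rw [LinearMap.smul_apply, LinearMap.comp_apply, map_neg, map_neg, map_smul, map_smul, smul_neg,
    smul_smul, mul_inv, mul_assoc, inv_mul_cancel₀ hk, mul_one, neg_smul]

/-- The argument is chosen so that the correction is exactly `G φ`. The `∪_1` part of `G φ` then
converts `2k R` into the symmetric `k (L + R)` of the gauge term, up to a boundary. -/
theorem separatorMap_Z_eq [Fact p.Prime] (hp : p ≠ 2) (hd : d = 2 * m + 1) (hm : Odd m)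
    {k : ZMod p} (hk : k ≠ 0) (φ : Cell d m →₀ ZMod p) :
    separatorMap d m k (0, inclMap p 1 d (m + 1) 0 ((2 * k) • cupRight (ZMod p) d 0 m (m + 1) φ)) =
      gaugeMap d m k φ + zBoundaryMap p d m (k • cupRight (ZMod p) d 1 m (m + 1 + 1) φ) := by
  have h1 : m + (m + 1) = d := by omega
  have h0 := two_mul_ne_zero_of_odd_prime hp hk
  rw [separatorMap_apply, gaussDual_Z, fieldMap_inclMap, map_smul (cupLeft _ _ _ _ _),
    map_smul (gaussMap _ _ _), inv_smul_smul₀ h0, cupLeft_cupRight h1, gaussMap_apply,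
    gaugeMap_apply, zBoundaryMap_apply, Prod.mk_add_mk, Prod.mk_add_mk, zero_add, add_zero,
    cupRight_one_delta hd hm]
  congr 1
  simp only [map_add, map_sub, map_smul]
  module

theorem separatorMap_zBoundaryMap [Fact p.Prime] (hd : d = 2 * m + 1) (hm : Odd m)
    (k : ZMod p) (h : Cell d (m + 2) →₀ ZMod p) :
    separatorMap d m k (zBoundaryMap p d m h) = zBoundaryMap p d m h := by
  rw [separatorMap_apply, zBoundaryMap_apply, gaussDual_Z, fieldMap_inclMap,
    gaussMap_eq_zero (delta_cupLeft_boundary hd hm h), smul_zero, add_zero]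

theorem map_zGroup_eq_hamiltonianGroup [Fact p.Prime] (hp : p ≠ 2) (hd : d = 2 * m + 1) (hm : Odd m)
    {k : ZMod p} (hk : k ≠ 0) :
    (zGroup p 1 d (m + 1)).map (separatorAut (d := d) (m := m) hp hd hm hk).toLinearMap =
      hamiltonianGroup p d m k := by
  have h1 : m + (m + 1) = d := by omega
  have h0 := two_mul_ne_zero_of_odd_prime hp hk
  rw [hamiltonianGroup_eq, zGroup_eq]
  change Submodule.map (separatorMap d m k) _ = _
  apply le_antisymm
  · rintro _ ⟨_, ⟨z, rfl⟩, rfl⟩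
    -- Every `Z` operator has the form required by `separatorMap_Z_eq`, since `2k R` is invertible.
    have hz : z = inclMap p 1 d (m + 1) 0 ((2 * k) • cupRight (ZMod p) d 0 m (m + 1)
        ((2 * k)⁻¹ • cupLeft (ZMod p) d 0 m (m + 1) (fieldMap p 1 d (m + 1) 0 z))) := by
      rw [map_smul (cupRight _ _ _ _ _), smul_inv_smul₀ h0, cupRight_cupLeft h1, inclMap_fieldMap]
    change separatorMap d m k (0, z) ∈ _
    rw [hz, separatorMap_Z_eq hp hd hm hk]
    exact Submodule.add_mem _ (Submodule.mem_sup_right ⟨_, rfl⟩) (Submodule.mem_sup_left ⟨_, rfl⟩)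
  · have hB : ∀ h, zBoundaryMap p d m h ∈ Submodule.map (separatorMap d m k)
        (LinearMap.range (LinearMap.inr (ZMod p) (Site 1 d (m + 1) →₀ ZMod p)
          (Site 1 d (m + 1) →₀ ZMod p))) := fun h =>
      ⟨_, ⟨_, rfl⟩, separatorMap_zBoundaryMap hd hm k h⟩
    refine sup_le ?_ ?_
    · rintro _ ⟨h, rfl⟩
      exact hB h
    · rintro _ ⟨φ, rfl⟩
      -- The boundary correction may be added freely, as the `Z_{∂ t}` are fixed by the automorphism
      -- and so already lie in the image.
      rw [← Submodule.add_mem_iff_left _ (hB _), ← separatorMap_Z_eq hp hd hm hk φ]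
      exact ⟨_, ⟨_, rfl⟩, rfl⟩

end

section


variable {p d m : ℕ}

/-! ### The stabilizer group of the gauged ground state -/

theorem isPotential_inclMap (φ : Cell d m →₀ ZMod p) :
    IsPotential (inclMap p 1 d m 0 φ) (inclMap p 1 d (m + 1) 0 (delta (ZMod p) d m φ)) := by
  rw [isPotential_iff]
  intro i
  rw [Subsingleton.elim i 0, fieldMap_inclMap, fieldMap_inclMap]

theorem exists_isPotential_iff (a : Site 1 d (m + 1) →₀ ZMod p) :
    (∃ φ : Site 1 d m →₀ ZMod p, IsPotential φ a) ↔
      ∃ φ : Cell d m →₀ ZMod p, a = inclMap p 1 d (m + 1) 0 (delta (ZMod p) d m φ) := by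
  constructor
  · rintro ⟨φ, hφ⟩
    exact ⟨fieldMap p 1 d m 0 φ, by rw [(isPotential_iff φ a).1 hφ 0, inclMap_fieldMap]⟩
  · rintro ⟨φ, rfl⟩
    exact ⟨_, isPotential_inclMap φ⟩

theorem gaugedState_inclMap [NeZero p] (hd : d = 2 * m + 1) (k : ZMod p) (φ : Cell d m →₀ ZMod p) :
    gaugedState (m := m) (Matrix.of fun (_ _ : Fin 1) => k)
      (inclMap p 1 d (m + 1) 0 (delta (ZMod p) d m φ)) =
    ZMod.stdAddChar (k * cupForm (ZMod p) d 0 m (m + 1) φ (delta (ZMod p) d m φ)) := by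
  rw [gaugedState_eq hd _ (isPotential_inclMap φ), boundaryAction_eq]
  simp only [Fin.sum_univ_one, Fin.isValue, Matrix.of_apply, fieldMap_inclMap]

theorem gaugedState_eq_zero {N : ℕ} [NeZero p] (K : Matrix (Fin N) (Fin N) (ZMod p))
    {a : Site N d (m + 1) →₀ ZMod p} (h : ¬ ∃ φ : Site N d m →₀ ZMod p, IsPotential φ a) :
    gaugedState K a = 0 := by
  rw [gaugedState, dif_neg h]

/-- The `X` part must preserve the support, the group of all `δφ`. The `Z` part must then compensate
the polarization of `k ∫ φ ∪ δφ`, and only its values on that group matter. -/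
theorem mem_stabilizer_gaugedState_iff [NeZero p] (hd : d = 2 * m + 1) (k : ZMod p)
    (v : Pauli p 1 d (m + 1)) :
    v ∈ stabilizer (gaugedState (m := m) (Matrix.of fun (_ _ : Fin 1) => k)) ↔
      ∃ φ : Cell d m →₀ ZMod p, v.1 = inclMap p 1 d (m + 1) 0 (delta (ZMod p) d m φ) ∧
        ∀ ψ : Cell d m →₀ ZMod p, dot v.2 (inclMap p 1 d (m + 1) 0 (delta (ZMod p) d m ψ)) =
          k * (cupForm (ZMod p) d 0 m (m + 1) ψ (delta (ZMod p) d m φ) +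
            cupForm (ZMod p) d 0 m (m + 1) φ (delta (ZMod p) d m ψ)) := by
  have h00 : gaugedState (m := m) (Matrix.of fun (_ _ : Fin 1) => k)
      (0 : Site 1 d (m + 1) →₀ ZMod p) = 1 := by
    simpa only [map_zero, mul_zero, AddChar.map_zero_eq_one] using gaugedState_inclMap hd k 0
  constructor
  · rintro ⟨c, hc⟩
    -- The amplitude at `0` is `1`, so evaluation at `v.1` shows that `v.1` lies in the support and
    -- relates `c` to its amplitude.
    have h1 := congrFun hc v.1
    simp only [pauliOp, sub_self, pairing_eq_dot, map_zero, AddChar.map_zero_eq_one, one_mul, h00,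
      Pi.smul_apply, smul_eq_mul] at h1
    obtain ⟨φ, hφ⟩ : ∃ φ : Cell d m →₀ ZMod p,
        v.1 = inclMap p 1 d (m + 1) 0 (delta (ZMod p) d m φ) := by
      rw [← exists_isPotential_iff]
      by_contra h
      rw [gaugedState_eq_zero _ h, mul_zero] at h1
      exact one_ne_zero h1
    refine ⟨φ, hφ, fun ψ => ?_⟩
    have h2 := congrFun hc (inclMap p 1 d (m + 1) 0 (delta (ZMod p) d m ψ) + v.1)
    simp only [pauliOp, add_sub_cancel_right, pairing_eq_dot, Pi.smul_apply, smul_eq_mul] at h2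
    rw [hφ, ← map_add, ← map_add, gaugedState_inclMap hd, gaugedState_inclMap hd] at h2
    rw [hφ, gaugedState_inclMap hd] at h1
    have h3 : ZMod.stdAddChar (k * cupForm (ZMod p) d 0 m (m + 1) φ (delta (ZMod p) d m φ) +
        (dot v.2 (inclMap p 1 d (m + 1) 0 (delta (ZMod p) d m ψ)) +
          k * cupForm (ZMod p) d 0 m (m + 1) ψ (delta (ZMod p) d m ψ))) =
        ZMod.stdAddChar (k * cupForm (ZMod p) d 0 m (m + 1) (ψ + φ) (delta (ZMod p) d m (ψ + φ))) := by
      rw [AddChar.map_add_eq_mul, AddChar.map_add_eq_mul, h2, ← mul_assoc, mul_comm _ c, ← h1, one_mul]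
    have h4 := ZMod.injective_stdAddChar h3
    simp only [map_add, LinearMap.add_apply] at h4
    linear_combination h4
  · rintro ⟨φ, hφ, h⟩
    refine ⟨ZMod.stdAddChar (-(k * cupForm (ZMod p) d 0 m (m + 1) φ (delta (ZMod p) d m φ))), ?_⟩
    funext a
    obtain ⟨b, rfl⟩ : ∃ b, a = b + v.1 := ⟨a - v.1, by simp⟩
    simp only [pauliOp, add_sub_cancel_right, pairing_eq_dot, Pi.smul_apply, smul_eq_mul]
    by_cases hb : ∃ ψ : Cell d m →₀ ZMod p, b = inclMap p 1 d (m + 1) 0 (delta (ZMod p) d m ψ)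
    · obtain ⟨ψ, rfl⟩ := hb
      rw [hφ, ← map_add, ← map_add, gaugedState_inclMap hd, gaugedState_inclMap hd, h ψ,
        ← AddChar.map_add_eq_mul, ← AddChar.map_add_eq_mul]
      congr 1
      simp only [map_add, LinearMap.add_apply]
      ring
    · have hb' : ¬ ∃ ψ : Cell d m →₀ ZMod p,
          b + v.1 = inclMap p 1 d (m + 1) 0 (delta (ZMod p) d m ψ) := by
        rintro ⟨ψ, hψ⟩
        refine hb ⟨ψ - φ, ?_⟩
        rw [map_sub, map_sub, ← hψ, ← hφ, add_sub_cancel_right]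
      rw [← exists_isPotential_iff] at hb hb'
      rw [gaugedState_eq_zero _ hb, gaugedState_eq_zero _ hb', mul_zero, mul_zero]

/-- The polarization is symmetric in the two potentials, so the two halves of the commutator agree.
-/
theorem symp_eq_zero_of_mem_stabilizer [NeZero p] (hd : d = 2 * m + 1) (k : ZMod p)
    {v w : Pauli p 1 d (m + 1)}
    (hv : v ∈ stabilizer (gaugedState (m := m) (Matrix.of fun (_ _ : Fin 1) => k)))
    (hw : w ∈ stabilizer (gaugedState (m := m) (Matrix.of fun (_ _ : Fin 1) => k))) :
    symp v w = 0 := by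
  obtain ⟨φ, h1, h2⟩ := (mem_stabilizer_gaugedState_iff hd k v).1 hv
  obtain ⟨ψ, h3, h4⟩ := (mem_stabilizer_gaugedState_iff hd k w).1 hw
  rw [symp_eq_dot, dot_comm, h1, h3, h2, h4]
  ring

theorem hamiltonianGroup_subset_stabilizer [NeZero p] (hd : d = 2 * m + 1) (hm : Odd m)
    (k : ZMod p) : (hamiltonianGroup p d m k : Set (Pauli p 1 d (m + 1))) ⊆
      stabilizer (gaugedState (m := m) (Matrix.of fun (_ _ : Fin 1) => k)) := by
  intro v hv
  rw [SetLike.mem_coe, hamiltonianGroup_eq, Submodule.mem_sup] at hv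
  obtain ⟨_, ⟨h, rfl⟩, _, ⟨φ, rfl⟩, rfl⟩ := hv
  rw [mem_stabilizer_gaugedState_iff hd]
  refine ⟨φ, ?_, fun ψ => ?_⟩
  · rw [zBoundaryMap_apply, gaugeMap_apply, Prod.mk_add_mk, zero_add]
  · rw [zBoundaryMap_apply, gaugeMap_apply, Prod.mk_add_mk, ← map_add, dot_inclMap,
      fieldMap_inclMap]
    simp only [map_add, map_smul, LinearMap.add_apply, LinearMap.smul_apply, smul_eq_mul]
    rw [dot_boundary, delta_delta, map_zero, dot_cupRight, dot_comm (cupLeft _ _ _ _ _ _),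
      dot_cupLeft, cupForm_delta_of_odd hd hm]
    ring

/-- The image of the group of all `Z` operators under a symplectic automorphism is maximal among the
isotropic groups. -/
theorem subset_image_zGroup_of_isotropic {N n : ℕ} {α : PauliAut p N d n} (hα : IsSymplectic α)
    {S : Set (Pauli p N d n)} (hS : ∀ v ∈ S, ∀ w ∈ S, symp v w = 0)
    (h : α '' (zGroup p N d n : Set (Pauli p N d n)) ⊆ S) :
    S ⊆ α '' (zGroup p N d n : Set (Pauli p N d n)) := by
  intro v hv
  obtain ⟨u, rfl⟩ := α.surjective v
  refine ⟨u, ?_, rfl⟩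
  -- Commuting with the image of every `Z_s` forces the preimage to have no `X` part.
  have h1 : u.1 = 0 := by
    ext s
    have hs : Z s ∈ (zGroup p N d n : Set (Pauli p N d n)) := Submodule.subset_span ⟨s, rfl⟩
    have := hS _ hv _ (h ⟨_, hs, rfl⟩)
    rw [hα, symp_eq_dot, Z, dot_single_right, map_zero, mul_one, sub_zero] at this
    exact this
  have h2 : u = LinearMap.inr (ZMod p) (Site N d n →₀ ZMod p) (Site N d n →₀ ZMod p) u.2 :=
    Prod.ext h1 rfl
  rw [h2, ← finsum_smul_map_single u.2, finsum_smul_eq_linearCombination,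
    Finsupp.linearCombination_apply]
  exact Submodule.sum_mem _ fun s _ => Submodule.smul_mem _ _ (Submodule.subset_span ⟨s, rfl⟩)

theorem exists_disentangling_qca [Fact p.Prime] (hp : p ≠ 2) {l : ℕ} (hd : d + 1 = 4 * l)
    (hm : m + 1 = 2 * l) {k : ZMod p} (hk : k ≠ 0) :
    ∃ α : PauliAut p 1 d (m + 1),
      (∀ s : Cell d (m + 1), α (Z (0, s)) = separator k s) ∧
      (∀ s : Cell d (m + 1), α (X (0, s)) = flipper k s) ∧
      IsCliffordQCA α ∧
      (zGroup p 1 d (m + 1)).map α.toLinearMap = hamiltonianGroup p d m k ∧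
      (hamiltonianGroup p d m k : Set (Pauli p 1 d (m + 1))) =
        stabilizer (gaugedState (Matrix.of fun _ _ => k)) ∧
      Disentangles α (gaugedState (Matrix.of fun _ _ => k)) := by
  have hd' : d = 2 * m + 1 := by omega
  -- `m + 1 = 2 * l` forces `l ≥ 1`, so the subtraction is not truncated.
  have hm' : Odd m := ⟨l - 1, by omega⟩
  have hq := isCliffordQCA_separatorAut (d := d) (m := m) hp hd' hm' hk
  have hmap := map_zGroup_eq_hamiltonianGroup hp hd' hm' hk
  have himg : separatorAut (d := d) (m := m) hp hd' hm' hk ''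
      (zGroup p 1 d (m + 1) : Set (Pauli p 1 d (m + 1))) = hamiltonianGroup p d m k :=
    congrArg SetLike.coe hmap
  have hS := hamiltonianGroup_subset_stabilizer hd' hm' k
  have heq : (hamiltonianGroup p d m k : Set (Pauli p 1 d (m + 1))) =
      stabilizer (gaugedState (Matrix.of fun _ _ => k)) := by
    -- The reverse inclusion is maximality: the Hamiltonian group is the image of the Lagrangian
    -- `zGroup`, and the stabilizer group containing it is isotropic.
    refine hS.antisymm ?_
    rw [← himg] at hS ⊢
    exact subset_image_zGroup_of_isotropic hq.1
      (fun v hv w hw => symp_eq_zero_of_mem_stabilizer hd' k hv hw) hS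
  exact ⟨separatorAut hp hd' hm' hk, separatorMap_Z k, separatorMap_X hk, hq, hmap, heq, hq,
    himg.trans heq⟩

end

end CupQCA

end

/-! ### The main theorem -/

theorem mainTheorem4 (p : ℕ) [Fact p.Prime] (hp : p ≠ 2) (R : Type*) [CommRing R] :
    -- The coboundary formulas of the (higher) cup products on hypercubic lattices: for degrees
    -- raised by two the signs are the same.
    ((∀ (d q₁ q₂ : ℕ) (a : Cochain d q₁ R) (b : Cochain d q₂ R),
        coboundary (cup 0 a b : Cochain d (q₁ + q₂) R) =
          cup 0 (coboundary a) b + (-1 : ℤ) ^ q₁ • cup 0 a (coboundary b)) ∧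
      (∀ d i q₁ q₂ : ℕ,
        CupRelation d R i q₁ q₂
          ((-1) ^ q₁) ((-1) ^ (q₁ + q₂ + (i + 1))) ((-1) ^ (q₁ * q₂ + q₁ + q₂)) ∧
        CupRelation d R i (q₁ + 2) (q₂ + 2)
          ((-1) ^ q₁) ((-1) ^ (q₁ + q₂ + (i + 1))) ((-1) ^ (q₁ * q₂ + q₁ + q₂)))) ∧
    -- The gauged ground state is well defined.
    (∀ (N d m : ℕ), d = 2 * m + 1 → ∀ (K : Matrix (Fin N) (Fin N) (ZMod p))
      (φ : Site N d m →₀ ZMod p) (a : Site N d (m + 1) →₀ ZMod p), IsPotential φ a →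
        gaugedState K a = ZMod.stdAddChar (boundaryAction K φ)) ∧
    -- Spatial dimension `d = 4 l - 1`, fields of degree `m + 1 = 2 l`: the separators and flippers
    -- define a Clifford QCA that disentangles the ground state of the gauged action `(k/p) A ∪ A`.
    (∀ (l d m : ℕ), 1 ≤ l → d + 1 = 4 * l → m + 1 = 2 * l → ∀ k : ZMod p, k ≠ 0 →
      ∃ α : PauliAut p 1 d (m + 1),
        (∀ s : Cell d (m + 1), α (Z (0, s)) = separator k s) ∧
        (∀ s : Cell d (m + 1), α (X (0, s)) = flipper k s) ∧
        IsCliffordQCA α ∧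
        (zGroup p 1 d (m + 1)).map α.toLinearMap = hamiltonianGroup p d m k ∧
        (hamiltonianGroup p d m k : Set (Pauli p 1 d (m + 1))) =
          stabilizer (gaugedState (Matrix.of fun _ _ => k)) ∧
        Disentangles α (gaugedState (Matrix.of fun _ _ => k))) ∧
    -- `(k/p) A ∪ A = δ ((k (p - 1) / 2)/p A ∪_1 A)` for cocycles `A` of degree `2 l + 1`.
    (∀ (d l : ℕ) (k : ZMod p) (A : Cochain d (2 * l + 1) (ZMod p)), coboundary A = 0 →
      (fun c => ZMod.toAddCircle (k * (cup 0 A A : Cochain d (4 * l + 1 + 1) (ZMod p)) c)) =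
        coboundary (fun c => ZMod.toAddCircle
          (k * (((p - 1) / 2 : ℕ) : ZMod p) *
            (cup 1 A A : Cochain d (4 * l + 1) (ZMod p)) c))) ∧
    -- Spatial dimension `d = 4 l + 1`, fields of degree `m + 1 = 2 l + 1`: the QCA of
    -- `(k/p) A ∪ A` is a Clifford circuit, and the presence of this term in an action changes
    -- the disentangling QCAs by this circuit only.
    (∀ (l d m : ℕ), d = 4 * l + 1 → m = 2 * l → ∀ (k : ZMod p) (N : ℕ) (i : Fin N),
      ∃ θ ∈ cliffordCircuits p N d (m + 1),
        (∀ v : Pauli p N d (m + 1), ∃ c : ℂ, ‖c‖ = 1 ∧ ∀ Ψ : State p N d (m + 1),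
          cupOneCircuit (k * (((p - 1) / 2 : ℕ) : ZMod p)) i (pauliOp v Ψ) =
            c • pauliOp (θ v) (cupOneCircuit (k * (((p - 1) / 2 : ℕ) : ZMod p)) i Ψ)) ∧
        ∀ K : Matrix (Fin N) (Fin N) (ZMod p),
          cupOneCircuit (k * (((p - 1) / 2 : ℕ) : ZMod p)) i (gaugedState (m := m) (d := d) K) =
            gaugedState (K + Matrix.single i i k) ∧
          θ '' stabilizer (gaugedState K) = stabilizer (gaugedState (K + Matrix.single i i k)) ∧
          ∀ α : PauliAut p N d (m + 1),
            Disentangles α (gaugedState K) ↔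
              Disentangles (θ * α) (gaugedState (K + Matrix.single i i k))) := by
  refine ⟨⟨fun d q₁ q₂ a b => coboundary_cup_zero a b, fun d i q₁ q₂ =>
    ⟨cupRelation d R i q₁ q₂, cupRelation_add_two d R i q₁ q₂⟩⟩,
    fun N d m hd K φ a h => gaugedState_eq hd K h,
    fun l d m _ hd hm k hk => exists_disentangling_qca hp hd hm hk,
    fun d l k A hA => toAddCircle_cup_self hp k A hA,
    fun l d m hd hm k N i => exists_circuit hp hd hm k i⟩
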